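/- A \emph{discrete p.m.p. groupoid} is a pair $(\mathcal{G},\mu^0)$ where $\mathcal{G}$ is a groupoid such that $\mathcal{G}$ and its unit space $\mathcal{G}^0$ are standard Borel spaces, the source map $s$, range map $r$, unit inclusion, multiplication and inversion are Borel, $s$ and $r$ are countable-to-one, and $\mu^0$ is a Borel probability measure on $\mathcal{G}^0$ such that $\int c^r_x\,d\mu^0(x)=\int c^s_x\,d\mu^0(x)=:\mu^1$, where $c^r_x$, $c^s_x$ are the counting measures on $r^{-1}(x)$, $s^{-1}(x)$. Products $gh$ are defined when $s(g)=r(h)$. A \emph{subgroupoid} is a Borel subset closed under products and inverses; for a subgroupoid $\mathcal{L}$, $\mathcal{L}^0$ denotes the set of units in $\mathcal{L}$ and, for $A\subseteq\mathcal{G}^0$, $\mathcal{L}_A=\{g\in\mathcal{L}: s(g),r(g)\in A\}$. A \emph{partial bisection} is a Borel set $\sigma\subseteq\mathcal{G}$ on which $r$ and $s$ are injective; it is a \emph{bisection}, written $\sigma\in[\mathcal{G}]$, if moreover $r(\sigma)$ and $s(\sigma)$ are $\mu^0$-conull. For $D\subseteq\mathcal{G}$ put $D^{-1}=\{g^{-1}:g\in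 D\}$ and $D^\sigma=\sigma^{-1}D\sigma$. A subgroupoid $\mathcal{L}$ is \emph{amenable} if there are Borel functions $f_n:\mathcal{L}\to[0,1]$ with $\sum_{w\in\mathcal{L},\,r(w)=x}f_n(w)=1$ for all $n$ and $\mu^0$-a.e. $x\in\mathcal{L}^0$, and $\sum_{w\in\mathcal{L},\,r(w)=r(g)}|f_n(w)-f_n(g^{-1}w)|\to0$ for $\mu^1$-a.e. $g\in\mathcal{L}$. It is \emph{nowhere amenable} if $\mathcal{L}_A$ is not amenable for every Borel $A\subseteq\mathcal{G}^0$ with $\mu^0(A)>0$. $\mathcal{G}$ is \emph{inner amenable} if there is a norm one positive linear functional $m$ on $L^\infty(\mathcal{G},\mu^1)$ such that, writing $m(D)=m(1_D)$: (1) $m(\mathcal{G}_A)=\mu^0(A)$ for all measurable $A\subseteq\mathcal{G}^0$; (2) $m(D^\sigma)=m(D)$ for all measurable $D\subseteq\mathcal{G}$ and all $\sigma\in[\mathcal{G}]$; (3) $m(D)=0$ for all measurable $D\subseteq\mathcal{G}$ with $\mu^1(D)<\infty$; (4) $m(D)=m(D^{-1})$ for all measurable $D\subseteq\mathcal{G}$.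 A set $D\subseteq\mathcal{G}$ is \emph{aperiodic on} $B\subseteq\mathcal{G}^0$ if $s^{-1}(x)\cap D$ is infinite for $\mu^0$-a.e. $x\in B$, and \emph{aperiodic} if this holds with $B=\mathcal{G}^0$. For subgroupoids $\mathcal{L}\subseteq\mathcal{M}$, $\mathcal{L}$ is \emph{q-normal} in $\mathcal{M}$ if there is a countable collection $\Sigma$ of partial bisections contained in $\mathcal{M}$ such that, with $S=\bigcup\Sigma$, the set $\bigcup_{n\ge1}(S\cup S^{-1})^n$ contains $\mu^1$-almost every element of $\mathcal{M}$, and such that for every $\sigma\in\Sigma$ the set $\mathcal{L}^\sigma\cap\mathcal{L}$ is aperiodic on $s(\sigma)$. \textbf{Theorem.} Let $(\mathcal{G},\mu^0)$ be an inner amenable discrete p.m.p. groupoid and let $\mathcal{H}\le\mathcal{G}$ be a nowhere amenable subgroupoid. Then there is a subgroupoid $\mathcal{K}$ with $\mathcal{H}\le\mathcal{K}\le\mathcal{G}$ such that $\mathcal{H}$ is q-normal in $\mathcal{K}$, $\mathcal{K}$ is q-normal in $\mathcal{G}$, and, for every $n\in\mathbb{N}$ and all bisections $\sigma_1,\dots,\sigma_n\in[\mathcal{G}]$,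 the set $\mathcal{K}\cap\mathcal{K}^{\sigma_1}\cap\dots\cap\mathcal{K}^{\sigma_n}$ is aperiodic. -/

import Mathlib

open MeasureTheory CategoryTheory Filter Topology
open scoped ENNReal

namespace PMPGroupoid

universe v u

/-! A groupoid with unit space `X` is a `CategoryTheory.Groupoid X`; its set of elements is the
set `Elt X` of all arrows. An arrow `x ⟶ y` has source `x` and range `y`, and the
product `g * h`, defined when the source of `g` is the range of `h`, is `h ≫ g`. -/

section Algebra

variable {X : Type u} [Groupoid.{v} X]

/-- The set of all elements (arrows) of the groupoid. -/
abbrev Elt (X : Type u) [Groupoid.{v} X] : Type max u v := Quiver.Total.{v, u} X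

/-- The source map. -/
def src (g : Elt X) : X := g.left

/-- The range map. -/
def rng (g : Elt X) : X := g.right

/-- The inclusion of the unit space. -/
def unit (x : X) : Elt X := ⟨x, x, 𝟙 x⟩

/-- The inverse of an element. -/
def inv (g : Elt X) : Elt X := ⟨g.right, g.left, Groupoid.inv g.hom⟩

/-- The product `g h` of two elements with `src g = rng h`. -/
def mul (g h : Elt X) (e : src g = rng h) : Elt X :=
  ⟨h.left, g.right, h.hom ≫ eqToHom e.symm ≫ g.hom⟩

/-- `A⁻¹ = {g⁻¹ | g ∈ A}`. -/
def setInv (A : Set (Elt X)) : Set (Elt X) := inv '' A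

/-- `A B = {g h | g ∈ A, h ∈ B, src g = rng h}`. -/
def setMul (A B : Set (Elt X)) : Set (Elt X) :=
  {k | ∃ g ∈ A, ∃ h ∈ B, ∃ e : src g = rng h, mul g h e = k}

/-- `D ^ σ = σ⁻¹ D σ`. When `σ` is a partial bisection this is the set of the elements `g ^ σ`, the
unique element of `σ⁻¹ g σ`, for those `g ∈ D` that have both range and source in `r(σ)`. -/
def conj (D σ : Set (Elt X)) : Set (Elt X) := setMul (setMul (setInv σ) D) σ

/-- `setPow A n` is the set of all products of `n + 1` elements of `A`. -/
def setPow (A : Set (Elt X)) : ℕ → Set (Elt X)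
  | 0 => A
  | n + 1 => setMul A (setPow A n)

/-- `⟨A⟩`, the union of the powers of `A ∪ A⁻¹` (with at least one factor). -/
def generatedSet (A : Set (Elt X)) : Set (Elt X) := ⋃ n, setPow (A ∪ setInv A) n

/-- The set of elements of a subgroupoid. -/
def elts (L : Subgroupoid X) : Set (Elt X) := {g | g.hom ∈ L.arrows g.left g.right}

end Algebra

section Measure

variable (X : Type u) [Groupoid.{v} X] [MeasurableSpace X] [MeasurableSpace (Elt X)]

/-- Discrete Borel groupoids. -/
structure IsDiscreteBorel : Prop where
  standardBorel_units : StandardBorelSpace X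
  standardBorel_elts : StandardBorelSpace (Elt X)
  measurable_src : Measurable (src : Elt X → X)
  measurable_rng : Measurable (rng : Elt X → X)
  measurable_unit : Measurable (unit : X → Elt X)
  measurable_inv : Measurable (inv : Elt X → Elt X)
  measurable_mul :
    Measurable fun p : {p : Elt X × Elt X // src p.1 = rng p.2} => mul p.1.1 p.1.2 p.2
  countable_src : ∀ x : X, {g : Elt X | src g = x}.Countable
  countable_rng : ∀ x : X, {g : Elt X | rng g = x}.Countable

variable {X}

/-- The measure `∫ c_x^s dμ`, where `c_x^s` is the counting measure on `s⁻¹(x)`. -/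
noncomputable def srcMeasure (μ : Measure X) : Measure (Elt X) :=
  μ.bind fun x => Measure.count.restrict {g : Elt X | src g = x}

/-- The measure `∫ c_x^r dμ`, where `c_x^r` is the counting measure on `r⁻¹(x)`. -/
noncomputable def rngMeasure (μ : Measure X) : Measure (Elt X) :=
  μ.bind fun x => Measure.count.restrict {g : Elt X | rng g = x}

/-- Discrete p.m.p. groupoids. The measure `μ¹` on the groupoid is `srcMeasure μ`. -/
structure IsDiscretePMP (μ : Measure X) : Prop extends IsDiscreteBorel X where
  prob : IsProbabilityMeasure μ
  rng_eq_src : rngMeasure μ = srcMeasure μ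

/-- Partial measurable bisections, the elements of the pseudogroup `[[𝒢]]`. -/
structure IsPartialBisection (σ : Set (Elt X)) : Prop where
  measurableSet : MeasurableSet σ
  src_injOn : Set.InjOn src σ
  rng_injOn : Set.InjOn rng σ

/-- Measurable bisections, the elements of the full group `[𝒢]`. -/
structure IsBisection (μ : Measure X) (σ : Set (Elt X)) : Prop extends IsPartialBisection σ where
  src_conull : ∀ᵐ x ∂μ, x ∈ src '' σ
  rng_conull : ∀ᵐ x ∂μ, x ∈ rng '' σ

/-- Amenability of the Borel subgroupoid `L`, with unit space `L.objs` and the measure on it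
obtained by restricting `μ`: the left translation action of `L` on itself is amenable. -/
def IsAmenable (μ : Measure X) (L : Subgroupoid X) : Prop :=
  ∃ f : ℕ → Elt X → ℝ,
    (∀ n, Measurable (f n)) ∧
    (∀ n g, f n g ∈ Set.Icc (0 : ℝ) 1) ∧
    (∀ n, ∀ᵐ x ∂μ, x ∈ L.objs →
      HasSum (fun w : {w : Elt X // w ∈ elts L ∧ rng w = x} => f n w) 1) ∧
    (∀ᵐ g ∂(srcMeasure μ), g ∈ elts L →
      Tendsto (fun n => ∑' w : {w : Elt X // w ∈ elts L ∧ rng w = rng g},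
        ENNReal.ofReal |f n w - f n (mul (inv g) w w.2.2.symm)|) atTop (𝓝 0))

/-- `L` is nowhere amenable: for every `A` of positive measure, the groupoid
`L_A = {g ∈ L | s(g), r(g) ∈ A}` is not amenable. -/
def NowhereAmenable (μ : Measure X) (L : Subgroupoid X) : Prop :=
  ∀ A : Set X, MeasurableSet A → 0 < μ A → ¬ IsAmenable μ (L ⊓ Subgroupoid.full A)

/-- The class of the indicator function of `D` in `L^∞(𝒢, ν)`. -/
noncomputable def indicatorLinf (ν : Measure (Elt X)) {D : Set (Elt X)} (hD : MeasurableSet D) :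
    Lp ℝ ∞ ν :=
  MemLp.toLp (D.indicator fun _ => (1 : ℝ)) ((memLp_top_const (1 : ℝ)).indicator hD)

/-- A mean on `(𝒢, ν)`: a norm one positive linear functional on `L^∞(𝒢, ν)`. -/
structure IsMean (ν : Measure (Elt X)) (m : Lp ℝ ∞ ν →L[ℝ] ℝ) : Prop where
  norm_eq_one : ‖m‖ = 1
  nonneg : ∀ f : Lp ℝ ∞ ν, 0 ≤ f → 0 ≤ m f

/-- Inner amenability of the discrete p.m.p. groupoid `(X, μ)`. The sets `𝒢_A`, `D ^ σ` and `D⁻¹`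
occurring here are automatically Borel. -/
def InnerAmenable (μ : Measure X) : Prop :=
  ∃ m : Lp ℝ ∞ (srcMeasure μ) →L[ℝ] ℝ, IsMean (srcMeasure μ) m ∧
    (∀ A : Set X, MeasurableSet A →
      ∀ h : MeasurableSet {g : Elt X | src g ∈ A ∧ rng g ∈ A},
        m (indicatorLinf (srcMeasure μ) h) = μ.real A) ∧
    (∀ (D : Set (Elt X)) (hD : MeasurableSet D) (σ : Set (Elt X)), IsBisection μ σ →
      ∀ h : MeasurableSet (conj D σ),
        m (indicatorLinf (srcMeasure μ) h) = m (indicatorLinf (srcMeasure μ) hD)) ∧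
    (∀ (D : Set (Elt X)) (hD : MeasurableSet D), srcMeasure μ D < ∞ →
      m (indicatorLinf (srcMeasure μ) hD) = 0) ∧
    (∀ (D : Set (Elt X)) (hD : MeasurableSet D) (h : MeasurableSet (setInv D)),
      m (indicatorLinf (srcMeasure μ) hD) = m (indicatorLinf (srcMeasure μ) h))

/-- `D` is aperiodic on `B ⊆ 𝒢⁰`: for almost every `x ∈ B`, the set `s⁻¹(x) ∩ D` is infinite. -/
def AperiodicOn (μ : Measure X) (D : Set (Elt X)) (B : Set X) : Prop :=
  ∀ᵐ x ∂μ, x ∈ B → {g : Elt X | src g = x ∧ g ∈ D}.Infinite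

/-- `D` is aperiodic: for almost every `x ∈ 𝒢⁰`, the set `s⁻¹(x) ∩ D` is infinite. -/
def Aperiodic (μ : Measure X) (D : Set (Elt X)) : Prop := AperiodicOn μ D Set.univ

/-- `L` is q-normal in `M`, where `L ≤ M` are Borel subgroupoids: there is a countable collection
of partial bisections of `M` that generates `M` (modulo a null set), such that `L ^ σ ∩ L` is
aperiodic on `s(σ)` for each of its members `σ`. -/
def QNormal (μ : Measure X) (L M : Subgroupoid X) : Prop :=
  L ≤ M ∧ ∃ S : Set (Set (Elt X)), S.Countable ∧
    (∀ σ ∈ S, IsPartialBisection σ ∧ σ ⊆ elts M) ∧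
    (∀ᵐ g ∂(srcMeasure μ), g ∈ elts M → g ∈ generatedSet (⋃₀ S)) ∧
    (∀ σ ∈ S, AperiodicOn μ (conj (elts L) σ ∩ elts L) (src '' σ))

end Measure

end PMPGroupoid

/-! The subgroupoid `K` is generated by `H` and the partial bisections that commensurate it. Up to a
null set, the groupoid is a countable disjoint union of partial bisections `σ n`, each inside `H` or
disjoint from it. Let `B n` be the set of the units `x` over which `H ^ σ n ∩ H` has infinite source
fibre, and restrict `σ n` to `B n` (if `σ n ⊆ H`, do not restrict it: a nowhere amenable groupoid
has infinite fibres over every set of positive measure). Let `K` be generated by these restrictions.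
Then `H` is q-normal in `K` by construction.

The main point is that every mean `m` witnessing inner amenability is concentrated on `K`. Almost
every element `g` outside `K` belongs to some `H t H` with `t ∈ σ n` and source of `t` outside `B n`. For
the least such `n`, the elements `w` of `H` with `g w ∈ H t` for such a `t` form a nonempty finite
subset of the range fibre of `H` at the source of `g`, and this set depends equivariantly on `g`
under multiplication by `H` from both sides. Suppose that the complement of `K` had positive mass.
Since `m` is invariant under conjugation by bisections in `H`, Day's convexity argument yields
integrable functions on the complement of `K` that are asymptotically invariant in `L¹` under
conjugation by `H`, and whose masses on the source fibres converge to the density of the restriction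
of `m` (`exists_almost_invariant`, `IsInvariantMean.exists_almost_invariant_seq`). Pushing them to
`H` by means of the finite sets and normalising shows that `H` is amenable over the set where that
density is positive (`IsInvariantMean.exists_isAmenable_of_equivariant`,
`IsInvariantMean.meanOf_compl_generatedSet`), a contradiction.

A set of full mean is aperiodic, since sets of finite measure have mass zero while the mass of
`src⁻¹ A` is the measure of `A` (`IsInvariantMean.aperiodic`). By conjugation invariance, every
finite intersection of conjugates of `K` by bisections has full mean and so is aperiodic. As the
groupoid is covered by countably many bisections up to a null set, `K` is q-normal in it.

Two tools are proved here in the form needed. The Lusin–Novikov theorem, that a countable-to-one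
Borel map is injective on each of countably many Borel sets that cover its domain, is proved modulo
null sets (`hasAeCover_univ`). The duality of `L¹` and `L^∞` is derived from that of `L²`
(`exists_bounded_density`). -/

namespace PMPGroupoid

/-! ### The partial product as a total operation -/

section Algebra

variable {X : Type*} [Groupoid X]

open Classical in
/-- The product of a groupoid as a total operation on its elements: `g * h` is `mul g h` when `src g
= rng h`, and the junk value `g` otherwise. -/
noncomputable instance : Mul (Elt X) := ⟨fun g h => if e : src g = rng h then mul g h e else g⟩

instance : Inv (Elt X) := ⟨inv⟩

theorem inv_eq (g : Elt X) : inv g = g⁻¹ := rfl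

theorem mul_def {g h : Elt X} (e : src g = rng h) : g * h = mul g h e := dif_pos e

@[simp] theorem src_unit (x : X) : src (unit x) = x := rfl

@[simp] theorem rng_unit (x : X) : rng (unit x) = x := rfl

@[simp] theorem src_inv (g : Elt X) : src g⁻¹ = rng g := rfl

@[simp] theorem rng_inv (g : Elt X) : rng g⁻¹ = src g := rfl

theorem src_mul {g h : Elt X} (e : src g = rng h) : src (g * h) = src h := by
  rw [mul_def e]; rfl

@[simp] theorem rng_mul (g h : Elt X) : rng (g * h) = rng g := by
  by_cases e : src g = rng h
  · rw [mul_def e]; rfl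
  · exact congrArg rng (dif_neg e)

theorem mk_mul_mk {a b c : X} (f : b ⟶ c) (g : a ⟶ b) :
    (⟨b, c, f⟩ : Elt X) * ⟨a, b, g⟩ = ⟨a, c, g ≫ f⟩ := by
  rw [mul_def (show src (⟨b, c, f⟩ : Elt X) = rng (⟨a, b, g⟩ : Elt X) from rfl)]
  change (⟨a, c, g ≫ eqToHom (rfl : b = b) ≫ f⟩ : Elt X) = _
  simp

theorem inv_mk {a b : X} (f : a ⟶ b) : (⟨a, b, f⟩ : Elt X)⁻¹ = ⟨b, a, Groupoid.inv f⟩ := rfl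

theorem elt_mul_assoc {g h k : Elt X} (e₁ : src g = rng h) (e₂ : src h = rng k) :
    g * h * k = g * (h * k) := by
  obtain ⟨a, b, g⟩ := g
  obtain ⟨c, d, h⟩ := h
  obtain ⟨p, q, k⟩ := k
  obtain rfl : a = d := e₁
  obtain rfl : c = q := e₂
  simp only [mk_mul_mk, Category.assoc]

@[simp] theorem elt_inv_inv (g : Elt X) : g⁻¹⁻¹ = g := by
  obtain ⟨a, b, g⟩ := g
  simp [inv_mk]

@[simp] theorem elt_inv_mul (g : Elt X) : g⁻¹ * g = unit (src g) := by
  obtain ⟨a, b, g⟩ := g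
  simp only [inv_mk, mk_mul_mk, Groupoid.comp_inv]; rfl

@[simp] theorem elt_mul_inv (g : Elt X) : g * g⁻¹ = unit (rng g) := by
  obtain ⟨a, b, g⟩ := g
  simp only [inv_mk, mk_mul_mk, Groupoid.inv_comp]; rfl

theorem unit_mul {x : X} {g : Elt X} (e : x = rng g) : unit x * g = g := by
  obtain ⟨a, b, g⟩ := g
  obtain rfl : x = b := e
  simp only [unit, mk_mul_mk, Category.comp_id]

theorem mul_unit {x : X} {g : Elt X} (e : src g = x) : g * unit x = g := by
  obtain ⟨a, b, g⟩ := g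
  obtain rfl : a = x := e
  simp only [unit, mk_mul_mk, Category.id_comp]

theorem elt_mul_inv_rev {g h : Elt X} (e : src g = rng h) : (g * h)⁻¹ = h⁻¹ * g⁻¹ := by
  obtain ⟨a, b, g⟩ := g
  obtain ⟨c, d, h⟩ := h
  obtain rfl : a = d := e
  simp [inv_mk, mk_mul_mk]

theorem inv_mul_cancel_left' {g h : Elt X} (e : src g = rng h) : g⁻¹ * (g * h) = h := by
  rw [← elt_mul_assoc (by simp) e, elt_inv_mul, unit_mul e]

theorem mul_inv_cancel_left' {g h : Elt X} (e : rng g = rng h) : g * (g⁻¹ * h) = h := by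
  rw [← elt_mul_assoc (by simp) (by simpa), elt_mul_inv, unit_mul e]

theorem mul_inv_cancel_right' {g h : Elt X} (e : src g = rng h) : g * h * h⁻¹ = g := by
  rw [elt_mul_assoc e (by simp), elt_mul_inv, mul_unit e]

theorem inv_mul_cancel_right' {g h : Elt X} (e : src g = src h) : g * h⁻¹ * h = g := by
  rw [elt_mul_assoc (by simpa) (by simp), elt_inv_mul, mul_unit e]

theorem mem_setInv {A : Set (Elt X)} {g : Elt X} : g ∈ setInv A ↔ g⁻¹ ∈ A := by
  constructor
  · rintro ⟨h, hh, rfl⟩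
    simpa [inv_eq] using hh
  · intro h
    exact ⟨g⁻¹, h, elt_inv_inv g⟩

theorem mem_setMul {A B : Set (Elt X)} {k : Elt X} :
    k ∈ setMul A B ↔ ∃ g ∈ A, ∃ h ∈ B, src g = rng h ∧ g * h = k := by
  constructor
  · rintro ⟨g, hg, h, hh, e, rfl⟩
    exact ⟨g, hg, h, hh, e, mul_def e⟩
  · rintro ⟨g, hg, h, hh, e, rfl⟩
    exact ⟨g, hg, h, hh, e, (mul_def e).symm⟩

/-- `k ∈ σ⁻¹ D σ` precisely when `b k a⁻¹ ∈ D` for some `a, b ∈ σ`. -/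
theorem mem_conj {D σ : Set (Elt X)} {k : Elt X} :
    k ∈ conj D σ ↔ ∃ a ∈ σ, ∃ b ∈ σ, src a = src k ∧ src b = rng k ∧ b * k * a⁻¹ ∈ D := by
  simp only [conj, mem_setMul, mem_setInv]
  constructor
  · rintro ⟨_, ⟨b, hb, d, hd, e₁, rfl⟩, a, ha, e₂, rfl⟩
    rw [src_mul e₁] at e₂
    refine ⟨a, ha, b⁻¹, hb, (src_mul (by rwa [src_mul e₁])).symm, by simp, ?_⟩
    rw [elt_mul_assoc e₁ e₂]
    rw [inv_mul_cancel_left' (by rw [rng_mul, e₁]), mul_inv_cancel_right' e₂]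
    exact hd
  · rintro ⟨a, ha, b, hb, e₁, e₂, h⟩
    have e₃ : src (b * k) = src a := by rw [src_mul e₂, e₁]
    refine ⟨b⁻¹ * (b * k * a⁻¹), ⟨b⁻¹, by simpa, _, h, by simp, rfl⟩, a, ha, ?_, ?_⟩
    · rw [src_mul (by simp), src_mul (by simpa), src_inv]
    · rw [elt_mul_assoc (by simp) (by rw [src_mul (by simpa), src_inv]),
        inv_mul_cancel_right' e₃, inv_mul_cancel_left' e₂]

theorem elts_mul {L : Subgroupoid X} {g h : Elt X} (hg : g ∈ elts L) (hh : h ∈ elts L)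
    (e : src g = rng h) : g * h ∈ elts L := by
  obtain ⟨a, b, g⟩ := g
  obtain ⟨c, d, h⟩ := h
  obtain rfl : a = d := e
  rw [mk_mul_mk]
  exact L.mul hh hg

theorem elts_inv {L : Subgroupoid X} {g : Elt X} (hg : g ∈ elts L) : g⁻¹ ∈ elts L := L.inv hg

theorem elts_inv_iff {L : Subgroupoid X} {g : Elt X} : g⁻¹ ∈ elts L ↔ g ∈ elts L :=
  ⟨fun h => by simpa using elts_inv h, elts_inv⟩

theorem unit_src_mem_elts {L : Subgroupoid X} {g : Elt X} (hg : g ∈ elts L) :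
    unit (src g) ∈ elts L := by
  rw [← elt_inv_mul]; exact elts_mul (elts_inv hg) hg (by simp)

theorem mem_objs_iff {L : Subgroupoid X} {x : X} : x ∈ L.objs ↔ unit x ∈ elts L :=
  ⟨fun h => L.id_mem_of_nonempty_isotropy x h, fun h => ⟨𝟙 x, h⟩⟩

/-- The subgroupoid with a prescribed set of elements closed under products and inverses. -/
def subgroupoidOf (K : Set (Elt X)) (hinv : ∀ g ∈ K, g⁻¹ ∈ K)
    (hmul : ∀ g ∈ K, ∀ h ∈ K, src g = rng h → g * h ∈ K) : Subgroupoid X where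
  arrows c d := {f | (⟨c, d, f⟩ : Elt X) ∈ K}
  inv hp := hinv _ hp
  mul := by
    intro c d e p hp q hq
    have := hmul _ hq _ hp rfl
    rwa [mk_mul_mk] at this

theorem le_iff_elts_subset {L M : Subgroupoid X} : L ≤ M ↔ elts L ⊆ elts M := by
  rw [Subgroupoid.le_iff]
  exact ⟨fun h g hg => h hg, fun h c d f hf => @h ⟨c, d, f⟩ hf⟩

theorem mem_elts_inf_full {L : Subgroupoid X} {A : Set X} {g : Elt X} :
    g ∈ elts (L ⊓ Subgroupoid.full A) ↔ g ∈ elts L ∧ src g ∈ A ∧ rng g ∈ A := by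
  obtain ⟨a, b, g⟩ := g
  change g ∈ L.arrows a b ∩ (Subgroupoid.full A).arrows a b ↔ _
  rw [Set.mem_inter_iff, Subgroupoid.mem_full_iff]
  rfl

@[simp] theorem elts_top : elts (⊤ : Subgroupoid X) = Set.univ := rfl

/-- Left multiplication by `g` is a bijection from the elements with range `s(g)` onto those with
range `r(g)`. -/
noncomputable def mulLeftEquiv (g : Elt X) :
    {w : Elt X // rng w = src g} ≃ {w : Elt X // rng w = rng g} where
  toFun w := ⟨g * w, by simp⟩
  invFun w := ⟨g⁻¹ * w, by simp⟩
  left_inv w := Subtype.ext (inv_mul_cancel_left' w.2.symm)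
  right_inv w := Subtype.ext (mul_inv_cancel_left' w.2.symm)

theorem setPow_mul {A : Set (Elt X)} {n m : ℕ} {g h : Elt X} (hg : g ∈ setPow A n)
    (hh : h ∈ setPow A m) (e : src g = rng h) : ∃ k, g * h ∈ setPow A k := by
  induction n generalizing g with
  | zero => exact ⟨m + 1, mem_setMul.2 ⟨g, hg, h, hh, e, rfl⟩⟩
  | succ n ih =>
    obtain ⟨a, ha, b, hb, e', rfl⟩ := mem_setMul.1 hg
    rw [src_mul e'] at e
    obtain ⟨k, hk⟩ := ih hb e
    exact ⟨k + 1, mem_setMul.2 ⟨a, ha, b * h, hk, by simpa, (elt_mul_assoc e' e).symm⟩⟩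

theorem generatedSet_mul {A : Set (Elt X)} {g h : Elt X} (hg : g ∈ generatedSet A)
    (hh : h ∈ generatedSet A) (e : src g = rng h) : g * h ∈ generatedSet A := by
  obtain ⟨n, hn⟩ := Set.mem_iUnion.1 hg
  obtain ⟨m, hm⟩ := Set.mem_iUnion.1 hh
  exact Set.mem_iUnion.2 (setPow_mul hn hm e)

theorem subset_generatedSet (A : Set (Elt X)) : A ⊆ generatedSet A :=
  fun _ hg => Set.mem_iUnion.2 ⟨0, Or.inl hg⟩

theorem generatedSet_inv {A : Set (Elt X)} {g : Elt X} (hg : g ∈ generatedSet A) :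
    g⁻¹ ∈ generatedSet A := by
  have base : ∀ g ∈ A ∪ setInv A, g⁻¹ ∈ generatedSet A := by
    rintro g (hg | hg)
    · exact Set.mem_iUnion.2 ⟨0, Or.inr (mem_setInv.2 (by simpa))⟩
    · exact subset_generatedSet A (mem_setInv.1 hg)
  obtain ⟨n, hn⟩ := Set.mem_iUnion.1 hg
  clear hg
  induction n generalizing g with
  | zero => exact base g hn
  | succ n ih =>
    obtain ⟨a, ha, b, hb, e, rfl⟩ := mem_setMul.1 hn
    rw [elt_mul_inv_rev e]
    exact generatedSet_mul (ih hb) (base a ha) (by simpa using e.symm)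

/-- A set of elements over an invariant set of units generates only elements over that set. -/
theorem generatedSet_src_mem {A : Set (Elt X)} {Y : Set X} (hY : ∀ g : Elt X, src g ∈ Y ↔ rng g ∈ Y)
    (hA : ∀ g ∈ A, src g ∈ Y) {g : Elt X} (hg : g ∈ generatedSet A) : src g ∈ Y := by
  obtain ⟨n, hn⟩ := Set.mem_iUnion.1 hg
  have base : ∀ g ∈ A ∪ setInv A, src g ∈ Y := by
    rintro g (hg | hg)
    · exact hA g hg
    · have := hA _ (mem_setInv.1 hg)
      rw [hY]; simpa using this
  cases n with
  | zero => exact base g hn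
  | succ n =>
    obtain ⟨a, ha, b, hb, e, rfl⟩ := mem_setMul.1 hn
    rw [hY, rng_mul, ← hY]
    exact base a ha

theorem setInv_setMul (A B : Set (Elt X)) : setInv (setMul A B) = setMul (setInv B) (setInv A) := by
  ext k
  simp only [mem_setInv, mem_setMul]
  constructor
  · rintro ⟨a, ha, b, hb, e, h⟩
    exact ⟨b⁻¹, by simpa, a⁻¹, by simpa, by simpa using e.symm, by
      rw [← elt_mul_inv_rev e, h, elt_inv_inv]⟩
  · rintro ⟨b, hb, a, ha, e, h⟩
    exact ⟨a⁻¹, ha, b⁻¹, hb, by simpa using e.symm, by rw [← elt_mul_inv_rev e, h]⟩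

theorem setInv_setInv (A : Set (Elt X)) : setInv (setInv A) = A := by
  ext g; simp [mem_setInv]

/-! ### Sections of the source map -/

open Classical in
/-- The element of a partial bisection `τ` with source `x`, or the unit at `x` if there is none. -/
noncomputable def sec (τ : Set (Elt X)) (x : X) : Elt X :=
  if h : ∃ g ∈ τ, src g = x then h.choose else unit x

theorem src_sec (τ : Set (Elt X)) (x : X) : src (sec τ x) = x := by
  unfold sec
  split_ifs with h
  · exact h.choose_spec.2
  · rfl

theorem sec_mem {τ : Set (Elt X)} {x : X} (h : x ∈ src '' τ) : sec τ x ∈ τ := by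
  unfold sec
  rw [dif_pos (show ∃ g ∈ τ, src g = x from h)]
  exact (show ∃ g ∈ τ, src g = x from h).choose_spec.1

theorem sec_of_notMem {τ : Set (Elt X)} {x : X} (h : x ∉ src '' τ) : sec τ x = unit x :=
  dif_neg h

/-- The inverse of a full section in the full group. -/
def invSection (φ : X → Elt X) (x : X) : Elt X := (φ (rng (φ x)))⁻¹

/-- The conjugation `g ↦ φ g φ⁻¹` of the groupoid by a full section. -/
noncomputable def conjMap (φ : X → Elt X) (g : Elt X) : Elt X := φ (rng g) * g * (φ (src g))⁻¹

theorem rng_conjMap (φ : X → Elt X) (g : Elt X) : rng (conjMap φ g) = rng (φ (rng g)) := by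
  simp [conjMap]

/-- The extension of a partial bisection `τ` by its inverse and by units. -/
noncomputable def extendSection (τ : Set (Elt X)) (x : X) : Elt X :=
  open Classical in if x ∈ src '' τ then sec τ x else sec (setInv τ) x

theorem extendSection_mem (τ : Set (Elt X)) (x : X) :
    extendSection τ x ∈ τ ∨ (extendSection τ x)⁻¹ ∈ τ ∨ extendSection τ x = unit x := by
  unfold extendSection
  split_ifs with h
  · exact Or.inl (sec_mem h)
  · by_cases h' : x ∈ src '' setInv τ
    · exact Or.inr (Or.inl (mem_setInv.1 (sec_mem h')))
    · exact Or.inr (Or.inr (sec_of_notMem h'))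

end Algebra

/-! ### Countable-to-one Borel maps modulo null sets -/

section CountableToOne

/-- Analytic sets are measured by every finite Borel measure. An analytic set is the image `f(ℕ^ℕ)`
of the Baire space; bounding one coordinate after the other loses arbitrarily little measure, and
leaves the image of a compact set. -/
theorem nullMeasurableSet_of_analyticSet {X : Type*} [TopologicalSpace X] [PolishSpace X]
    [MeasurableSpace X] [BorelSpace X] (μ : Measure X) [IsFiniteMeasure μ] {A : Set X}
    (hA : AnalyticSet A) : NullMeasurableSet A μ := by
  rw [AnalyticSet] at hA
  rcases hA with rfl | ⟨f, hf, rfl⟩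
  · exact MeasurableSet.empty.nullMeasurableSet
  let := TopologicalSpace.upgradeIsCompletelyMetrizable X
  have inner : ∀ c < μ (Set.range f), ∃ K ⊆ Set.range f, MeasurableSet K ∧ c ≤ μ K := by
    intro c hc
    have step : ∀ (k : ℕ) (D : {D : Set (ℕ → ℕ) // c < μ (f '' D)}),
        ∃ m : ℕ, c < μ (f '' (D.1 ∩ {x | x k ≤ m})) := by
      intro k D
      have hmono : Monotone fun m : ℕ => f '' (D.1 ∩ {x | x k ≤ m}) := fun a b hab =>
        Set.image_mono fun x hx => ⟨hx.1, le_trans hx.2 hab⟩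
      have hU : ⋃ m : ℕ, f '' (D.1 ∩ {x | x k ≤ m}) = f '' D.1 := by
        rw [← Set.image_iUnion, ← Set.inter_iUnion]
        congr 1
        ext x
        simp only [Set.mem_inter_iff, Set.mem_iUnion, Set.mem_ofPred_eq, and_iff_left_iff_imp]
        exact fun _ => ⟨x k, le_rfl⟩
      have := D.2
      rw [← hU, hmono.measure_iUnion] at this
      exact lt_iSup_iff.1 this
    choose m hm using step
    let Dseq : ℕ → {D : Set (ℕ → ℕ) // c < μ (f '' D)} := fun k =>
      Nat.rec ⟨Set.univ, by rwa [Set.image_univ]⟩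
        (fun k D => ⟨D.1 ∩ {x | x k ≤ m k D}, hm k D⟩) k
    let n : ℕ → ℕ := fun k => m k (Dseq k)
    have hD : ∀ k, ∀ y ∈ (Dseq k).1, ∀ i < k, y i ≤ n i := by
      intro k
      induction k with
      | zero => intro y _ i hi; omega
      | succ k ih =>
        intro y hy i hi
        rcases Nat.lt_succ_iff_lt_or_eq.1 hi with h | rfl
        · exact ih y hy.1 i h
        · exact hy.2
    let K : Set (ℕ → ℕ) := Set.pi Set.univ fun i => Set.Iic (n i)
    have hK : IsCompact K := isCompact_univ_pi fun i => (Set.finite_Iic _).isCompact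
    refine ⟨f '' K, Set.image_subset_range _ _, (hK.image hf).isClosed.measurableSet, ?_⟩
    rw [Set.measure_eq_iInf_isOpen]
    refine le_iInf fun U => le_iInf fun hKU => le_iInf fun hU => ?_
    by_contra hlt
    have hex : ∀ k, ∃ y ∈ (Dseq k).1, f y ∉ U := by
      intro k
      by_contra! h
      exact hlt ((Dseq k).2.le.trans (measure_mono (Set.image_subset_iff.2 h)))
    choose y hy hyU using hex
    -- `y k` agrees in its first `k` coordinates with a point of the compact set `K`.
    obtain ⟨x, -, φ, hφ, hx⟩ := hK.tendsto_subseq (x := fun k i => if i < k then y k i else 0)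
      (by
        intro k i _
        by_cases h : i < k
        · simpa [h] using hD k _ (hy k) i h
        · simp [h])
    have hxK : x ∈ K := hK.isClosed.mem_of_tendsto hx (Eventually.of_forall fun k => by
        intro i _
        by_cases h : i < φ k
        · simpa [h] using hD _ _ (hy _) i h
        · simp [h])
    have hy' : Tendsto (fun k => y (φ k)) atTop (𝓝 x) := by
      rw [tendsto_pi_nhds] at hx ⊢
      intro i
      refine (hx i).congr' ?_
      filter_upwards [eventually_gt_atTop i] with k hk
      simp [lt_of_lt_of_le hk (hφ.id_le k)]
    have := ((hf.tendsto x).comp hy').eventually (hU.mem_nhds (hKU ⟨x, hxK, rfl⟩))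
    obtain ⟨k, hk⟩ := this.exists
    exact hyU _ hk
  rcases eq_or_ne (μ (Set.range f)) 0 with h0 | h0
  · exact NullMeasurableSet.of_null h0
  obtain ⟨u, -, hu, hlim⟩ := exists_seq_strictMono_tendsto' (pos_iff_ne_zero.2 h0)
  choose K hKsub hKm hKle using fun k => inner (u k) (hu k).2
  have hle : μ (Set.range f) ≤ μ (⋃ k, K k) :=
    le_of_tendsto' hlim fun k => (hKle k).trans (measure_mono (Set.subset_iUnion _ _))
  exact (MeasurableSet.iUnion hKm).nullMeasurableSet.congr
    (ae_eq_of_subset_of_measure_ge (Set.iUnion_subset hKsub) hle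
      (MeasurableSet.iUnion hKm).nullMeasurableSet (measure_ne_top _ _))

/-- A family of measurable sets closed under countable unions has a member that contains every other
one up to a null set. -/
theorem exists_ae_maximal {X : Type*} [MeasurableSpace X] (μ : Measure X) [IsFiniteMeasure μ]
    (Q : Set X → Prop) (h0 : Q ∅) (hU : ∀ Y : ℕ → Set X, (∀ n, Q (Y n)) → Q (⋃ n, Y n)) :
    ∃ Y, MeasurableSet Y ∧ Q Y ∧ ∀ Z, MeasurableSet Z → Q Z → μ (Z \ Y) = 0 := by
  let T : Set ℝ≥0∞ := {a | ∃ Y, MeasurableSet Y ∧ Q Y ∧ μ Y = a}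
  obtain ⟨u, -, hlim, hu⟩ := exists_seq_tendsto_sSup (S := T)
    ⟨_, ∅, MeasurableSet.empty, h0, rfl⟩ (OrderTop.bddAbove _)
  choose Y hYm hYQ hYu using hu
  have hYm' : MeasurableSet (⋃ n, Y n) := MeasurableSet.iUnion hYm
  refine ⟨⋃ n, Y n, hYm', hU Y hYQ, fun Z hZ hQZ => ?_⟩
  have hle : sSup T ≤ μ (⋃ n, Y n) := le_of_tendsto' hlim fun n => by
    rw [← hYu]; exact measure_mono (Set.subset_iUnion _ _)
  have hQ2 : Q (⋃ n, (if n = 0 then Z else ⋃ n, Y n)) := hU _ fun n => by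
    split_ifs
    · exact hQZ
    · exact hU Y hYQ
  have heq : ⋃ n : ℕ, (if n = 0 then Z else ⋃ n, Y n) = (⋃ n, Y n) ∪ Z := by
    apply subset_antisymm
    · refine Set.iUnion_subset fun n => ?_
      split_ifs
      · exact Set.subset_union_right
      · exact Set.subset_union_left
    · exact Set.union_subset (Set.subset_iUnion_of_subset 1 (by simp))
        (Set.subset_iUnion_of_subset 0 (by simp))
  rw [heq] at hQ2
  have h1 : μ ((⋃ n, Y n) ∪ Z) ≤ sSup T := le_sSup ⟨_, hYm'.union hZ, hQ2, rfl⟩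
  rw [← Set.union_sdiff_self, measure_union Set.disjoint_sdiff_right (hZ.diff hYm')] at h1
  have h2 : μ (⋃ n, Y n) + μ (Z \ ⋃ n, Y n) ≤ μ (⋃ n, Y n) + 0 := by
    rw [add_zero]; exact h1.trans hle
  exact le_antisymm ((ENNReal.add_le_add_iff_left (measure_ne_top _ _)).1 h2) bot_le

/-- A nonempty countable closed set in a Polish space has an isolated point. -/
theorem exists_isolated_of_countable {G : Type*} [TopologicalSpace G] [PolishSpace G] {F : Set G}
    (hF : IsClosed F) (hc : F.Countable) (hne : F.Nonempty) :
    ∃ x ∈ F, ∃ U ∈ 𝓝 x, ∀ y ∈ U ∩ F, y = x := by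
  by_contra! h
  let := TopologicalSpace.upgradeIsCompletelyMetrizable G
  have hp : Perfect F := ⟨hF, preperfect_iff_nhds.2 h⟩
  obtain ⟨f, hf, -, hinj⟩ := hp.exists_nat_bool_injection hne
  have hc' : (Set.range f).Countable := hc.mono hf
  have : Countable (ℕ → Bool) := by
    have := hc'.to_subtype
    exact (Set.rangeFactorization_injective.2 hinj).countable
  have h1 := Cardinal.mk_le_aleph0_iff.2 this
  rw [Cardinal.mk_pi] at h1
  simp only [Cardinal.mk_bool, Cardinal.prod_const, Cardinal.lift_id, Cardinal.mk_nat] at h1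
  exact absurd h1 (not_le.2 (by simpa using Cardinal.cantor Cardinal.aleph0))

/-- The set of points with exactly one preimage in a Borel set is measured by every finite measure.
-/
theorem nullMeasurableSet_existsUnique {G X : Type*} [MeasurableSpace G] [MeasurableSpace X]
    [TopologicalSpace G] [PolishSpace G] [BorelSpace G] [TopologicalSpace X] [PolishSpace X]
    [BorelSpace X] (μ : Measure X) [IsFiniteMeasure μ] {s : G → X} (hs : Measurable s)
    {D : Set G} (hD : MeasurableSet D) : NullMeasurableSet {x | ∃! g, g ∈ D ∧ s g = x} μ := by
  have him : ∀ D : Set G, MeasurableSet D → NullMeasurableSet (s '' D) μ := fun D hD =>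
    nullMeasurableSet_of_analyticSet μ (hD.analyticSet_image hs)
  obtain ⟨b, hbc, -, hb⟩ := TopologicalSpace.exists_countable_basis G
  have := hbc.to_subtype
  have heq : {x | ∃! g, g ∈ D ∧ s g = x} = s '' D \
      ⋃ (U : b) (V : b) (_ : Disjoint U.1 V.1), s '' (D ∩ U) ∩ s '' (D ∩ V) := by
    ext x
    simp only [Set.mem_ofPred_eq, Set.mem_sdiff, Set.mem_iUnion, not_exists]
    constructor
    · rintro ⟨g, ⟨hg, rfl⟩, huniq⟩
      refine ⟨⟨g, hg, rfl⟩, ?_⟩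
      rintro U V hUV ⟨⟨g₁, h₁, e₁⟩, ⟨g₂, h₂, e₂⟩⟩
      have : g₁ = g₂ := (huniq g₁ ⟨h₁.1, e₁⟩).trans (huniq g₂ ⟨h₂.1, e₂⟩).symm
      exact Set.disjoint_left.1 hUV h₁.2 (this ▸ h₂.2)
    · rintro ⟨⟨g, hg, rfl⟩, h⟩
      refine ⟨g, ⟨hg, rfl⟩, fun g' hg' => ?_⟩
      by_contra hne
      obtain ⟨U, V, hU, hV, hgU, hgV, hUV⟩ := t2_separation hne
      obtain ⟨U', hU'b, hgU', hU'⟩ := hb.exists_subset_of_mem_open hgU hU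
      obtain ⟨V', hV'b, hgV', hV'⟩ := hb.exists_subset_of_mem_open hgV hV
      exact h ⟨U', hU'b⟩ ⟨V', hV'b⟩ (hUV.mono hU' hV')
        ⟨⟨g', ⟨hg'.1, hgU'⟩, hg'.2⟩, ⟨g, ⟨hg, hgV'⟩, rfl⟩⟩
  rw [heq]
  refine (him D hD).diff (NullMeasurableSet.iUnion fun U => NullMeasurableSet.iUnion fun V =>
    NullMeasurableSet.iUnion fun _ => ?_)
  exact (him _ (hD.inter (hb.isOpen U.2).measurableSet)).inter
    (him _ (hD.inter (hb.isOpen V.2).measurableSet))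

/-- `HasAeCover μ s W` says that almost every fibre of `W` is covered by countably many Borel sets
on each of which `s` is injective. -/
def HasAeCover {G X : Type*} [MeasurableSpace G] [MeasurableSpace X] (μ : Measure X) (s : G → X)
    (W : Set G) : Prop :=
  ∃ S : ℕ → Set G, (∀ n, MeasurableSet (S n) ∧ Set.InjOn s (S n)) ∧
    ∀ᵐ x ∂μ, ∀ g ∈ W, s g = x → ∃ n, g ∈ S n

theorem HasAeCover.mono {G X : Type*} [MeasurableSpace G] [MeasurableSpace X] {μ : Measure X}
    {s : G → X} {V W : Set G} (h : HasAeCover μ s W) (hVW : V ⊆ W) : HasAeCover μ s V := by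
  obtain ⟨S, hS, h⟩ := h
  exact ⟨S, hS, h.mono fun x hx g hg => hx g (hVW hg)⟩

theorem HasAeCover.iUnion {G X : Type*} [MeasurableSpace G] [MeasurableSpace X] {μ : Measure X}
    {s : G → X} {W : ℕ → Set G} (h : ∀ n, HasAeCover μ s (W n)) :
    HasAeCover μ s (⋃ n, W n) := by
  choose S hS h using h
  refine ⟨fun n => S n.unpair.1 n.unpair.2, fun n => hS _ _, ?_⟩
  filter_upwards [ae_all_iff.2 h] with x hx g hg e
  obtain ⟨n, hn⟩ := Set.mem_iUnion.1 hg
  obtain ⟨k, hk⟩ := hx n g hn e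
  exact ⟨Nat.pair n k, by simpa using hk⟩

theorem HasAeCover.union {G X : Type*} [MeasurableSpace G] [MeasurableSpace X] {μ : Measure X}
    {s : G → X} {V W : Set G} (hV : HasAeCover μ s V) (hW : HasAeCover μ s W) :
    HasAeCover μ s (V ∪ W) := by
  refine (HasAeCover.iUnion (W := fun n => if n = 0 then V else W) fun n => ?_).mono ?_
  · split_ifs
    exacts [hV, hW]
  · exact Set.union_subset (Set.subset_iUnion_of_subset 0 (by simp))
      (Set.subset_iUnion_of_subset 1 (by simp))

/-- A countable-to-one continuous map of Polish spaces is injective on each of countably many Borel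
sets that together cover almost every fibre. Of each basic open set a part over a maximal set of
base points is covered; what is left of a fibre is closed, countable and, by maximality, without
isolated points, hence empty. -/
theorem hasAeCover_univ_of_continuous {G X : Type*} [MeasurableSpace G] [MeasurableSpace X]
    [TopologicalSpace G] [PolishSpace G] [BorelSpace G] [TopologicalSpace X] [PolishSpace X]
    [BorelSpace X] (μ : Measure X) [IsFiniteMeasure μ] {s : G → X} (hs : Continuous s)
    (hc : ∀ x, {g | s g = x}.Countable) : HasAeCover μ s Set.univ := by
  obtain ⟨b, hbc, -, hb⟩ := TopologicalSpace.exists_countable_basis G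
  have hb' : (insert ∅ b).Countable := hbc.insert ∅
  obtain ⟨U, hU⟩ := hb'.exists_eq_range (Set.insert_nonempty _ _)
  have hUo : ∀ n, IsOpen (U n) := by
    intro n
    have : U n ∈ insert ∅ b := hU ▸ Set.mem_range_self n
    rcases this with h | h
    · rw [h]; exact isOpen_empty
    · exact hb.isOpen h
  have hempty : HasAeCover μ s ∅ :=
    ⟨fun _ => ∅, fun _ => ⟨MeasurableSet.empty, Set.injOn_empty s⟩, by simp⟩
  choose Y hYm hYc hYmax using fun n => exists_ae_maximal μ
    (fun Y => HasAeCover μ s (U n ∩ s ⁻¹' Y)) (by simpa using hempty)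
    (fun Y hY => by simpa only [Set.preimage_iUnion, Set.inter_iUnion] using HasAeCover.iUnion hY)
  let W : Set G := ⋃ n, U n ∩ s ⁻¹' Y n
  have hWc : HasAeCover μ s W := HasAeCover.iUnion hYc
  have hWm : MeasurableSet W := MeasurableSet.iUnion fun n =>
    (hUo n).measurableSet.inter (hs.measurable (hYm n))
  let Z : ℕ → Set X := fun n => {x | ∃! g, g ∈ U n \ W ∧ s g = x}
  have hZ : ∀ n, ∀ᵐ x ∂μ, x ∈ Z n → x ∈ Y n := by
    intro n
    obtain ⟨Z', hZ'sub, hZ'm, hZ'ae⟩ := (nullMeasurableSet_existsUnique μ hs.measurable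
      ((hUo n).measurableSet.diff hWm)).exists_measurable_subset_ae_eq
    have hcov : HasAeCover μ s (U n ∩ s ⁻¹' Z') := by
      refine (hWc.union (W := (U n \ W) ∩ s ⁻¹' Z') ⟨fun _ => (U n \ W) ∩ s ⁻¹' Z', fun _ =>
        ⟨((hUo n).measurableSet.diff hWm).inter (hs.measurable hZ'm), ?_⟩, ?_⟩).mono ?_
      · intro g hg g' hg' e
        exact (hZ'sub hg.2).unique ⟨hg.1, rfl⟩ ⟨hg'.1, e.symm⟩
      · exact Eventually.of_forall fun x g hg _ => ⟨0, hg⟩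
      · intro g hg
        by_cases h : g ∈ W
        · exact Or.inl h
        · exact Or.inr ⟨⟨hg.1, h⟩, hg.2⟩
    have h0 := measure_eq_zero_iff_ae_notMem.1 (hYmax n Z' hZ'm hcov)
    filter_upwards [h0, hZ'ae.mem_iff] with x hx hx' hxZ
    by_contra h
    exact hx ⟨hx'.2 hxZ, h⟩
  obtain ⟨S, hS, hSc⟩ := hWc
  refine ⟨S, hS, ?_⟩
  filter_upwards [hSc, ae_all_iff.2 hZ] with x hx hxZ g _ e
  refine hx g ?_ e
  by_contra hgW
  have hFcl : IsClosed ({g | s g = x} ∩ ⋂ n, {g | g ∈ U n → x ∉ Y n}) := by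
    refine (isClosed_singleton.preimage hs).inter (isClosed_iInter fun n => ?_)
    by_cases h : x ∈ Y n
    · simp only [h, not_true_eq_false, imp_false]
      exact (hUo n).isClosed_compl
    · simp [h]
  have hmem : ∀ g', g' ∈ ({g | s g = x} ∩ ⋂ n, {g | g ∈ U n → x ∉ Y n}) ↔ s g' = x ∧ g' ∉ W := by
    intro g'
    simp only [W, Set.mem_inter_iff, Set.mem_ofPred_eq, Set.mem_iInter, Set.mem_iUnion, not_exists,
      not_and, Set.mem_preimage]
    constructor
    · rintro ⟨rfl, h⟩; exact ⟨rfl, h⟩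
    · rintro ⟨rfl, h⟩; exact ⟨rfl, h⟩
  obtain ⟨g', hg', V, hV, hiso⟩ := exists_isolated_of_countable hFcl
    ((hc x).mono Set.inter_subset_left) ⟨g, (hmem g).2 ⟨e, hgW⟩⟩
  obtain ⟨V', hV'b, hgV', hV'⟩ := hb.mem_nhds_iff.1 hV
  obtain ⟨n, rfl⟩ : V' ∈ Set.range U := hU ▸ Set.mem_insert_of_mem _ hV'b
  have hxn : x ∈ Z n := by
    refine ⟨g', ⟨⟨hgV', ((hmem g').1 hg').2⟩, ((hmem g').1 hg').1⟩, ?_⟩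
    rintro g'' ⟨⟨h₁, h₂⟩, h₃⟩
    exact hiso g'' ⟨hV' h₁, (hmem g'').2 ⟨h₃, h₂⟩⟩
  refine ((hmem g').1 hg').2 (Set.mem_iUnion.2 ⟨n, hgV', ?_⟩)
  rw [Set.mem_preimage, ((hmem g').1 hg').1]
  exact hxZ n hxn

/-- The form of the Lusin–Novikov theorem modulo null sets: a countable-to-one Borel map is
injective on each of countably many Borel sets that together cover almost every fibre. -/
theorem hasAeCover_univ {G X : Type*} [MeasurableSpace G] [MeasurableSpace X]
    [StandardBorelSpace G] [StandardBorelSpace X] (μ : Measure X) [IsFiniteMeasure μ] {s : G → X}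
    (hs : Measurable s) (hc : ∀ x, {g | s g = x}.Countable) : HasAeCover μ s Set.univ := by
  let := upgradeStandardBorel X
  obtain ⟨t, hb, hpol⟩ := StandardBorelSpace.polish (α := G)
  obtain ⟨t', ht', hcont, hpol'⟩ := hs.exists_continuous
  have hborel : @BorelSpace G t' _ := by
    refine @BorelSpace.mk G t' _ ?_
    rw [hb.measurable_eq]
    exact (borel_eq_borel_of_le hpol' hpol ht').symm
  exact @hasAeCover_univ_of_continuous G X _ _ t' hpol' hborel _ _ _ μ _ s hcont hc

end CountableToOne

/-! ### The measure on a discrete groupoid -/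

section FibreMeasure

variable {G X : Type*} [MeasurableSpace G] [MeasurableSpace X] [StandardBorelSpace G]
  [StandardBorelSpace X] {μ : Measure X} [IsFiniteMeasure μ] {s : G → X}

/-- The family of the counting measures on the fibres of a countable-to-one Borel map is measurable.
-/
theorem aemeasurable_count_fibre (hs : Measurable s) (hc : ∀ x, {g | s g = x}.Countable) :
    AEMeasurable (fun x => Measure.count.restrict {g : G | s g = x}) μ := by
  obtain ⟨S', hS', hcov'⟩ := hasAeCover_univ μ hs hc
  let S := disjointed S'
  have hSm : ∀ n, MeasurableSet (S n) := MeasurableSet.disjointed fun n => (hS' n).1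
  have hSi : ∀ n, Set.InjOn s (S n) := fun n => (hS' n).2.mono (disjointed_subset S' n)
  obtain ⟨N, hN, hNm, hN0⟩ := exists_measurable_superset_of_null (ae_iff.1 hcov')
  have hcov : ∀ x ∉ N, ∀ g, s g = x → g ∈ ⋃ n, S n := by
    intro x hx g hg
    rw [iUnion_disjointed]
    by_contra h
    exact hx (hN fun h' => h (Set.mem_iUnion.2 (h' g trivial hg)))
  classical
  let κ : X → Measure G := fun x => if x ∈ N then 0 else Measure.count.restrict {g : G | s g = x}
  refine ⟨κ, ?_, ?_⟩
  · refine Measure.measurable_of_measurable_coe κ fun D hD => ?_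
    have hval : ∀ x, κ x D = ∑' n, (s '' (D ∩ S n) \ N).indicator 1 x := by
      intro x
      by_cases hx : x ∈ N
      · simp [κ, hx]
      · simp only [κ, hx, if_false]
        rw [Measure.restrict_apply hD]
        have hD' : D ∩ {g | s g = x} = ⋃ n, (D ∩ S n) ∩ {g | s g = x} := by
          ext g
          simp only [Set.mem_inter_iff, Set.mem_ofPred_eq, Set.mem_iUnion]
          constructor
          · rintro ⟨h₁, h₂⟩
            obtain ⟨n, hn⟩ := Set.mem_iUnion.1 (hcov x hx g h₂)
            exact ⟨n, ⟨h₁, hn⟩, h₂⟩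
          · rintro ⟨n, h₁, h₂⟩
            exact ⟨h₁.1, h₂⟩
        rw [hD', measure_iUnion]
        · refine tsum_congr fun n => ?_
          by_cases h : ∃ g ∈ D ∩ S n, s g = x
          · obtain ⟨g, hg, rfl⟩ := h
            have : D ∩ S n ∩ {g' | s g' = s g} = {g} := by
              ext g'
              constructor
              · rintro ⟨h₁, h₂⟩
                exact hSi n h₁.2 hg.2 h₂
              · rintro rfl
                exact ⟨hg, rfl⟩
            rw [this, Measure.count_singleton, Set.indicator_of_mem
              (show s g ∈ s '' (D ∩ S n) \ N from ⟨⟨g, hg, rfl⟩, hx⟩)]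
            rfl
          · have : D ∩ S n ∩ {g' | s g' = x} = ∅ := by
              ext g'
              simp only [Set.mem_inter_iff, Set.mem_empty_iff_false, iff_false]
              rintro ⟨h₁, h₂⟩
              exact h ⟨g', h₁, h₂⟩
            rw [this, measure_empty, Set.indicator_of_notMem]
            rintro ⟨⟨g, hg, e⟩, -⟩
            exact h ⟨g, hg, e⟩
        · intro n m hnm
          exact (disjoint_disjointed S' hnm).mono
            (fun g hg => hg.1.2) (fun g hg => hg.1.2)
        · exact fun n => (hD.inter (hSm n)).inter (hs (measurableSet_singleton x))
    simp_rw [hval]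
    refine Measurable.tsum fun n => measurable_one.indicator ?_
    exact ((hD.inter (hSm n)).image_of_measurable_injOn hs
      ((hSi n).mono Set.inter_subset_right)).diff hNm
  · have : ∀ᵐ x ∂μ, x ∉ N := measure_eq_zero_iff_ae_notMem.1 hN0
    filter_upwards [this] with x hx
    simp [κ, hx]

theorem lintegral_bind_count_fibre (hs : Measurable s) (hc : ∀ x, {g | s g = x}.Countable)
    {f : G → ℝ≥0∞} (hf : Measurable f) :
    ∫⁻ g, f g ∂(μ.bind fun x => Measure.count.restrict {g : G | s g = x}) =
      ∫⁻ x, ∑' g : {g // s g = x}, f g ∂μ := by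
  rw [Measure.lintegral_bind (aemeasurable_count_fibre hs hc) hf.aemeasurable]
  refine lintegral_congr fun x => ?_
  rw [lintegral_countable f (hc x)]
  simp only [Measure.count_singleton, mul_one]
  rfl

theorem aemeasurable_tsum_fibre (hs : Measurable s) (hc : ∀ x, {g | s g = x}.Countable)
    {f : G → ℝ≥0∞} (hf : Measurable f) :
    AEMeasurable (fun x => ∑' g : {g // s g = x}, f g) μ := by
  have h := (Measure.measurable_lintegral hf).comp_aemeasurable
    (aemeasurable_count_fibre (μ := μ) hs hc)
  refine h.congr (Eventually.of_forall fun x => ?_)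
  simp only [Function.comp]
  rw [lintegral_countable f (hc x)]
  simp only [Measure.count_singleton, mul_one]
  rfl

theorem ae_bind_count_fibre_iff (hs : Measurable s) (hc : ∀ x, {g | s g = x}.Countable)
    {p : G → Prop} :
    (∀ᵐ g ∂(μ.bind fun x => Measure.count.restrict {g : G | s g = x}), p g) ↔
      ∀ᵐ x ∂μ, ∀ g, s g = x → p g := by
  have key : ∀ D, MeasurableSet D →
      ((μ.bind fun x => Measure.count.restrict {g : G | s g = x}) D = 0 ↔
        ∀ᵐ x ∂μ, ∀ g, s g = x → g ∉ D) := by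
    intro D hD
    have hm : AEMeasurable (fun x => Measure.count.restrict {g : G | s g = x} D) μ :=
      (Measure.measurable_coe hD).comp_aemeasurable (aemeasurable_count_fibre hs hc)
    rw [Measure.bind_apply hD (aemeasurable_count_fibre hs hc), lintegral_eq_zero_iff' hm]
    refine eventually_congr (Eventually.of_forall fun x => ?_)
    simp only [Pi.zero_apply]
    rw [Measure.restrict_apply hD, Measure.count_eq_zero_iff, Set.eq_empty_iff_forall_notMem]
    exact ⟨fun h g hg hD => h g ⟨hD, hg⟩, fun h g hg => h g hg.2 hg.1⟩
  constructor
  · intro h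
    obtain ⟨N, hN, hNm, hN0⟩ := exists_measurable_superset_of_null (ae_iff.1 h)
    filter_upwards [(key N hNm).1 hN0] with x hx g hg
    by_contra hp
    exact hx g hg (hN hp)
  · intro h
    obtain ⟨N, hN, hNm, hN0⟩ := exists_measurable_superset_of_null (ae_iff.1 h)
    refine ae_iff.2 (measure_mono_null (t := s ⁻¹' N) (fun g hg => hN fun h' => hg (h' g rfl)) ?_)
    rw [key _ (hs hNm)]
    filter_upwards [measure_eq_zero_iff_ae_notMem.1 hN0] with x hx g hg
    simpa [hg] using hx

end FibreMeasure

section Groupoid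

variable {X : Type*} [Groupoid X] [MeasurableSpace X] [MeasurableSpace (Elt X)] {μ : Measure X}

theorem IsDiscreteBorel.measurable_mul' (hG : IsDiscreteBorel X) :
    Measurable fun p : Elt X × Elt X => p.1 * p.2 := by
  have := hG.standardBorel_units
  have hset : MeasurableSet {p : Elt X × Elt X | src p.1 = rng p.2} :=
    measurableSet_eq_fun (hG.measurable_src.comp measurable_fst)
      (hG.measurable_rng.comp measurable_snd)
  refine measurable_of_restrict_of_restrict_compl hset ?_ ?_
  · have : ({p : Elt X × Elt X | src p.1 = rng p.2}.domRestrict fun p => p.1 * p.2) =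
        fun p => mul p.1.1 p.1.2 p.2 := funext fun p => mul_def p.2
    rw [this]
    exact hG.measurable_mul
  · have : ({p : Elt X × Elt X | src p.1 = rng p.2}ᶜ.domRestrict fun p => p.1 * p.2) =
        fun p => p.1.1 := funext fun p => dif_neg p.2
    rw [this]
    exact measurable_fst.comp measurable_subtype_coe

theorem IsDiscreteBorel.measurable_mul_fun (hG : IsDiscreteBorel X) {Z : Type*} [MeasurableSpace Z]
    {f g : Z → Elt X} (hf : Measurable f) (hg : Measurable g) : Measurable fun z => f z * g z :=
  hG.measurable_mul'.comp (hf.prodMk hg)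

theorem IsDiscreteBorel.measurable_inv_fun (hG : IsDiscreteBorel X) {Z : Type*} [MeasurableSpace Z]
    {f : Z → Elt X} (hf : Measurable f) : Measurable fun z => (f z)⁻¹ :=
  hG.measurable_inv.comp hf

variable (hG : IsDiscretePMP μ)
include hG

theorem IsDiscretePMP.lintegral_src {f : Elt X → ℝ≥0∞} (hf : Measurable f) :
    ∫⁻ g, f g ∂(srcMeasure μ) = ∫⁻ x, ∑' g : {g : Elt X // src g = x}, f g ∂μ := by
  have := hG.standardBorel_units
  have := hG.standardBorel_elts
  have := hG.prob
  exact lintegral_bind_count_fibre hG.measurable_src hG.countable_src hf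

theorem IsDiscretePMP.lintegral_rng {f : Elt X → ℝ≥0∞} (hf : Measurable f) :
    ∫⁻ g, f g ∂(srcMeasure μ) = ∫⁻ x, ∑' g : {g : Elt X // rng g = x}, f g ∂μ := by
  have := hG.standardBorel_units
  have := hG.standardBorel_elts
  have := hG.prob
  rw [← hG.rng_eq_src]
  exact lintegral_bind_count_fibre hG.measurable_rng hG.countable_rng hf

theorem IsDiscretePMP.ae_iff_src {p : Elt X → Prop} :
    (∀ᵐ g ∂(srcMeasure μ), p g) ↔ ∀ᵐ x ∂μ, ∀ g : Elt X, src g = x → p g := by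
  have := hG.standardBorel_units
  have := hG.standardBorel_elts
  have := hG.prob
  exact ae_bind_count_fibre_iff hG.measurable_src hG.countable_src

theorem IsDiscretePMP.ae_iff_rng {p : Elt X → Prop} :
    (∀ᵐ g ∂(srcMeasure μ), p g) ↔ ∀ᵐ x ∂μ, ∀ g : Elt X, rng g = x → p g := by
  have := hG.standardBorel_units
  have := hG.standardBorel_elts
  have := hG.prob
  rw [← hG.rng_eq_src]
  exact ae_bind_count_fibre_iff hG.measurable_rng hG.countable_rng

/-- Every null set of units is contained in an invariant Borel null set. -/
theorem IsDiscretePMP.exists_invariant_null {N : Set X} (hN : μ N = 0) :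
    ∃ N', N ⊆ N' ∧ MeasurableSet N' ∧ μ N' = 0 ∧ ∀ g : Elt X, src g ∈ N' ↔ rng g ∈ N' := by
  have step : ∀ N : {N : Set X // μ N = 0}, μ (N.1 ∪ {x | ∃ g : Elt X, rng g = x ∧ src g ∈ N.1}) = 0 := by
    rintro ⟨N, hN⟩
    refine measure_union_null hN ?_
    have h : ∀ᵐ g ∂(srcMeasure μ), src g ∉ N := hG.ae_iff_src.2 (by
      filter_upwards [measure_eq_zero_iff_ae_notMem.1 hN] with x hx g hg
      rwa [hg])
    rw [measure_eq_zero_iff_ae_notMem]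
    filter_upwards [hG.ae_iff_rng.1 h] with x hx
    rintro ⟨g, hg, hgN⟩
    exact hx g hg hgN
  let F : ℕ → {N : Set X // μ N = 0} := fun n => Nat.rec ⟨N, hN⟩
    (fun _ N => ⟨toMeasurable μ _, (measure_toMeasurable _).trans (step N)⟩) n
  have hsucc : ∀ n, (F n).1 ∪ {x | ∃ g : Elt X, rng g = x ∧ src g ∈ (F n).1} ⊆ (F (n + 1)).1 :=
    fun n => subset_toMeasurable _ _
  have hmono : Monotone fun n => (F n).1 :=
    monotone_nat_of_le_succ fun n => Set.subset_union_left.trans (hsucc n)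
  have hdir : ∀ g : Elt X, src g ∈ ⋃ n, (F (n + 1)).1 → rng g ∈ ⋃ n, (F (n + 1)).1 := by
    intro g hg
    obtain ⟨n, hn⟩ := Set.mem_iUnion.1 hg
    exact Set.mem_iUnion.2 ⟨n + 1, hsucc (n + 1) (Or.inr ⟨g, rfl, hn⟩)⟩
  refine ⟨⋃ n, (F (n + 1)).1, ?_, MeasurableSet.iUnion fun n => measurableSet_toMeasurable _ _,
    measure_iUnion_null fun n => (F (n + 1)).2, fun g => ⟨hdir g, fun h => hdir g⁻¹ h⟩⟩
  exact (hmono (Nat.zero_le 1)).trans (Set.subset_iUnion (fun n => (F (n + 1)).1) 0)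

/-- The source and the range of a partial bisection have the same measure. -/
theorem IsDiscretePMP.measure_src_image {σ : Set (Elt X)} (hσ : IsPartialBisection σ) :
    μ (src '' σ) = μ (rng '' σ) := by
  have := hG.standardBorel_units
  have := hG.standardBorel_elts
  have h1 : ∀ (s : Elt X → X), Measurable s → Set.InjOn s σ →
      ∫⁻ x, ∑' g : {g : Elt X // s g = x}, σ.indicator 1 g.1 ∂μ = μ (s '' σ) := by
    intro s hs hinj
    rw [← lintegral_indicator_one (hσ.measurableSet.image_of_measurable_injOn hs hinj)]
    refine lintegral_congr fun x => ?_
    by_cases h : x ∈ s '' σ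
    · obtain ⟨g, hg, rfl⟩ := h
      rw [Set.indicator_of_mem (show s g ∈ s '' σ from ⟨g, hg, rfl⟩), tsum_eq_single ⟨g, rfl⟩]
      · simp [hg]
      · rintro ⟨g', hg'⟩ hne
        refine Set.indicator_of_notMem (fun h => hne (Subtype.ext (hinj h hg hg'))) _
    · rw [Set.indicator_of_notMem h, ENNReal.tsum_eq_zero]
      rintro ⟨g, rfl⟩
      exact Set.indicator_of_notMem (fun hg => h ⟨g, hg, rfl⟩) _
  have hf : Measurable (σ.indicator (1 : Elt X → ℝ≥0∞)) := measurable_one.indicator hσ.measurableSet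
  rw [← h1 src hG.measurable_src hσ.src_injOn, ← h1 rng hG.measurable_rng hσ.rng_injOn,
    ← hG.lintegral_src hf, ← hG.lintegral_rng hf]

end Groupoid

/-! ### Bisections -/

section Bisections

variable {X : Type*} [Groupoid X] [MeasurableSpace X] [MeasurableSpace (Elt X)] {μ : Measure X}

theorem measurableSet_setInv (hG : IsDiscreteBorel X) {D : Set (Elt X)} (hD : MeasurableSet D) :
    MeasurableSet (setInv D) := by
  have : setInv D = (fun g => g⁻¹) ⁻¹' D := by ext g; exact mem_setInv
  rw [this]
  exact hG.measurable_inv hD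

theorem IsPartialBisection.setInv (hG : IsDiscreteBorel X) {τ : Set (Elt X)}
    (hτ : IsPartialBisection τ) : IsPartialBisection (setInv τ) where
  measurableSet := measurableSet_setInv hG hτ.measurableSet
  src_injOn g hg h hh e := by
    have := hτ.rng_injOn (mem_setInv.1 hg) (mem_setInv.1 hh) e
    rw [← elt_inv_inv g, this, elt_inv_inv]
  rng_injOn g hg h hh e := by
    have := hτ.src_injOn (mem_setInv.1 hg) (mem_setInv.1 hh) e
    rw [← elt_inv_inv g, this, elt_inv_inv]

omit [MeasurableSpace X] in
theorem IsPartialBisection.inter {τ : Set (Elt X)} (hτ : IsPartialBisection τ) {D : Set (Elt X)}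
    (hD : MeasurableSet D) : IsPartialBisection (τ ∩ D) where
  measurableSet := hτ.measurableSet.inter hD
  src_injOn := hτ.src_injOn.mono Set.inter_subset_left
  rng_injOn := hτ.rng_injOn.mono Set.inter_subset_left

theorem measurableSet_setMul (hG : IsDiscreteBorel X) {D τ : Set (Elt X)} (hD : MeasurableSet D)
    (hτ : IsPartialBisection τ) : MeasurableSet (setMul D τ) := by
  have := hG.standardBorel_units
  have := hG.standardBorel_elts
  have hset : MeasurableSet {p : Elt X × Elt X | src p.1 = rng p.2} :=
    measurableSet_eq_fun (hG.measurable_src.comp measurable_fst)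
      (hG.measurable_rng.comp measurable_snd)
  have heq : setMul D τ =
      (fun p : Elt X × Elt X => p.1 * p.2) '' ((D ×ˢ τ) ∩ {p | src p.1 = rng p.2}) := by
    ext k
    rw [mem_setMul]
    constructor
    · rintro ⟨g, hg, h, hh, e, rfl⟩
      exact ⟨(g, h), ⟨⟨hg, hh⟩, e⟩, rfl⟩
    · rintro ⟨⟨g, h⟩, ⟨⟨hg, hh⟩, e⟩, rfl⟩
      exact ⟨g, hg, h, hh, e, rfl⟩
  rw [heq]
  refine ((hD.prod hτ.measurableSet).inter hset).image_of_measurable_injOn hG.measurable_mul' ?_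
  rintro ⟨g, h⟩ ⟨⟨-, hh⟩, e⟩ ⟨g', h'⟩ ⟨⟨-, hh'⟩, e'⟩ heq
  simp only [Set.mem_ofPred_eq] at e e' heq hh hh'
  have hs : src h = src h' := by rw [← src_mul e, heq, src_mul e']
  obtain rfl : h = h' := hτ.src_injOn hh hh' hs
  rw [← mul_inv_cancel_right' e, heq, mul_inv_cancel_right' e']

theorem measurableSet_setMul_left (hG : IsDiscreteBorel X) {D τ : Set (Elt X)}
    (hD : MeasurableSet D) (hτ : IsPartialBisection τ) : MeasurableSet (setMul τ D) := by
  rw [← setInv_setInv (setMul τ D), setInv_setMul]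
  exact measurableSet_setInv hG
    (measurableSet_setMul hG (measurableSet_setInv hG hD) (hτ.setInv hG))

theorem measurableSet_conj (hG : IsDiscreteBorel X) {D σ : Set (Elt X)} (hD : MeasurableSet D)
    (hσ : IsPartialBisection σ) : MeasurableSet (conj D σ) :=
  measurableSet_setMul hG (measurableSet_setMul_left hG hD (hσ.setInv hG)) hσ

theorem measurableSet_generatedSet (hG : IsDiscreteBorel X) {σ : ℕ → Set (Elt X)}
    (hσ : ∀ n, IsPartialBisection (σ n)) : MeasurableSet (generatedSet (⋃ n, σ n)) := by
  have hU : MeasurableSet (⋃ n, σ n) := MeasurableSet.iUnion fun n => (hσ n).measurableSet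
  have hA : MeasurableSet ((⋃ n, σ n) ∪ setInv (⋃ n, σ n)) := hU.union (measurableSet_setInv hG hU)
  refine MeasurableSet.iUnion fun k => ?_
  induction k with
  | zero => exact hA
  | succ k ih =>
    have : setPow ((⋃ n, σ n) ∪ setInv (⋃ n, σ n)) (k + 1) =
        ⋃ n, (setMul (σ n) (setPow ((⋃ n, σ n) ∪ setInv (⋃ n, σ n)) k) ∪
          setMul (setInv (σ n)) (setPow ((⋃ n, σ n) ∪ setInv (⋃ n, σ n)) k)) := by
      ext g
      simp only [setPow, Set.mem_iUnion, Set.mem_union, mem_setMul, mem_setInv]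
      constructor
      · rintro ⟨a, ⟨n, hn⟩ | ⟨n, hn⟩, b, hb, e, rfl⟩
        · exact ⟨n, Or.inl ⟨a, hn, b, hb, e, rfl⟩⟩
        · exact ⟨n, Or.inr ⟨a, hn, b, hb, e, rfl⟩⟩
      · rintro ⟨n, ⟨a, hn, b, hb, e, rfl⟩ | ⟨a, hn, b, hb, e, rfl⟩⟩
        · exact ⟨a, Or.inl ⟨n, hn⟩, b, hb, e, rfl⟩
        · exact ⟨a, Or.inr ⟨n, hn⟩, b, hb, e, rfl⟩
    rw [this]
    exact MeasurableSet.iUnion fun n => (measurableSet_setMul_left hG ih (hσ n)).union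
      (measurableSet_setMul_left hG ih ((hσ n).setInv hG))

omit [MeasurableSpace X] in
theorem sec_src {τ : Set (Elt X)} (hτ : IsPartialBisection τ) {g : Elt X} (hg : g ∈ τ) :
    sec τ (src g) = g :=
  hτ.src_injOn (sec_mem ⟨g, hg, rfl⟩) hg (src_sec τ _)

theorem measurableSet_src_image (hG : IsDiscreteBorel X) {τ : Set (Elt X)}
    (hτ : IsPartialBisection τ) : MeasurableSet (src '' τ) := by
  have := hG.standardBorel_units
  have := hG.standardBorel_elts
  exact hτ.measurableSet.image_of_measurable_injOn hG.measurable_src hτ.src_injOn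

theorem measurable_sec (hG : IsDiscreteBorel X) {τ : Set (Elt X)} (hτ : IsPartialBisection τ) :
    Measurable (sec τ) := by
  intro D hD
  have : sec τ ⁻¹' D = src '' (τ ∩ D) ∪ ((src '' τ)ᶜ ∩ unit ⁻¹' D) := by
    ext x
    by_cases h : x ∈ src '' τ
    · constructor
      · intro hx
        exact Or.inl ⟨sec τ x, ⟨sec_mem h, hx⟩, src_sec τ x⟩
      · rintro (⟨g, hg, rfl⟩ | h')
        · rw [Set.mem_preimage, sec_src hτ hg.1]; exact hg.2
        · exact absurd h h'.1
    · constructor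
      · intro hx
        rw [Set.mem_preimage, sec_of_notMem h] at hx
        exact Or.inr ⟨h, hx⟩
      · rintro (⟨g, hg, rfl⟩ | h')
        · exact absurd ⟨g, hg.1, rfl⟩ h
        · rw [Set.mem_preimage, sec_of_notMem h]; exact h'.2
  rw [this]
  exact (measurableSet_src_image hG (hτ.inter hD)).union
    ((measurableSet_src_image hG hτ).compl.inter (hG.measurable_unit hD))

/-! ### Full sections -/

/-- A Borel family of elements `φ x` with source `x` for which `x ↦ rng (φ x)` is an involution. Its
range is a bisection; elements of the full group of this simple kind suffice for the argument. -/
structure IsFullSection (φ : X → Elt X) : Prop where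
  measurable : Measurable φ
  src_eq : ∀ x, src (φ x) = x
  invol : ∀ x, rng (φ (rng (φ x))) = x

theorem IsFullSection.isPartialBisection (hG : IsDiscreteBorel X) {φ : X → Elt X}
    (hφ : IsFullSection φ) : IsPartialBisection (Set.range φ) where
  measurableSet := by
    have := hG.standardBorel_units
    have := hG.standardBorel_elts
    rw [← Set.image_univ]
    refine MeasurableSet.univ.image_of_measurable_injOn hφ.measurable fun x _ y _ h => ?_
    rw [← hφ.src_eq x, h, hφ.src_eq]
  src_injOn := by
    rintro _ ⟨x, rfl⟩ _ ⟨y, rfl⟩ h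
    rw [hφ.src_eq, hφ.src_eq] at h
    rw [h]
  rng_injOn := by
    rintro _ ⟨x, rfl⟩ _ ⟨y, rfl⟩ h
    rw [← hφ.invol x, h, hφ.invol]

theorem IsFullSection.isBisection (hG : IsDiscreteBorel X) {φ : X → Elt X}
    (hφ : IsFullSection φ) : IsBisection μ (Set.range φ) where
  toIsPartialBisection := hφ.isPartialBisection hG
  src_conull := Eventually.of_forall fun x => ⟨φ x, ⟨x, rfl⟩, hφ.src_eq x⟩
  rng_conull := Eventually.of_forall fun x => ⟨φ (rng (φ x)), ⟨_, rfl⟩, hφ.invol x⟩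

theorem IsFullSection.rng_invSection {φ : X → Elt X} (hφ : IsFullSection φ) (x : X) :
    rng (invSection φ x) = rng (φ x) := by
  simp [invSection, hφ.src_eq]

theorem IsFullSection.isFullSection_invSection (hG : IsDiscreteBorel X) {φ : X → Elt X} (hφ : IsFullSection φ) :
    IsFullSection (invSection φ) where
  measurable := hG.measurable_inv_fun
    (hφ.measurable.comp (hG.measurable_rng.comp hφ.measurable))
  src_eq x := hφ.invol x
  invol x := by simp [hφ.rng_invSection, hφ.invol]

theorem IsFullSection.src_conjMap {φ : X → Elt X} (hφ : IsFullSection φ) (g : Elt X) :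
    src (conjMap φ g) = rng (φ (src g)) := by
  have e₁ : src (φ (rng g)) = rng g := hφ.src_eq _
  rw [conjMap, src_mul, src_inv]
  rw [src_mul e₁, rng_inv, hφ.src_eq]

theorem IsFullSection.measurable_conjMap (hG : IsDiscreteBorel X) {φ : X → Elt X}
    (hφ : IsFullSection φ) : Measurable (conjMap φ) :=
  hG.measurable_mul_fun (hG.measurable_mul_fun (hφ.measurable.comp hG.measurable_rng) measurable_id)
    (hG.measurable_inv_fun (hφ.measurable.comp hG.measurable_src))

theorem IsFullSection.conjMap_invSection {φ : X → Elt X} (hφ : IsFullSection φ) (g : Elt X) :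
    conjMap (invSection φ) (conjMap φ g) = g := by
  have e₁ : src (φ (rng g)) = rng g := hφ.src_eq _
  have e₂ : src (φ (rng g) * g) = rng (φ (src g))⁻¹ := by rw [src_mul e₁, rng_inv, hφ.src_eq]
  rw [conjMap, rng_conjMap, hφ.src_conjMap, invSection, invSection, hφ.invol, hφ.invol,
    elt_inv_inv, conjMap, elt_mul_assoc e₁ (by rw [rng_inv, hφ.src_eq]),
    inv_mul_cancel_left' (by rw [rng_mul, e₁]),
    inv_mul_cancel_right' (by rw [hφ.src_eq])]

theorem IsFullSection.invSection_invSection {φ : X → Elt X} (hφ : IsFullSection φ) :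
    invSection (invSection φ) = φ := by
  funext x
  have : rng (invSection φ x) = rng (φ x) := hφ.rng_invSection x
  rw [invSection, this, invSection, hφ.invol, elt_inv_inv]

/-- Conjugation by a full section as a Borel automorphism. -/
noncomputable def conjEquiv (hG : IsDiscreteBorel X) {φ : X → Elt X} (hφ : IsFullSection φ) :
    Elt X ≃ᵐ Elt X where
  toFun := conjMap φ
  invFun := conjMap (invSection φ)
  left_inv := hφ.conjMap_invSection
  right_inv g := by
    have := (hφ.isFullSection_invSection hG).conjMap_invSection g
    rwa [hφ.invSection_invSection] at this
  measurable_toFun := hφ.measurable_conjMap hG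
  measurable_invFun := (hφ.isFullSection_invSection hG).measurable_conjMap hG

theorem IsFullSection.conj_range {φ : X → Elt X} (hφ : IsFullSection φ) (D : Set (Elt X)) :
    conj D (Set.range φ) = conjMap φ ⁻¹' D := by
  ext k
  rw [mem_conj]
  constructor
  · rintro ⟨_, ⟨x, rfl⟩, _, ⟨y, rfl⟩, hx, hy, h⟩
    rw [hφ.src_eq] at hx hy
    rw [hx, hy] at h
    exact h
  · intro h
    exact ⟨_, ⟨src k, rfl⟩, _, ⟨rng k, rfl⟩, hφ.src_eq _, hφ.src_eq _, h⟩

/-- Conjugation by a full section maps the source fibre of `x` onto that of `rng (φ x)`. -/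
noncomputable def conjFibreEquiv (hG : IsDiscreteBorel X) {φ : X → Elt X} (hφ : IsFullSection φ)
    (x : X) : {g : Elt X // src g = x} ≃ {g : Elt X // src g = rng (φ x)} where
  toFun g := ⟨conjMap φ g, by rw [hφ.src_conjMap, g.2]⟩
  invFun g := ⟨conjMap (invSection φ) g, by
    rw [(hφ.isFullSection_invSection hG).src_conjMap, g.2, hφ.rng_invSection, hφ.invol]⟩
  left_inv g := Subtype.ext ((conjEquiv hG hφ).left_inv g.1)
  right_inv g := Subtype.ext ((conjEquiv hG hφ).right_inv g.1)

theorem IsFullSection.measurePreserving_rng (hG : IsDiscretePMP μ) {φ : X → Elt X}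
    (hφ : IsFullSection φ) : MeasurePreserving (fun x => rng (φ x)) μ μ := by
  have hm : Measurable fun x => rng (φ x) := hG.measurable_rng.comp hφ.measurable
  refine ⟨hm, Measure.ext fun B hB => ?_⟩
  rw [Measure.map_apply hm hB]
  have h := hG.measure_src_image ((hφ.isPartialBisection hG.toIsDiscreteBorel).inter
    (hG.measurable_rng hB))
  convert h using 2
  · ext x
    constructor
    · intro hx
      exact ⟨φ x, ⟨⟨x, rfl⟩, hx⟩, hφ.src_eq x⟩
    · rintro ⟨_, ⟨⟨y, rfl⟩, hy⟩, rfl⟩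
      rw [hφ.src_eq]
      exact hy
  · ext x
    constructor
    · intro hx
      exact ⟨φ (rng (φ x)), ⟨⟨_, rfl⟩, by rw [Set.mem_preimage, hφ.invol]; exact hx⟩, hφ.invol x⟩
    · rintro ⟨_, ⟨⟨y, rfl⟩, hy⟩, rfl⟩
      exact hy

theorem IsFullSection.measurePreserving_conjMap (hG : IsDiscretePMP μ) {φ : X → Elt X}
    (hφ : IsFullSection φ) : MeasurePreserving (conjMap φ) (srcMeasure μ) (srcMeasure μ) := by
  have hm := hφ.measurable_conjMap hG.toIsDiscreteBorel
  refine ⟨hm, Measure.ext fun D hD => ?_⟩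
  rw [Measure.map_apply hm hD, ← lintegral_indicator_one hD, ← lintegral_indicator_one (hm hD),
    hG.lintegral_src (measurable_one.indicator hD),
    hG.lintegral_src (measurable_one.indicator (hm hD))]
  have := hG.standardBorel_units
  have := hG.standardBorel_elts
  have := hG.prob
  have hae : AEMeasurable (fun x => ∑' g : {g : Elt X // src g = x}, D.indicator (1 : Elt X → ℝ≥0∞) g) μ :=
    aemeasurable_tsum_fibre hG.measurable_src hG.countable_src (measurable_one.indicator hD)
  rw [← (hφ.measurePreserving_rng hG).map_eq] at hae
  conv_rhs => rw [← (hφ.measurePreserving_rng hG).map_eq]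
  rw [lintegral_map' hae (hφ.measurePreserving_rng hG).aemeasurable]
  refine lintegral_congr fun x => ?_
  rw [← (conjFibreEquiv hG.toIsDiscreteBorel hφ x).tsum_eq]
  rfl

omit [MeasurableSpace X] in
theorem extendSection_src {τ : Set (Elt X)} (hτ : IsPartialBisection τ) {g : Elt X} (hg : g ∈ τ) :
    extendSection τ (src g) = g := by
  rw [extendSection, if_pos ⟨g, hg, rfl⟩, sec_src hτ hg]

theorem isFullSection_extendSection (hG : IsDiscreteBorel X) {τ : Set (Elt X)}
    (hτ : IsPartialBisection τ)
    (h : (∀ g ∈ τ, src g = rng g) ∨ Disjoint (src '' τ) (rng '' τ)) :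
    IsFullSection (extendSection τ) where
  measurable := Measurable.ite (measurableSet_src_image hG hτ) (measurable_sec hG hτ)
    (measurable_sec hG (hτ.setInv hG))
  src_eq x := by
    unfold extendSection
    split_ifs <;> exact src_sec _ _
  invol x := by
    rcases h with h | h
    · have hfix : ∀ x, rng (extendSection τ x) = x := by
        intro x
        have hs : src (extendSection τ x) = x := by
          unfold extendSection
          split_ifs <;> exact src_sec _ _
        rcases extendSection_mem τ x with h' | h' | h'
        · rw [← h _ h', hs]
        · have := h _ h'
          rw [src_inv, rng_inv] at this
          rw [this, hs]
        · rw [h']; rfl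
      rw [hfix, hfix]
    · by_cases hx : x ∈ src '' τ
      · obtain ⟨g, hg, rfl⟩ := hx
        rw [extendSection_src hτ hg, extendSection,
          if_neg (fun h' => Set.disjoint_left.1 h h' ⟨g, hg, rfl⟩)]
        have := sec_src (hτ.setInv hG) (g := g⁻¹) (mem_setInv.2 (by simpa))
        rw [src_inv] at this
        rw [this, rng_inv]
      · have e : extendSection τ x = sec (setInv τ) x := if_neg hx
        by_cases hx' : x ∈ src '' setInv τ
        · have hm := mem_setInv.1 (sec_mem hx')
          have := extendSection_src hτ hm
          rw [src_inv] at this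
          rw [e, this, rng_inv, src_sec]
        · have : rng (extendSection τ x) = x := by rw [e, sec_of_notMem hx']; rfl
          rw [this, this]

end Bisections

/-! ### The dual of `L¹` -/

section DualL1

variable {Ω : Type*} [MeasurableSpace Ω] {ν : Measure Ω}

/-- On the functions `w φ` with `φ` square integrable, where `w` is a fixed square integrable
function, a functional on `L¹` is given by an element of `L²`. -/
theorem exists_memLp_two_density {w : Ω → ℝ} (hw : MemLp w 2 ν) (Λ : Lp ℝ 1 ν →L[ℝ] ℝ) :
    ∃ ψ : Ω → ℝ, MemLp ψ 2 ν ∧ ∀ φ : Ω → ℝ, MemLp φ 2 ν →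
      ∀ h : Integrable (w * φ) ν, Λ (h.toL1 (w * φ)) = ∫ x, ψ x * φ x ∂ν := by
  let J : Lp ℝ 2 ν →L[ℝ] Lp ℝ 1 ν :=
    (ContinuousLinearMap.mul ℝ ℝ).holderL ν 2 2 1 (hw.toLp w)
  let ψ := (InnerProductSpace.toDual ℝ (Lp ℝ 2 ν)).symm (Λ.comp J)
  refine ⟨ψ, Lp.memLp ψ, fun φ hφ h => ?_⟩
  have h1 : J (hφ.toLp φ) = h.toL1 (w * φ) := by
    apply Lp.ext
    have e := ContinuousLinearMap.coeFn_holder (r := 1) (ContinuousLinearMap.mul ℝ ℝ)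
      (hw.toLp w) (hφ.toLp φ)
    refine (show J (hφ.toLp φ) =ᵐ[ν] _ from e).trans ?_
    filter_upwards [hw.coeFn_toLp, hφ.coeFn_toLp, h.coeFn_toL1] with x e₁ e₂ e₃
    rw [e₃, e₁, e₂]; rfl
  rw [← h1]
  have h2 : inner ℝ ψ (hφ.toLp φ) = Λ (J (hφ.toLp φ)) :=
    InnerProductSpace.toDual_symm_apply
  rw [← h2, L2.inner_def]
  refine integral_congr_ae ?_
  filter_upwards [hφ.coeFn_toLp] with x e
  rw [e]
  simp [mul_comm]

/-- Every bounded functional on `L¹` of a `σ`-finite measure is given by a bounded function. -/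
theorem exists_bounded_density [SigmaFinite ν] (Λ : Lp ℝ 1 ν →L[ℝ] ℝ) :
    ∃ ψ : Ω → ℝ, Measurable ψ ∧ (∀ x, |ψ x| ≤ ‖Λ‖) ∧
      ∀ (f : Ω → ℝ) (hf : Integrable f ν), Λ (hf.toL1 f) = ∫ x, ψ x * f x ∂ν := by
  obtain ⟨g, hgpos, hgm, hgint⟩ := exists_pos_lintegral_lt_of_sigmaFinite ν one_ne_zero
  let w : Ω → ℝ := fun x => Real.sqrt (g x)
  have hwpos : ∀ x, 0 < w x := fun x => Real.sqrt_pos.2 (hgpos x)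
  have hwm : Measurable w := hgm.coe_nnreal_real.sqrt
  have hw2 : Integrable (fun x => w x ^ 2) ν := by
    have : (fun x => w x ^ 2) = fun x => (g x : ℝ) := by
      funext x; exact Real.sq_sqrt (g x).2
    rw [this]
    refine ⟨hgm.coe_nnreal_real.aestronglyMeasurable, ?_⟩
    rw [hasFiniteIntegral_iff_enorm]
    refine lt_of_le_of_lt (lintegral_mono fun x => ?_) (hgint.trans ENNReal.one_lt_top)
    simp
  have hw : MemLp w 2 ν := (memLp_two_iff_integrable_sq hwm.aestronglyMeasurable).2 hw2
  obtain ⟨ψ₂, hψ₂, hrep⟩ := exists_memLp_two_density hw Λ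
  have hψw : Integrable (ψ₂ * w) ν := hψ₂.integrable_mul hw
  have hset : ∀ A, MeasurableSet A → |∫ x in A, ψ₂ x * w x ∂ν| ≤ ‖Λ‖ * ∫ x in A, w x ^ 2 ∂ν := by
    intro A hA
    have hφ : MemLp (A.indicator w) 2 ν := hw.indicator hA
    have hi : Integrable (w * A.indicator w) ν := hw.integrable_mul hφ
    have e := hrep _ hφ hi
    have e1 : ∫ x, ψ₂ x * A.indicator w x ∂ν = ∫ x in A, ψ₂ x * w x ∂ν := by
      rw [← integral_indicator hA]
      refine integral_congr_ae (Eventually.of_forall fun x => ?_)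
      by_cases hx : x ∈ A <;> simp [hx]
    have e2 : ‖hi.toL1 (w * A.indicator w)‖ = ∫ x in A, w x ^ 2 ∂ν := by
      rw [L1.norm_of_fun_eq_integral_norm, ← integral_indicator hA]
      refine integral_congr_ae (Eventually.of_forall fun x => ?_)
      by_cases hx : x ∈ A
      · simp [hx, sq, abs_of_pos (hwpos x)]
      · simp [hx]
    rw [← e1, ← e, ← e2]
    exact Λ.le_opNorm _
  have hcw : Integrable (fun x => ‖Λ‖ * w x ^ 2) ν := hw2.const_mul _
  have hub : ∀ᵐ x ∂ν, ψ₂ x * w x ≤ ‖Λ‖ * w x ^ 2 :=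
    ae_le_of_forall_setIntegral_le hψw hcw fun A hA _ => by
      rw [integral_const_mul]; exact (le_abs_self _).trans (hset A hA)
  have hlb : ∀ᵐ x ∂ν, -(ψ₂ x * w x) ≤ ‖Λ‖ * w x ^ 2 :=
    ae_le_of_forall_setIntegral_le hψw.neg hcw fun A hA _ => by
      rw [integral_const_mul]
      simp only [integral_neg]
      exact (neg_le_abs _).trans (hset A hA)
  let ψ₁ : Ω → ℝ := hψ₂.1.mk ψ₂
  have hψ₁m : Measurable ψ₁ := hψ₂.1.stronglyMeasurable_mk.measurable
  let ψ : Ω → ℝ := fun x => max (-‖Λ‖) (min ‖Λ‖ (ψ₁ x / w x))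
  have hψm : Measurable ψ := measurable_const.max (measurable_const.min (hψ₁m.div hwm))
  have hψb : ∀ x, |ψ x| ≤ ‖Λ‖ := by
    intro x
    have := norm_nonneg Λ
    exact abs_le.2 ⟨le_max_left _ _, max_le (by linarith) (min_le_left _ _)⟩
  have hψw' : ∀ᵐ x ∂ν, ψ₂ x = ψ x * w x := by
    filter_upwards [hub, hlb, hψ₂.1.ae_eq_mk] with x h1 h2 h3
    have h4 : ψ₁ x = ψ₂ x := h3.symm
    have hp := hwpos x
    have h5 : ψ₂ x / w x ≤ ‖Λ‖ := by
      rw [div_le_iff₀ hp]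
      nlinarith
    have h6 : -‖Λ‖ ≤ ψ₂ x / w x := by
      rw [le_div_iff₀ hp]
      nlinarith
    simp only [ψ, h4]
    rw [min_eq_right h5, max_eq_right h6, div_mul_cancel₀ _ hp.ne']
  have hint : ∀ f : Ω → ℝ, Integrable f ν → Integrable (fun x => ψ x * f x) ν := fun f hf =>
    hf.bdd_mul (c := ‖Λ‖) hψm.aestronglyMeasurable (Eventually.of_forall hψb)
  refine ⟨ψ, hψm, hψb, fun f hf => ?_⟩
  -- The identity holds for the truncations of `f` to `{|f| ≤ n w²}`, which lie in `w L²`.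
  obtain ⟨f', hf'm, hff'⟩ := hf.1
  have hf' : Integrable f' ν := hf.congr hff'
  have hcongr : hf.toL1 f = hf'.toL1 f' := (Integrable.toL1_eq_toL1_iff _ _ _ _).2 hff'
  have hcongr2 : ∫ x, ψ x * f x ∂ν = ∫ x, ψ x * f' x ∂ν :=
    integral_congr_ae (hff'.mono fun x hx => by simp only [hx])
  rw [hcongr, hcongr2]
  clear hcongr hcongr2
  let A : ℕ → Set Ω := fun n => {x | |f' x| ≤ n * w x ^ 2}
  have hA : ∀ n, MeasurableSet (A n) := fun n =>
    measurableSet_le hf'm.measurable.abs ((hwm.pow_const 2).const_mul _)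
  have htrunc : ∀ n (h : Integrable ((A n).indicator f') ν),
      Λ (h.toL1 _) = ∫ x, ψ x * (A n).indicator f' x ∂ν := by
    intro n h
    have hφ : MemLp (fun x => (A n).indicator f' x / w x) 2 ν := by
      refine (hw.const_mul (n : ℝ)).mono
        (((hf'm.measurable.indicator (hA n)).div hwm).aestronglyMeasurable)
        (Eventually.of_forall fun x => ?_)
      have hp := hwpos x
      by_cases hx : x ∈ A n
      · have hx' : |f' x| ≤ n * w x ^ 2 := hx
        have hnw : 0 ≤ n * w x := mul_nonneg n.cast_nonneg hp.le
        rw [Set.indicator_of_mem hx, Real.norm_eq_abs, Real.norm_eq_abs, abs_div, abs_of_pos hp,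
          div_le_iff₀ hp, abs_of_nonneg hnw]
        linarith
      · rw [Set.indicator_of_notMem hx, zero_div, norm_zero]
        exact norm_nonneg _
    have heq : (w * fun x => (A n).indicator f' x / w x) = (A n).indicator f' := by
      funext x
      simp [mul_div_cancel₀ _ (hwpos x).ne']
    have h' : Integrable (w * fun x => (A n).indicator f' x / w x) ν := by rwa [heq]
    have e := hrep _ hφ h'
    have : h'.toL1 _ = h.toL1 ((A n).indicator f') :=
      (Integrable.toL1_eq_toL1_iff _ _ _ _).2 (Eventually.of_forall fun x => congrFun heq x)
    rw [← this, e]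
    refine integral_congr_ae (hψw'.mono fun x hx => ?_)
    simp only [hx]
    rw [mul_assoc, mul_div_cancel₀ _ (hwpos x).ne']
  have hest : ∀ n, |Λ (hf'.toL1 f') - ∫ x, ψ x * f' x ∂ν| ≤
      2 * ‖Λ‖ * ∫ x in (A n)ᶜ, |f' x| ∂ν := by
    intro n
    have h1 : Integrable ((A n).indicator f') ν := hf'.indicator (hA n)
    have h2 : Integrable ((A n)ᶜ.indicator f') ν := hf'.indicator (hA n).compl
    have hsum : (A n).indicator f' + (A n)ᶜ.indicator f' = f' := Set.indicator_self_add_compl _ _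
    have e1 : hf'.toL1 f' = h1.toL1 _ + h2.toL1 _ := by
      rw [← Integrable.toL1_add]
      exact (Integrable.toL1_eq_toL1_iff _ _ _ _).2
        (Eventually.of_forall fun x => (congrFun hsum x).symm)
    have e2 : ∫ x, ψ x * f' x ∂ν =
        ∫ x, ψ x * (A n).indicator f' x ∂ν + ∫ x, ψ x * (A n)ᶜ.indicator f' x ∂ν := by
      rw [← integral_add (hint _ h1) (hint _ h2)]
      refine integral_congr_ae (Eventually.of_forall fun x => ?_)
      simp only
      rw [← mul_add]
      exact congrArg _ (congrFun hsum x).symm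
    have e3 : ∫ x, |(A n)ᶜ.indicator f' x| ∂ν = ∫ x in (A n)ᶜ, |f' x| ∂ν := by
      rw [← integral_indicator (hA n).compl]
      refine integral_congr_ae (Eventually.of_forall fun x => ?_)
      by_cases hx : x ∈ A n <;> simp [hx]
    have b1 : |Λ (h2.toL1 _)| ≤ ‖Λ‖ * ∫ x in (A n)ᶜ, |f' x| ∂ν := by
      refine (Λ.le_opNorm _).trans (le_of_eq ?_)
      rw [L1.norm_of_fun_eq_integral_norm, ← e3]
      rfl
    have b2 : |∫ x, ψ x * (A n)ᶜ.indicator f' x ∂ν| ≤ ‖Λ‖ * ∫ x in (A n)ᶜ, |f' x| ∂ν := by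
      rw [← e3, ← integral_const_mul, ← Real.norm_eq_abs]
      refine (norm_integral_le_of_norm_le (h2.abs.const_mul ‖Λ‖) (Eventually.of_forall fun x => ?_))
      rw [Real.norm_eq_abs, abs_mul]
      exact mul_le_mul_of_nonneg_right (hψb x) (abs_nonneg _)
    rw [e1, e2, map_add, htrunc n h1]
    have := abs_sub (Λ (h2.toL1 _)) (∫ x, ψ x * (A n)ᶜ.indicator f' x ∂ν)
    rw [add_sub_add_left_eq_sub]
    linarith
  have hlim : Tendsto (fun n => ∫ x in (A n)ᶜ, |f' x| ∂ν) atTop (𝓝 0) := by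
    have h := tendsto_setIntegral_of_antitone (μ := ν) (f := fun x => |f' x|) (s := fun n => (A n)ᶜ)
      (fun n => (hA n).compl) (fun n m hnm => Set.compl_subset_compl.2 fun x hx => by
        refine le_trans (show |f' x| ≤ n * w x ^ 2 from hx) ?_
        gcongr) ⟨0, hf'.abs.integrableOn⟩
    have : ⋂ n, (A n)ᶜ = ∅ := by
      rw [← Set.compl_iUnion, Set.compl_empty_iff, Set.eq_univ_iff_forall]
      intro x
      obtain ⟨n, hn⟩ := exists_nat_ge (|f' x| / w x ^ 2)
      rw [div_le_iff₀ (pow_pos (hwpos x) 2)] at hn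
      exact Set.mem_iUnion.2 ⟨n, hn⟩
    rwa [this, setIntegral_empty] at h
  have hlim2 : Tendsto (fun n => 2 * ‖Λ‖ * ∫ x in (A n)ᶜ, |f' x| ∂ν) atTop (𝓝 0) := by
    simpa using hlim.const_mul (2 * ‖Λ‖)
  have h0 := ge_of_tendsto' hlim2 hest
  exact sub_eq_zero.1 (abs_eq_zero.1 (le_antisymm h0 (abs_nonneg _)))

end DualL1

/-! ### Means on bounded functions -/

section Means

/-- An additive functional on the bounded measurable functions that is continuous for the uniform
norm is determined by its values at the multiples of indicator functions. -/
theorem eq_zero_of_forall_indicator {Ω : Type*} [MeasurableSpace Ω] {L : (Ω → ℝ) → ℝ} {K : ℝ}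
    (hadd : ∀ f g : Ω → ℝ, Measurable f → Measurable g → (∃ C, ∀ x, |f x| ≤ C) →
      (∃ C, ∀ x, |g x| ≤ C) → L (f + g) = L f + L g)
    (hbound : ∀ f : Ω → ℝ, Measurable f → ∀ C, 0 ≤ C → (∀ x, |f x| ≤ C) → |L f| ≤ K * C)
    (hind : ∀ (A : Set Ω) (c : ℝ), MeasurableSet A → L (A.indicator fun _ => c) = 0)
    {f : Ω → ℝ} (hf : Measurable f) {C : ℝ} (hC : ∀ x, |f x| ≤ C) : L f = 0 := by
  have hsimple : ∀ g : SimpleFunc Ω ℝ, L g = 0 := by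
    intro g
    induction g using SimpleFunc.induction with
    | @const c s hs =>
      refine (congrArg L (funext fun x => ?_)).trans (hind s c hs)
      by_cases hx : x ∈ s <;> simp [SimpleFunc.coe_piecewise, hx]
    | @add f g _ hf hg =>
      have hb : ∀ g : SimpleFunc Ω ℝ, ∃ C, ∀ x, |g x| ≤ C := fun g => by
        obtain ⟨C, hC⟩ := g.exists_forall_norm_le
        exact ⟨C, hC⟩
      rw [SimpleFunc.coe_add, hadd f g f.measurable g.measurable (hb f) (hb g), hf, hg, add_zero]
  have hest : ∀ n : ℕ, |L f| ≤ K * (1 / ((n : ℝ) + 1)) := by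
    intro n
    have hn : (0 : ℝ) < n + 1 := by positivity
    let g : Ω → ℝ := fun x => ⌊f x * (n + 1)⌋ / ((n : ℝ) + 1)
    have hgm : Measurable g := by
      have : Measurable fun x => ((⌊f x * (n + 1)⌋ : ℤ) : ℝ) :=
        measurable_from_top.comp (hf.mul_const _).floor
      exact this.div_const _
    have hgf : (Set.range g).Finite := by
      refine ((Set.finite_Icc ⌊-C * (n + 1)⌋ ⌊C * (n + 1)⌋).image
        fun k : ℤ => (k : ℝ) / ((n : ℝ) + 1)).subset ?_
      rintro _ ⟨x, rfl⟩
      have := abs_le.1 (hC x)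
      exact ⟨⌊f x * (n + 1)⌋, ⟨Int.floor_mono (by nlinarith), Int.floor_mono (by nlinarith)⟩, rfl⟩
    let G : SimpleFunc Ω ℝ := ⟨g, fun y => hgm (measurableSet_singleton y), hgf⟩
    have hclose : ∀ x, |f x - g x| ≤ 1 / ((n : ℝ) + 1) := by
      intro x
      have e : f x - g x = Int.fract (f x * (n + 1)) / (n + 1) := by
        simp only [g, Int.fract]; field_simp
      rw [e, abs_of_nonneg (div_nonneg (Int.fract_nonneg _) hn.le)]
      exact div_le_div_of_nonneg_right (Int.fract_lt_one _).le hn.le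
    obtain ⟨C', hC'⟩ := G.exists_forall_norm_le
    have e : L f = L (f - g) := by
      have := hadd (f - g) g (hf.sub hgm) hgm ⟨_, hclose⟩ ⟨C', hC'⟩
      rw [sub_add_cancel] at this
      rw [this, show L g = 0 from hsimple G, add_zero]
    rw [e]
    exact hbound _ (hf.sub hgm) _ (by positivity) hclose
  have hlim : Tendsto (fun n : ℕ => K * (1 / ((n : ℝ) + 1))) atTop (𝓝 0) := by
    simpa using tendsto_one_div_add_atTop_nhds_zero_nat.const_mul K
  exact abs_eq_zero.1 (le_antisymm (ge_of_tendsto' hlim hest) (abs_nonneg _))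

variable {Ω : Type*} [MeasurableSpace Ω] {ν : Measure Ω}

open Classical in
/-- The value of a functional on `L^∞` at the class of an essentially bounded function. -/
noncomputable def meanVal (m : Lp ℝ ∞ ν →L[ℝ] ℝ) (f : Ω → ℝ) : ℝ :=
  if h : MemLp f ∞ ν then m (h.toLp f) else 0

variable {m : Lp ℝ ∞ ν →L[ℝ] ℝ} {f g : Ω → ℝ}

theorem memLp_top_of_abs_le (hf : Measurable f) {C : ℝ} (hC : ∀ x, |f x| ≤ C) : MemLp f ∞ ν :=
  memLp_top_of_bound hf.aestronglyMeasurable C (Eventually.of_forall hC)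

theorem meanVal_add (hf : MemLp f ∞ ν) (hg : MemLp g ∞ ν) :
    meanVal m (f + g) = meanVal m f + meanVal m g := by
  rw [meanVal, meanVal, meanVal, dif_pos hf, dif_pos hg, dif_pos (hf.add hg), MemLp.toLp_add,
    map_add]

theorem meanVal_smul (c : ℝ) (hf : MemLp f ∞ ν) : meanVal m (c • f) = c * meanVal m f := by
  rw [meanVal, meanVal, dif_pos hf, dif_pos (hf.const_smul c), MemLp.toLp_const_smul, map_smul,
    smul_eq_mul]

theorem meanVal_sub (hf : MemLp f ∞ ν) (hg : MemLp g ∞ ν) :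
    meanVal m (f - g) = meanVal m f - meanVal m g := by
  have : f - g = f + (-1 : ℝ) • g := by simp [sub_eq_add_neg]
  rw [this, meanVal_add hf (hg.const_smul _), meanVal_smul _ hg]
  ring

theorem meanVal_sum {ι : Type*} (s : Finset ι) {F : ι → Ω → ℝ} (hF : ∀ i, MemLp (F i) ∞ ν) :
    meanVal m (∑ i ∈ s, F i) = ∑ i ∈ s, meanVal m (F i) := by
  classical
  induction s using Finset.induction_on with
  | empty =>
    have := meanVal_smul (m := m) 0 (MemLp.zero' (p := ∞) (μ := ν) (ε := ℝ))
    simp only [zero_smul, zero_mul] at this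
    simpa using this
  | insert i s hi ih =>
    rw [Finset.sum_insert hi, Finset.sum_insert hi, meanVal_add (hF i) (memLp_finsetSum' s
      fun i _ => hF i), ih]

theorem meanVal_nonneg (hm : ∀ f : Lp ℝ ∞ ν, 0 ≤ f → 0 ≤ m f) (hf : 0 ≤ᵐ[ν] f) :
    0 ≤ meanVal m f := by
  unfold meanVal
  split_ifs with h
  · refine hm _ ((Lp.coeFn_nonneg _).1 ?_)
    filter_upwards [hf, h.coeFn_toLp] with x h1 h2
    rw [h2]; exact h1
  · exact le_rfl

theorem abs_meanVal_le {C : ℝ} (hC0 : 0 ≤ C) (hC : ∀ x, |f x| ≤ C) :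
    |meanVal m f| ≤ ‖m‖ * C := by
  unfold meanVal
  split_ifs with h
  · refine (m.le_opNorm _).trans ?_
    gcongr
    rw [Lp.norm_toLp]
    refine ENNReal.toReal_le_of_le_ofReal hC0 ?_
    rw [eLpNorm_exponent_top]
    exact eLpNormEssSup_le_of_ae_bound (Eventually.of_forall hC)
  · simpa using mul_nonneg (norm_nonneg m) hC0

end Means

/-! ### Almost invariant integrable functions from an invariant mean -/

section Day

variable {Ω X : Type*} [MeasurableSpace Ω] [MeasurableSpace X] {ν : Measure Ω} {μ : Measure X}

/-- The pairs `((f - f ∘ e j)_j, a)` for the nonnegative integrable functions `f` vanishing outside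
`D` that have an integrable `a` as density of their image under `π`. -/
def dayCone {k : ℕ} (ν : Measure Ω) (μ : Measure X) (D : Set Ω) (π : Ω → X)
    (e : Fin k → Ω ≃ᵐ Ω) : Set ((Fin k → Lp ℝ 1 ν) × Lp ℝ 1 μ) :=
  {v | ∃ (f : Ω → ℝ) (a : X → ℝ) (ha : Integrable a μ)
    (hf : ∀ j, Integrable (fun x => f x - f (e j x)) ν), Measurable f ∧ (∀ x, 0 ≤ f x) ∧
    (∀ x ∉ D, f x = 0) ∧ Integrable f ν ∧
    (∀ A, MeasurableSet A → ∫ x in A, a x ∂μ = ∫ x in π ⁻¹' A, f x ∂ν) ∧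
    v = (fun j => (hf j).toL1 _, ha.toL1 a)}

theorem convex_dayCone {k : ℕ} (D : Set Ω) (π : Ω → X) (e : Fin k → Ω ≃ᵐ Ω) :
    Convex ℝ (dayCone ν μ D π e) := by
  rintro _ ⟨f, a, ha, hf, hfm, hf0, hfD, hfi, hfa, rfl⟩ _ ⟨g, b, hb, hg, hgm, hg0, hgD, hgi, hgb, rfl⟩
    p q hp hq -
  have hI : ∀ j, Integrable (fun x => (p * f x + q * g x) - (p * f (e j x) + q * g (e j x))) ν :=
    fun j => (((hf j).const_mul p).add ((hg j).const_mul q)).congr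
      (Eventually.of_forall fun x => by simp only [Pi.add_apply]; ring)
  refine ⟨fun x => p * f x + q * g x, fun x => p * a x + q * b x,
    (ha.const_mul p).add (hb.const_mul q), hI, (hfm.const_mul p).add (hgm.const_mul q),
    fun x => add_nonneg (mul_nonneg hp (hf0 x)) (mul_nonneg hq (hg0 x)),
    fun x hx => by simp [hfD x hx, hgD x hx], (hfi.const_mul p).add (hgi.const_mul q), ?_, ?_⟩
  · intro A hA
    rw [integral_add (ha.const_mul p).integrableOn (hb.const_mul q).integrableOn,
      integral_add (hfi.const_mul p).integrableOn (hgi.const_mul q).integrableOn,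
      integral_const_mul, integral_const_mul, integral_const_mul, integral_const_mul,
      hfa A hA, hgb A hA]
  · refine Prod.ext (funext fun j => ?_) ?_
    · change p • (hf j).toL1 _ + q • (hg j).toL1 _ = _
      rw [← Integrable.toL1_smul, ← Integrable.toL1_smul, ← Integrable.toL1_add]
      refine (Integrable.toL1_eq_toL1_iff _ _ _ (hI j)).2 (Eventually.of_forall fun x => ?_)
      simp only [Pi.add_apply, smul_eq_mul]; ring
    · change p • ha.toL1 _ + q • hb.toL1 _ = _
      rw [← Integrable.toL1_smul, ← Integrable.toL1_smul, ← Integrable.toL1_add]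
      exact (Integrable.toL1_eq_toL1_iff _ _ _ ((ha.const_mul p).add (hb.const_mul q))).2
        (Eventually.of_forall fun x => rfl)

theorem smul_mem_dayCone {k : ℕ} {D : Set Ω} {π : Ω → X} {e : Fin k → Ω ≃ᵐ Ω}
    {v : (Fin k → Lp ℝ 1 ν) × Lp ℝ 1 μ} (hv : v ∈ dayCone ν μ D π e) {p : ℝ} (hp : 0 ≤ p) :
    p • v ∈ dayCone ν μ D π e := by
  obtain ⟨f, a, ha, hf, hfm, hf0, hfD, hfi, hfa, rfl⟩ := hv
  have hI : ∀ j, Integrable (fun x => p * f x - p * f (e j x)) ν := fun j =>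
    ((hf j).const_mul p).congr (Eventually.of_forall fun x => by ring)
  refine ⟨fun x => p * f x, fun x => p * a x, ha.const_mul p, hI, hfm.const_mul p,
    fun x => mul_nonneg hp (hf0 x), fun x hx => by simp [hfD x hx], hfi.const_mul p, ?_, ?_⟩
  · intro A hA
    rw [integral_const_mul, integral_const_mul, hfa A hA]
  · refine Prod.ext (funext fun j => ?_) ?_
    · change p • (hf j).toL1 _ = _
      rw [← Integrable.toL1_smul]
      refine (Integrable.toL1_eq_toL1_iff _ _ _ (hI j)).2 (Eventually.of_forall fun x => ?_)
      simp only [smul_eq_mul]; ring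
    · change p • ha.toL1 _ = _
      rw [← Integrable.toL1_smul]
      exact (Integrable.toL1_eq_toL1_iff _ _ _ (ha.const_mul p)).2 (Eventually.of_forall fun x => rfl)

/-- The image of a nonnegative integrable function under a map that is nonsingular has an integrable
density. -/
theorem exists_pushforward_density [IsFiniteMeasure μ] {π : Ω → X} (hπ : Measurable π)
    (hac : ∀ N, MeasurableSet N → μ N = 0 → ν (π ⁻¹' N) = 0) {f : Ω → ℝ} (hf : Integrable f ν)
    (hf0 : ∀ x, 0 ≤ f x) :
    ∃ a : X → ℝ, Integrable a μ ∧
      ∀ A, MeasurableSet A → ∫ x in A, a x ∂μ = ∫ x in π ⁻¹' A, f x ∂ν := by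
  let ρ : Measure X := (ν.withDensity fun x => ENNReal.ofReal (f x)).map π
  have hfin : IsFiniteMeasure (ν.withDensity fun x => ENNReal.ofReal (f x)) :=
    isFiniteMeasure_withDensity_ofReal hf.2
  have hfin' : IsFiniteMeasure ρ := Measure.isFiniteMeasure_map _ _
  have hρ : ρ ≪ μ := Measure.AbsolutelyContinuous.mk fun N hN h0 => by
    rw [Measure.map_apply hπ hN]
    exact withDensity_absolutelyContinuous _ _ (hac N hN h0)
  refine ⟨fun x => (ρ.rnDeriv μ x).toReal, Measure.integrable_toReal_rnDeriv, fun A hA => ?_⟩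
  rw [Measure.setIntegral_toReal_rnDeriv hρ, measureReal_def, Measure.map_apply hπ hA,
    withDensity_apply _ (hπ hA), integral_eq_lintegral_of_nonneg_ae (Eventually.of_forall hf0)
      hf.1.restrict]

variable {m : Lp ℝ ∞ ν →L[ℝ] ℝ}

/-- A mean that is invariant on sets is invariant on bounded functions. -/
theorem meanVal_comp_of_invariant {e : Ω → Ω} (he : Measurable e)
    (hinv : ∀ E, MeasurableSet E →
      meanVal m ((e ⁻¹' E).indicator fun _ => (1 : ℝ)) = meanVal m (E.indicator fun _ => (1 : ℝ)))
    {f : Ω → ℝ} (hf : Measurable f) {C : ℝ} (hC : ∀ x, |f x| ≤ C) :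
    meanVal m (fun x => f (e x)) = meanVal m f := by
  have h := eq_zero_of_forall_indicator (L := fun f => meanVal m (fun x => f (e x)) - meanVal m f)
    (K := 2 * ‖m‖) ?_ ?_ ?_ hf hC
  · exact sub_eq_zero.1 h
  · rintro f g hf hg ⟨C, hC⟩ ⟨C', hC'⟩
    have h1 := meanVal_add (m := m) (memLp_top_of_abs_le (ν := ν) hf hC) (memLp_top_of_abs_le hg hC')
    have h2 := meanVal_add (m := m) (memLp_top_of_abs_le (ν := ν) (hf.comp he) fun x => hC (e x))
      (memLp_top_of_abs_le (hg.comp he) fun x => hC' (e x))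
    have h3 : (fun x => (f + g) (e x)) = f ∘ e + g ∘ e := rfl
    simp only [h3, h1, h2]
    simp only [Function.comp_def]
    ring
  · intro f _ C hC0 hC
    have h1 := abs_meanVal_le (m := m) hC0 hC
    have h2 := abs_meanVal_le (m := m) hC0 fun x => hC (e x)
    have := abs_sub (meanVal m fun x => f (e x)) (meanVal m f)
    linarith
  · intro A c hA
    have h1 : (A.indicator fun _ => c) = c • A.indicator fun _ : Ω => (1 : ℝ) := by
      funext x; by_cases hx : x ∈ A <;> simp [hx]
    have h2 : (fun x => A.indicator (fun _ => c) (e x)) =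
        c • (e ⁻¹' A).indicator fun _ : Ω => (1 : ℝ) := by
      funext x; by_cases hx : e x ∈ A <;> simp [hx]
    have hM : ∀ B, MeasurableSet B → MemLp (B.indicator fun _ : Ω => (1 : ℝ)) ∞ ν := fun B hB =>
      (memLp_top_const (1 : ℝ)).indicator hB
    rw [h2, h1, meanVal_smul _ (hM _ (he hA)), meanVal_smul _ (hM _ hA), hinv A hA, sub_self]

/-- If the image under `π` of a mean restricted to `D` has density `φ` on sets, then so it has on
bounded functions. -/
theorem meanVal_indicator_comp_eq_integral [IsFiniteMeasure μ] {π : Ω → X} (hπ : Measurable π)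
    {D : Set Ω} (hD : MeasurableSet D) {φ : X → ℝ} (hφ : Integrable φ μ)
    (hmφ : ∀ A, MeasurableSet A →
      meanVal m ((D ∩ π ⁻¹' A).indicator fun _ => (1 : ℝ)) = ∫ x in A, φ x ∂μ)
    {η : X → ℝ} (hη : Measurable η) {C : ℝ} (hC : ∀ x, |η x| ≤ C) :
    meanVal m (D.indicator fun x => η (π x)) = ∫ x, η x * φ x ∂μ := by
  have hM : ∀ {η : X → ℝ} {C : ℝ}, Measurable η → (∀ x, |η x| ≤ C) →
      MemLp (D.indicator fun x => η (π x)) ∞ ν := fun {η C} hη hC =>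
    (memLp_top_of_abs_le (hη.comp hπ) fun x => hC (π x)).indicator hD
  have hI : ∀ {η : X → ℝ} {C : ℝ}, Measurable η → (∀ x, |η x| ≤ C) →
      Integrable (fun x => η x * φ x) μ := fun {η C} hη hC =>
    hφ.bdd_mul (c := C) hη.aestronglyMeasurable (Eventually.of_forall hC)
  have h := eq_zero_of_forall_indicator
    (L := fun η => meanVal m (D.indicator fun x => η (π x)) - ∫ x, η x * φ x ∂μ)
    (K := ‖m‖ + ∫ x, |φ x| ∂μ) ?_ ?_ ?_ hη hC
  · exact sub_eq_zero.1 h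
  · rintro f g hf hg ⟨C, hC⟩ ⟨C', hC'⟩
    have h1 : (D.indicator fun x => (f + g) (π x)) =
        (D.indicator fun x => f (π x)) + D.indicator fun x => g (π x) :=
      Set.indicator_add D (fun x => f (π x)) fun x => g (π x)
    have h2 : ∫ x, (f + g) x * φ x ∂μ = ∫ x, f x * φ x ∂μ + ∫ x, g x * φ x ∂μ := by
      rw [← integral_add (hI hf hC) (hI hg hC')]
      exact integral_congr_ae (Eventually.of_forall fun x => by simp [add_mul])
    simp only [h1, h2, meanVal_add (hM hf hC) (hM hg hC')]
    ring
  · intro f hf C hC0 hC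
    have h1 : |meanVal m (D.indicator fun x => f (π x))| ≤ ‖m‖ * C := abs_meanVal_le hC0 fun x => by
      by_cases hx : x ∈ D
      · simpa [hx] using hC (π x)
      · simpa [hx] using hC0
    have h2 : |∫ x, f x * φ x ∂μ| ≤ (∫ x, |φ x| ∂μ) * C := by
      rw [← integral_mul_const, ← Real.norm_eq_abs]
      refine norm_integral_le_of_norm_le (hφ.abs.mul_const C) (Eventually.of_forall fun x => ?_)
      rw [Real.norm_eq_abs, abs_mul, mul_comm]
      exact mul_le_mul_of_nonneg_left (hC x) (abs_nonneg _)
    have := abs_sub (meanVal m (D.indicator fun x => f (π x))) (∫ x, f x * φ x ∂μ)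
    linarith
  · intro A c hA
    have h1 : (D.indicator fun x => A.indicator (fun _ => c) (π x)) =
        c • (D ∩ π ⁻¹' A).indicator fun _ : Ω => (1 : ℝ) := by
      funext x
      by_cases hx : x ∈ D <;> by_cases hx' : π x ∈ A <;> simp [hx, hx']
    have h2 : ∫ x, A.indicator (fun _ => c) x * φ x ∂μ = c * ∫ x in A, φ x ∂μ := by
      rw [← integral_const_mul, ← integral_indicator hA]
      refine integral_congr_ae (Eventually.of_forall fun x => ?_)
      by_cases hx : x ∈ A <;> simp [hx]
    rw [h1, h2, meanVal_smul _ ((memLp_top_const (1 : ℝ)).indicator (hD.inter (hπ hA))), hmφ A hA,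
      sub_self]

theorem integral_mul_pushforward_density {π : Ω → X} (hπ : Measurable π) {f : Ω → ℝ} {a : X → ℝ}
    (ha : Integrable a μ) (hf : Integrable f ν)
    (hfa : ∀ A, MeasurableSet A → ∫ x in A, a x ∂μ = ∫ x in π ⁻¹' A, f x ∂ν)
    {η : X → ℝ} (hη : Measurable η) {C : ℝ} (hC : ∀ x, |η x| ≤ C) :
    ∫ x, η x * a x ∂μ = ∫ x, η (π x) * f x ∂ν := by
  have h := eq_zero_of_forall_indicator
    (L := fun η => ∫ x, η x * a x ∂μ - ∫ x, η (π x) * f x ∂ν)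
    (K := ∫ x, |a x| ∂μ + ∫ x, |f x| ∂ν) ?_ ?_ ?_ hη hC
  · exact sub_eq_zero.1 h
  · rintro g g' hg hg' ⟨C, hC⟩ ⟨C', hC'⟩
    have i1 : Integrable (fun x => g x * a x) μ :=
      ha.bdd_mul (c := C) hg.aestronglyMeasurable (Eventually.of_forall hC)
    have i2 : Integrable (fun x => g' x * a x) μ :=
      ha.bdd_mul (c := C') hg'.aestronglyMeasurable (Eventually.of_forall hC')
    have i3 : Integrable (fun x => g (π x) * f x) ν :=
      hf.bdd_mul (c := C) (hg.comp hπ).aestronglyMeasurable (Eventually.of_forall fun x => hC (π x))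
    have i4 : Integrable (fun x => g' (π x) * f x) ν :=
      hf.bdd_mul (c := C') (hg'.comp hπ).aestronglyMeasurable
        (Eventually.of_forall fun x => hC' (π x))
    simp only [Pi.add_apply, add_mul]
    rw [integral_add i1 i2, integral_add i3 i4]
    ring
  · intro g hg C hC0 hC
    have h1 : |∫ x, g x * a x ∂μ| ≤ (∫ x, |a x| ∂μ) * C := by
      rw [← integral_mul_const, ← Real.norm_eq_abs]
      refine norm_integral_le_of_norm_le (ha.abs.mul_const C) (Eventually.of_forall fun x => ?_)
      rw [Real.norm_eq_abs, abs_mul, mul_comm]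
      exact mul_le_mul_of_nonneg_left (hC x) (abs_nonneg _)
    have h2 : |∫ x, g (π x) * f x ∂ν| ≤ (∫ x, |f x| ∂ν) * C := by
      rw [← integral_mul_const, ← Real.norm_eq_abs]
      refine norm_integral_le_of_norm_le (hf.abs.mul_const C) (Eventually.of_forall fun x => ?_)
      rw [Real.norm_eq_abs, abs_mul, mul_comm]
      exact mul_le_mul_of_nonneg_left (hC _) (abs_nonneg _)
    have := abs_sub (∫ x, g x * a x ∂μ) (∫ x, g (π x) * f x ∂ν)
    linarith
  · intro A c hA
    have h1 : ∫ x, A.indicator (fun _ => c) x * a x ∂μ = c * ∫ x in A, a x ∂μ := by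
      rw [← integral_const_mul, ← integral_indicator hA]
      refine integral_congr_ae (Eventually.of_forall fun x => ?_)
      by_cases hx : x ∈ A <;> simp [hx]
    have h2 : ∫ x, A.indicator (fun _ => c) (π x) * f x ∂ν = c * ∫ x in π ⁻¹' A, f x ∂ν := by
      rw [← integral_const_mul, ← integral_indicator (hπ hA)]
      refine integral_congr_ae (Eventually.of_forall fun x => ?_)
      by_cases hx : π x ∈ A <;> simp [hx]
    rw [h1, h2, hfa A hA, sub_self]

theorem zero_mem_dayCone {k : ℕ} {D : Set Ω} {π : Ω → X} {e : Fin k → Ω ≃ᵐ Ω} :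
    (0 : (Fin k → Lp ℝ 1 ν) × Lp ℝ 1 μ) ∈ dayCone ν μ D π e := by
  have hI : Integrable (fun _ : Ω => (0 : ℝ) - 0) ν := (integrable_zero Ω ℝ ν).sub (integrable_zero _ _ _)
  have h0 : hI.toL1 _ = 0 := by
    rw [← Integrable.toL1_zero (integrable_zero Ω ℝ ν)]
    exact (Integrable.toL1_eq_toL1_iff _ _ _ _).2 (Eventually.of_forall fun x => sub_self _)
  refine ⟨fun _ => 0, fun _ => 0, integrable_zero _ _ _, fun j => hI, measurable_const,
    fun _ => le_rfl, fun _ _ => rfl, integrable_zero _ _ _, fun _ _ => by simp, ?_⟩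
  refine Prod.ext (funext fun j => h0.symm) ?_
  exact (Integrable.toL1_zero (integrable_zero X ℝ μ)).symm

theorem exists_bounded_density_prod [SigmaFinite ν] [IsFiniteMeasure μ] {k : ℕ}
    (Λ : ((Fin k → Lp ℝ 1 ν) × Lp ℝ 1 μ) →L[ℝ] ℝ) :
    ∃ (ψ : Fin k → Ω → ℝ) (η : X → ℝ) (Cψ : Fin k → ℝ) (Cη : ℝ), (∀ j, Measurable (ψ j)) ∧
      (∀ j x, |ψ j x| ≤ Cψ j) ∧ Measurable η ∧ (∀ x, |η x| ≤ Cη) ∧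
      ∀ (f : Fin k → Ω → ℝ) (hf : ∀ j, Integrable (f j) ν) (a : X → ℝ) (ha : Integrable a μ),
        Λ (fun j => (hf j).toL1 _, ha.toL1 a) =
          ∑ j, ∫ x, ψ j x * f j x ∂ν + ∫ x, η x * a x ∂μ := by
  let Λ₁ : Fin k → (Lp ℝ 1 ν →L[ℝ] ℝ) := fun j =>
    (Λ.comp (ContinuousLinearMap.inl ℝ _ _)).comp
      (ContinuousLinearMap.single ℝ (fun _ : Fin k => Lp ℝ 1 ν) j)
  let Λ₀ : Lp ℝ 1 μ →L[ℝ] ℝ := Λ.comp (ContinuousLinearMap.inr ℝ _ _)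
  have hdec : ∀ v : Fin k → Lp ℝ 1 ν, ∀ a, Λ (v, a) = ∑ j, Λ₁ j (v j) + Λ₀ a := by
    intro v a
    have h1 : (v, a) = ContinuousLinearMap.inl ℝ _ _ v + ContinuousLinearMap.inr ℝ _ _ a := by
      simp
    rw [h1, map_add]
    congr 1
    conv_lhs => rw [← Finset.univ_sum_single v]
    rw [map_sum, map_sum]
    rfl
  choose ψ hψm hψb hψ using fun j => exists_bounded_density (Λ₁ j)
  obtain ⟨η, hηm, hηb, hη⟩ := exists_bounded_density Λ₀
  refine ⟨ψ, η, _, _, hψm, hψb, hηm, hηb, fun f hf a ha => ?_⟩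
  rw [hdec, hη]
  congr 1
  exact Finset.sum_congr rfl fun j _ => hψ j _ _

/-- **Day's convexity argument.** Let `m` be a positive functional on `L^∞`, restricted to a set
`D`, that is invariant under finitely many automorphisms preserving `D`, and whose image under `π`
has density `φ`. Then there are nonnegative integrable functions `f` on `D` that are almost
invariant in `L¹`, and whose images under `π` have densities close to `φ` in `L¹`. Otherwise the
Hahn–Banach theorem separates `(0, φ)` from the cone of the pairs `((f - f ∘ e j)_j, a)`; the
functional that separates is given by a function that is nonnegative on `D` and has negative mean.
-/
theorem exists_almost_invariant [SigmaFinite ν] [IsFiniteMeasure μ]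
    (hm : ∀ f : Lp ℝ ∞ ν, 0 ≤ f → 0 ≤ m f) {π : Ω → X} (hπ : Measurable π)
    (hac : ∀ N, MeasurableSet N → μ N = 0 → ν (π ⁻¹' N) = 0) {D : Set Ω} (hD : MeasurableSet D)
    {φ : X → ℝ} (hφ : Integrable φ μ)
    (hmφ : ∀ A, MeasurableSet A →
      meanVal m ((D ∩ π ⁻¹' A).indicator fun _ => (1 : ℝ)) = ∫ x in A, φ x ∂μ)
    {k : ℕ} (e : Fin k → Ω ≃ᵐ Ω) (he : ∀ j, MeasurePreserving (e j) ν ν)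
    (heD : ∀ j x, e j x ∈ D ↔ x ∈ D)
    (hinv : ∀ j E, MeasurableSet E →
      meanVal m ((e j ⁻¹' E).indicator fun _ => (1 : ℝ)) = meanVal m (E.indicator fun _ => (1 : ℝ)))
    {ε : ℝ} (hε : 0 < ε) :
    ∃ (f : Ω → ℝ) (a : X → ℝ), Measurable f ∧ (∀ x, 0 ≤ f x) ∧ (∀ x ∉ D, f x = 0) ∧
      Integrable f ν ∧ Integrable a μ ∧
      (∀ A, MeasurableSet A → ∫ x in A, a x ∂μ = ∫ x in π ⁻¹' A, f x ∂ν) ∧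
      (∀ j, ∫ x, |f x - f (e j x)| ∂ν < ε) ∧ ∫ x, |a x - φ x| ∂μ < ε := by
  classical
  let t : (Fin k → Lp ℝ 1 ν) × Lp ℝ 1 μ := (0, hφ.toL1 φ)
  have hcl : t ∈ closure (dayCone ν μ D π e) := by
    by_contra hnot
    obtain ⟨Λ, u, hu, hΛ⟩ := geometric_hahn_banach_point_closed
      (convex_dayCone (ν := ν) (μ := μ) D π e).closure isClosed_closure hnot
    have hΛ' : ∀ b ∈ dayCone ν μ D π e, u < Λ b := fun b hb => hΛ b (subset_closure hb)
    -- The functional is nonnegative on the cone and negative at `t`.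
    have hΛ0 : ∀ b ∈ dayCone ν μ D π e, 0 ≤ Λ b := by
      intro b hb
      by_contra! hneg
      have h := hΛ' _ (smul_mem_dayCone hb (p := |u| / -Λ b)
        (div_nonneg (abs_nonneg u) (by linarith)))
      rw [map_smul, smul_eq_mul, div_mul_eq_mul_div, lt_div_iff₀ (by linarith)] at h
      have := neg_abs_le u
      nlinarith
    have hΛt : Λ t < 0 := by
      have := hΛ' _ zero_mem_dayCone
      rw [map_zero] at this
      linarith
    obtain ⟨ψ, η, Cψ, Cη, hψm, hψb, hηm, hηb, hrep⟩ := exists_bounded_density_prod Λ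
    let Ψ : Ω → ℝ := fun x => ∑ j, (ψ j x - ψ j ((e j).symm x)) + η (π x)
    have hΨm : Measurable Ψ := (Finset.measurable_sum _ fun j _ =>
      (hψm j).sub ((hψm j).comp (e j).symm.measurable)).add (hηm.comp hπ)
    have hΨb : ∀ x, |Ψ x| ≤ ∑ j, (Cψ j + Cψ j) + Cη := by
      intro x
      refine (abs_add_le _ _).trans (add_le_add ((Finset.abs_sum_le_sum_abs _ _).trans
        (Finset.sum_le_sum fun j _ => ?_)) (hηb _))
      exact (abs_sub _ _).trans (add_le_add (hψb j _) (hψb j _))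
    -- Pairing with an element of the cone.
    have hpair : ∀ (B : Set Ω), MeasurableSet B → B ⊆ D → ν B < ∞ → 0 ≤ ∫ x in B, Ψ x ∂ν := by
      intro B hB hBD hBfin
      have hfi : Integrable (B.indicator fun _ => (1 : ℝ)) ν :=
        (integrable_indicator_iff hB).2 (integrableOn_const hBfin.ne)
      have hf0 : ∀ x, 0 ≤ B.indicator (fun _ => (1 : ℝ)) x := fun x =>
        Set.indicator_nonneg (fun _ _ => zero_le_one) x
      obtain ⟨a, ha, hfa⟩ := exists_pushforward_density (μ := μ) hπ hac hfi hf0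
      have hfe : ∀ j, Integrable (fun x => B.indicator (fun _ => (1 : ℝ)) (e j x)) ν := fun j =>
        (he j).integrable_comp_of_integrable hfi
      have hpos := hΛ0 _ ⟨B.indicator fun _ => (1 : ℝ), a, ha, fun j => hfi.sub (hfe j),
        measurable_const.indicator hB, hf0,
        fun x hx => Set.indicator_of_notMem (fun h => hx (hBD h)) _, hfi, hfa, rfl⟩
      have hηφ : ∫ x, η x * a x ∂μ = ∫ x in B, η (π x) ∂ν := by
        rw [integral_mul_pushforward_density hπ ha hfi hfa hηm hηb, ← integral_indicator hB]
        refine integral_congr_ae (Eventually.of_forall fun x => ?_)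
        by_cases hx : x ∈ B <;> simp [hx]
      have hψe : ∀ j, ∫ x, ψ j x * (B.indicator (fun _ => (1 : ℝ)) x -
          B.indicator (fun _ => (1 : ℝ)) (e j x)) ∂ν = ∫ x in B, (ψ j x - ψ j ((e j).symm x)) ∂ν := by
        intro j
        have i1 : Integrable (fun x => ψ j x * B.indicator (fun _ => (1 : ℝ)) x) ν :=
          hfi.bdd_mul (c := Cψ j) (hψm j).aestronglyMeasurable (Eventually.of_forall (hψb j))
        have i2 : Integrable (fun x => ψ j x * B.indicator (fun _ => (1 : ℝ)) (e j x)) ν :=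
          (hfe j).bdd_mul (c := Cψ j) (hψm j).aestronglyMeasurable (Eventually.of_forall (hψb j))
        have i3 : IntegrableOn (ψ j) B ν :=
          Measure.integrableOn_of_bounded hBfin.ne (hψm j).aestronglyMeasurable (M := Cψ j)
            (Eventually.of_forall (hψb j))
        have i4 : IntegrableOn (fun x => ψ j ((e j).symm x)) B ν :=
          Measure.integrableOn_of_bounded hBfin.ne
            ((hψm j).comp (e j).symm.measurable).aestronglyMeasurable (M := Cψ j)
            (Eventually.of_forall fun x => hψb j _)
        have e1 : ∫ x, ψ j x * B.indicator (fun _ => (1 : ℝ)) x ∂ν = ∫ x in B, ψ j x ∂ν := by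
          rw [← integral_indicator hB]
          refine integral_congr_ae (Eventually.of_forall fun x => ?_)
          by_cases hx : x ∈ B <;> simp [hx]
        have e2 : ∫ x, ψ j x * B.indicator (fun _ => (1 : ℝ)) (e j x) ∂ν =
            ∫ x in B, ψ j ((e j).symm x) ∂ν := by
          rw [← integral_indicator hB]
          refine Eq.trans ?_ ((he j).integral_comp (e j).measurableEmbedding _)
          refine integral_congr_ae (Eventually.of_forall fun x => ?_)
          by_cases hx : e j x ∈ B <;> simp [hx]
        simp only [mul_sub]
        rw [integral_sub i1 i2, integral_sub i3 i4, e1, e2]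
      rw [hrep] at hpos
      have : ∫ x in B, Ψ x ∂ν = ∑ j, ∫ x in B, (ψ j x - ψ j ((e j).symm x)) ∂ν +
          ∫ x in B, η (π x) ∂ν := by
        rw [integral_add, integral_finsetSum]
        · intro j _
          refine Measure.integrableOn_of_bounded hBfin.ne
            ((hψm j).sub ((hψm j).comp (e j).symm.measurable)).aestronglyMeasurable
            (M := Cψ j + Cψ j) (Eventually.of_forall fun x => ?_)
          exact (norm_sub_le _ _).trans (add_le_add (hψb j _) (hψb j _))
        · refine integrable_finsetSum _ fun j _ => ?_
          refine Measure.integrableOn_of_bounded hBfin.ne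
            ((hψm j).sub ((hψm j).comp (e j).symm.measurable)).aestronglyMeasurable
            (M := Cψ j + Cψ j) (Eventually.of_forall fun x => ?_)
          exact (norm_sub_le _ _).trans (add_le_add (hψb j _) (hψb j _))
        · exact Measure.integrableOn_of_bounded hBfin.ne (hηm.comp hπ).aestronglyMeasurable
            (M := Cη) (Eventually.of_forall fun x => hηb _)
      rw [this, ← hηφ]
      simpa only [hψe] using hpos
    have hΨD : 0 ≤ᵐ[ν] D.indicator Ψ := by
      refine ae_nonneg_of_forall_setIntegral_nonneg_of_sigmaFinite (fun s hs hsfin => ?_)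
        fun s hs hsfin => ?_
      · exact Measure.integrableOn_of_bounded hsfin.ne (hΨm.indicator hD).aestronglyMeasurable
          (M := ∑ j, (Cψ j + Cψ j) + Cη) (Eventually.of_forall fun x =>
            (norm_indicator_le_norm_self _ _).trans (hΨb x))
      · rw [setIntegral_indicator hD]
        exact hpair _ (hs.inter hD) Set.inter_subset_right
          ((measure_mono Set.inter_subset_left).trans_lt hsfin)
    have ht : Λ t = ∫ x, η x * φ x ∂μ := by
      have h := hrep (fun _ _ => 0) (fun _ => integrable_zero _ _ _) φ hφ
      simp only [mul_zero, integral_zero, Finset.sum_const_zero, zero_add] at h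
      rw [← h]
      congr 1
    have hmean : meanVal m (D.indicator Ψ) = Λ t := by
      have hψL : ∀ j, MemLp (D.indicator (ψ j)) ∞ ν := fun j =>
        (memLp_top_of_abs_le (hψm j) (hψb j)).indicator hD
      have hψL' : ∀ j, MemLp (D.indicator fun x => ψ j ((e j).symm x)) ∞ ν := fun j =>
        (memLp_top_of_abs_le ((hψm j).comp (e j).symm.measurable) fun x => hψb j _).indicator hD
      have hηL : MemLp (D.indicator fun x => η (π x)) ∞ ν :=
        (memLp_top_of_abs_le (hηm.comp hπ) fun x => hηb _).indicator hD
      have hsplit : D.indicator Ψ = ∑ j, (D.indicator (ψ j) -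
          D.indicator fun x => ψ j ((e j).symm x)) + D.indicator fun x => η (π x) := by
        funext x
        by_cases hx : x ∈ D <;> simp [hx, Ψ]
      rw [hsplit, meanVal_add (memLp_finsetSum' _ fun j _ => (hψL j).sub (hψL' j)) hηL,
        meanVal_sum _ fun j => (hψL j).sub (hψL' j),
        meanVal_indicator_comp_eq_integral hπ hD hφ hmφ hηm hηb, ht]
      have hz : ∀ j, meanVal m (D.indicator (ψ j) - D.indicator fun x => ψ j ((e j).symm x)) = 0 := by
        intro j
        rw [meanVal_sub (hψL j) (hψL' j), sub_eq_zero]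
        have := meanVal_comp_of_invariant (e j).measurable (hinv j)
          (f := D.indicator fun x => ψ j ((e j).symm x)) (C := Cψ j)
          (((hψm j).comp (e j).symm.measurable).indicator hD)
          (fun x => (norm_indicator_le_norm_self (E := ℝ) _ x).trans (hψb j _))
        rw [← this]
        congr 1
        funext x
        by_cases hx : x ∈ D
        · simp [hx, (heD j x).2 hx]
        · simp [hx, (heD j x).not.2 hx]
      simp only [hz, Finset.sum_const_zero, zero_add]
    have := meanVal_nonneg hm hΨD
    linarith
  obtain ⟨v, ⟨f, a, ha, hf, hfm, hf0, hfD, hfi, hfa, rfl⟩, hdist⟩ := Metric.mem_closure_iff.1 hcl ε hε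
  refine ⟨f, a, hfm, hf0, hfD, hfi, ha, hfa, fun j => ?_, ?_⟩
  · have h1 := (dist_le_pi_dist _ _ j).trans_lt ((le_max_left _ _).trans_lt hdist)
    rw [dist_comm] at h1
    simp only [t, Pi.zero_apply, dist_zero_right] at h1
    rwa [L1.norm_of_fun_eq_integral_norm] at h1
  · have h1 := (le_max_right _ _).trans_lt hdist
    rw [dist_comm, dist_eq_norm] at h1
    simp only [t] at h1
    rw [← Integrable.toL1_sub, L1.norm_of_fun_eq_integral_norm] at h1
    exact h1

end Day

/-! ### Covers by partial bisections -/

section Atlas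

variable {X : Type*} [Groupoid X] [MeasurableSpace X] [MeasurableSpace (Elt X)] {μ : Measure X}

/-- A countable partition, into partial bisections, of the set of all elements over an invariant
Borel set `Y` of units. -/
structure IsAtlas (Y : Set X) (σ : ℕ → Set (Elt X)) : Prop where
  measurableSet : MeasurableSet Y
  src_mem_iff : ∀ g : Elt X, src g ∈ Y ↔ rng g ∈ Y
  isPartialBisection : ∀ n, IsPartialBisection (σ n)
  disjoint : Pairwise (Function.onFun Disjoint σ)
  iUnion_eq : ⋃ n, σ n = src ⁻¹' Y

theorem IsAtlas.src_mem {Y : Set X} {σ : ℕ → Set (Elt X)} (h : IsAtlas Y σ) {n : ℕ} {g : Elt X}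
    (hg : g ∈ σ n) : src g ∈ Y := by
  have : g ∈ ⋃ n, σ n := Set.mem_iUnion.2 ⟨n, hg⟩
  rwa [h.iUnion_eq] at this

theorem IsAtlas.exists_mem {Y : Set X} {σ : ℕ → Set (Elt X)} (h : IsAtlas Y σ) {g : Elt X}
    (hg : src g ∈ Y) : ∃ n, g ∈ σ n := by
  have : g ∈ ⋃ n, σ n := by rw [h.iUnion_eq]; exact hg
  exact Set.mem_iUnion.1 this

theorem IsAtlas.restrict (hG : IsDiscreteBorel X) {Y Z : Set X} {σ : ℕ → Set (Elt X)}
    (h : IsAtlas Y σ) (hZ : MeasurableSet Z) (hZinv : ∀ g : Elt X, src g ∈ Z ↔ rng g ∈ Z)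
    (hZY : Z ⊆ Y) : IsAtlas Z fun n => σ n ∩ src ⁻¹' Z where
  measurableSet := hZ
  src_mem_iff := hZinv
  isPartialBisection n := (h.isPartialBisection n).inter (hG.measurable_src hZ)
  disjoint _ _ hij := (h.disjoint hij).mono Set.inter_subset_left Set.inter_subset_left
  iUnion_eq := by
    rw [← Set.iUnion_inter, h.iUnion_eq]
    exact Set.inter_eq_right.2 fun g hg => hZY hg

/-- A discrete p.m.p. groupoid is, over a conull set of units, a countable union of partial
bisections, which can be chosen inside a given Borel set or disjoint from it. -/
theorem IsDiscretePMP.exists_atlas (hG : IsDiscretePMP μ) {P : Set (Elt X)} (hP : MeasurableSet P) :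
    ∃ Y σ, IsAtlas Y σ ∧ μ Yᶜ = 0 ∧ ∀ n, σ n ⊆ P ∨ Disjoint (σ n) P := by
  have := hG.standardBorel_units
  have := hG.standardBorel_elts
  have := hG.prob
  obtain ⟨S, hS, hScov⟩ := hasAeCover_univ μ hG.measurable_src hG.countable_src
  obtain ⟨T, hT, hTcov⟩ := hasAeCover_univ μ hG.measurable_rng hG.countable_rng
  obtain ⟨N, hN, hNm, hN0, hNinv⟩ := hG.exists_invariant_null (ae_iff.1 (hScov.and hTcov))
  obtain ⟨u, hu⟩ := exists_surjective_nat (ℕ × ℕ × Bool)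
  let ρ : ℕ → Set (Elt X) := fun n =>
    S (u n).1 ∩ T (u n).2.1 ∩ (if (u n).2.2 then P else Pᶜ) ∩ src ⁻¹' Nᶜ
  have hρm : ∀ n, MeasurableSet (ρ n) := by
    intro n
    refine (((hS _).1.inter (hT _).1).inter ?_).inter (hG.measurable_src hNm.compl)
    split_ifs
    exacts [hP, hP.compl]
  have hcov : ∀ g : Elt X, src g ∉ N → ∃ n, g ∈ ρ n := by
    intro g hg
    have h1 : ¬ ¬ _ := fun h => hg (hN h)
    have h2 : ¬ ¬ _ := fun h => (hNinv g).not.1 hg (hN h)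
    obtain ⟨i, hi⟩ := (not_not.1 h1).1 g trivial rfl
    obtain ⟨j, hj⟩ := (not_not.1 h2).2 g trivial rfl
    by_cases hgP : g ∈ P
    · obtain ⟨n, hn⟩ := hu (i, j, true)
      exact ⟨n, by simp only [ρ, hn]; exact ⟨⟨⟨hi, hj⟩, by simpa⟩, hg⟩⟩
    · obtain ⟨n, hn⟩ := hu (i, j, false)
      exact ⟨n, by simp only [ρ, hn]; exact ⟨⟨⟨hi, hj⟩, by simpa⟩, hg⟩⟩
  refine ⟨Nᶜ, disjointed ρ, ⟨hNm.compl, fun g => (hNinv g).not, fun n => ?_,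
    disjoint_disjointed ρ, ?_⟩, by rwa [compl_compl], fun n => ?_⟩
  · have hsub := disjointed_subset ρ n
    exact ⟨MeasurableSet.disjointed hρm n, (hS _).2.mono (hsub.trans fun g hg => hg.1.1.1),
      (hT _).2.mono (hsub.trans fun g hg => hg.1.1.2)⟩
  · rw [iUnion_disjointed]
    refine subset_antisymm (Set.iUnion_subset fun n g hg => hg.2) fun g hg => ?_
    exact Set.mem_iUnion.2 (hcov g hg)
  · have hsub := disjointed_subset ρ n
    cases h : (u n).2.2
    · refine Or.inr (Set.disjoint_left.2 fun g hg => ?_)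
      have := (hsub hg).1.2
      simpa [h] using this
    · refine Or.inl fun g hg => ?_
      have := (hsub hg).1.2
      simpa [h] using this

/-- Sums over the source fibres depend measurably on parameters. -/
theorem IsAtlas.measurable_tsum_src (hG : IsDiscreteBorel X) {Y : Set X} {σ : ℕ → Set (Elt X)}
    (h : IsAtlas Y σ) {Z : Type*} [MeasurableSpace Z] {a : Z → X} (ha : Measurable a)
    {f : Z × Elt X → ℝ≥0∞} (hf : Measurable f) (hfY : ∀ z g, src g ∉ Y → f (z, g) = 0) :
    Measurable fun z => ∑' g : {g : Elt X // src g = a z}, f (z, g) := by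
  classical
  have key : ∀ z, ∑' g : {g : Elt X // src g = a z}, f (z, g) =
      ∑' n, if a z ∈ src '' σ n then f (z, sec (σ n) (a z)) else 0 := by
    intro z
    have h1 : ∀ g : {g : Elt X // src g = a z},
        f (z, g) = ∑' n, (σ n).indicator (fun g => f (z, g)) g := by
      intro g
      by_cases hg : src g.1 ∈ Y
      · obtain ⟨n, hn⟩ := h.exists_mem hg
        rw [tsum_eq_single n, Set.indicator_of_mem hn]
        intro k hk
        exact Set.indicator_of_notMem (fun hk' => Set.disjoint_left.1 (h.disjoint hk) hk' hn) _
      · rw [hfY z g hg, eq_comm, ENNReal.tsum_eq_zero]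
        intro n
        exact Set.indicator_of_notMem (fun hn => hg (h.src_mem hn)) _
    simp_rw [h1]
    rw [ENNReal.tsum_comm]
    refine tsum_congr fun n => ?_
    split_ifs with hz
    · rw [tsum_eq_single ⟨sec (σ n) (a z), src_sec _ _⟩, Set.indicator_of_mem (sec_mem hz)]
      rintro ⟨g, hg⟩ hne
      refine Set.indicator_of_notMem (fun hgn => hne (Subtype.ext ?_)) _
      exact (h.isPartialBisection n).src_injOn hgn (sec_mem hz) (by rw [hg, src_sec])
    · rw [ENNReal.tsum_eq_zero]
      rintro ⟨g, hg⟩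
      exact Set.indicator_of_notMem (fun hgn => hz ⟨g, hgn, hg⟩) _
  simp_rw [key]
  refine Measurable.tsum fun n => Measurable.ite
    (ha (measurableSet_src_image hG (h.isPartialBisection n))) ?_ measurable_const
  exact hf.comp (measurable_id.prodMk ((measurable_sec hG (h.isPartialBisection n)).comp ha))

/-- Inversion maps range fibres to source fibres. -/
def invFibreEquiv (x : X) : {g : Elt X // src g = x} ≃ {g : Elt X // rng g = x} where
  toFun g := ⟨g.1⁻¹, g.2⟩
  invFun g := ⟨g.1⁻¹, g.2⟩
  left_inv g := Subtype.ext (elt_inv_inv g.1)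
  right_inv g := Subtype.ext (elt_inv_inv g.1)

theorem IsAtlas.measurable_tsum_rng (hG : IsDiscreteBorel X) {Y : Set X} {σ : ℕ → Set (Elt X)}
    (h : IsAtlas Y σ) {Z : Type*} [MeasurableSpace Z] {a : Z → X} (ha : Measurable a)
    {f : Z × Elt X → ℝ≥0∞} (hf : Measurable f) (hfY : ∀ z g, rng g ∉ Y → f (z, g) = 0) :
    Measurable fun z => ∑' g : {g : Elt X // rng g = a z}, f (z, g) := by
  have key : ∀ z, ∑' g : {g : Elt X // rng g = a z}, f (z, g) =
      ∑' g : {g : Elt X // src g = a z}, f (z, g.1⁻¹) := fun z =>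
    ((invFibreEquiv (a z)).tsum_eq fun g : {g : Elt X // rng g = a z} => f (z, g)).symm
  simp_rw [key]
  exact h.measurable_tsum_src hG ha
    (f := fun p => f (p.1, p.2⁻¹))
    (hf.comp (measurable_fst.prodMk (hG.measurable_inv_fun measurable_snd)))
    fun z g hg => hfY z g⁻¹ hg

/-- The elements over `Y` of a Borel set `P` are covered by countably many full sections that take
values in `P ∪ P⁻¹` and the units. A partial bisection that consists of isotropy elements, or has
disjoint source and range, extends to a full section; the other elements are covered by separating
source and range by countably many Borel sets. -/
theorem IsAtlas.exists_fullSections (hG : IsDiscreteBorel X) {Y : Set X} {σ : ℕ → Set (Elt X)}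
    (h : IsAtlas Y σ) {P : Set (Elt X)} (hP : MeasurableSet P) :
    ∃ φ : ℕ → X → Elt X, (∀ j, IsFullSection (φ j)) ∧
      (∀ j x, φ j x ∈ P ∨ (φ j x)⁻¹ ∈ P ∨ φ j x = unit x) ∧
      ∀ g ∈ P, src g ∈ Y → ∃ j, φ j (src g) = g := by
  have := hG.standardBorel_units
  obtain ⟨A, hA, hsep⟩ := exists_seq_separating X MeasurableSet.empty Set.univ
  let Q : Option (ℕ × Bool) → Set (Elt X) := fun o => match o with
    | none => {g | src g = rng g}
    | some (k, true) => src ⁻¹' A k ∩ rng ⁻¹' (A k)ᶜ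
    | some (k, false) => src ⁻¹' (A k)ᶜ ∩ rng ⁻¹' A k
  have hQ : ∀ o, MeasurableSet (Q o) := by
    rintro (_ | ⟨k, _ | _⟩)
    · exact measurableSet_eq_fun hG.measurable_src hG.measurable_rng
    · exact (hG.measurable_src (hA k).compl).inter (hG.measurable_rng (hA k))
    · exact (hG.measurable_src (hA k)).inter (hG.measurable_rng (hA k).compl)
  have hQ' : ∀ o, (∀ g ∈ Q o, src g = rng g) ∨ Disjoint (src '' Q o) (rng '' Q o) := by
    rintro (_ | ⟨k, _ | _⟩)
    · exact Or.inl fun g hg => hg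
    · refine Or.inr (Set.disjoint_left.2 ?_)
      rintro _ ⟨g, hg, rfl⟩ ⟨g', hg', e⟩
      exact hg.1 (e ▸ hg'.2)
    · refine Or.inr (Set.disjoint_left.2 ?_)
      rintro _ ⟨g, hg, rfl⟩ ⟨g', hg', e⟩
      exact hg'.2 (e ▸ hg.1)
  have hQcov : ∀ g, ∃ o, g ∈ Q o := by
    intro g
    by_cases hg : src g = rng g
    · exact ⟨none, hg⟩
    · have : ¬ ∀ n, src g ∈ A n ↔ rng g ∈ A n := fun h => hg (hsep _ trivial _ trivial h)
      push Not at this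
      obtain ⟨n, ⟨h1, h2⟩ | ⟨h1, h2⟩⟩ := this
      · exact ⟨some (n, true), h1, h2⟩
      · exact ⟨some (n, false), h1, h2⟩
  obtain ⟨u, hu⟩ := exists_surjective_nat (ℕ × Option (ℕ × Bool))
  let τ : ℕ → Set (Elt X) := fun j => σ (u j).1 ∩ P ∩ Q (u j).2
  have hτ : ∀ j, IsPartialBisection (τ j) := fun j =>
    ((h.isPartialBisection _).inter hP).inter (hQ _)
  refine ⟨fun j => extendSection (τ j), fun j => isFullSection_extendSection hG (hτ j) ?_, ?_, ?_⟩
  · rcases hQ' (u j).2 with hq | hq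
    · exact Or.inl fun g hg => hq g hg.2
    · exact Or.inr (hq.mono (Set.image_mono Set.inter_subset_right)
        (Set.image_mono Set.inter_subset_right))
  · intro j x
    rcases extendSection_mem (τ j) x with h1 | h1 | h1
    · exact Or.inl h1.1.2
    · exact Or.inr (Or.inl h1.1.2)
    · exact Or.inr (Or.inr h1)
  · intro g hg hgY
    obtain ⟨n, hn⟩ := h.exists_mem hgY
    obtain ⟨o, ho⟩ := hQcov g
    obtain ⟨j, hj⟩ := hu (n, o)
    refine ⟨j, extendSection_src (hτ j) ?_⟩
    simp only [τ, hj]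
    exact ⟨⟨hn, hg⟩, ho⟩

/-- The measure of a discrete p.m.p. groupoid is `σ`-finite. -/
theorem IsDiscretePMP.sigmaFinite (hG : IsDiscretePMP μ) : SigmaFinite (srcMeasure μ) := by
  have := hG.standardBorel_units
  have := hG.standardBorel_elts
  have := hG.prob
  obtain ⟨Y, σ, hσ, hY, -⟩ := hG.exists_atlas MeasurableSet.empty
  refine ⟨⟨⟨fun n => ⋃ i ∈ Finset.range n, (σ i ∪ src ⁻¹' Yᶜ), fun _ => trivial, fun n => ?_, ?_⟩⟩⟩
  · refine (measure_biUnion_finset_le _ _).trans_lt (ENNReal.sum_lt_top.2 fun i _ => ?_)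
    refine (measure_union_le _ _).trans_lt (ENNReal.add_lt_top.2 ⟨?_, ?_⟩)
    · rw [← lintegral_indicator_one (hσ.isPartialBisection i).measurableSet,
        hG.lintegral_src (measurable_one.indicator (hσ.isPartialBisection i).measurableSet)]
      refine (lintegral_mono (g := fun _ => 1) fun x => ?_).trans_lt (by simp)
      by_cases hx : x ∈ src '' σ i
      · obtain ⟨g, hg, rfl⟩ := hx
        rw [tsum_eq_single ⟨g, rfl⟩]
        · simp [hg]
        · rintro ⟨g', hg'⟩ hne
          refine Set.indicator_of_notMem (fun h => hne (Subtype.ext ?_)) _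
          exact (hσ.isPartialBisection i).src_injOn h hg hg'
      · refine le_of_eq_of_le (ENNReal.tsum_eq_zero.2 ?_) zero_le_one
        rintro ⟨g, rfl⟩
        exact Set.indicator_of_notMem (fun hg => hx ⟨g, hg, rfl⟩) _
    · have : srcMeasure μ (src ⁻¹' Yᶜ) = 0 := by
        rw [measure_eq_zero_iff_ae_notMem, hG.ae_iff_src]
        filter_upwards [measure_eq_zero_iff_ae_notMem.1 hY] with x hx g hg
        simpa [hg] using hx
      rw [this]; exact ENNReal.zero_lt_top
  · rw [Set.eq_univ_iff_forall]
    intro g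
    by_cases hg : src g ∈ Y
    · obtain ⟨n, hn⟩ := hσ.exists_mem hg
      exact Set.mem_iUnion.2 ⟨n + 1, Set.mem_biUnion (Finset.self_mem_range_succ n) (Or.inl hn)⟩
    · exact Set.mem_iUnion.2 ⟨1, Set.mem_biUnion (Finset.self_mem_range_succ 0) (Or.inr hg)⟩

end Atlas

/-! ### Invariant means on the groupoid -/

section MeanOf

variable {Ω X : Type*} [MeasurableSpace Ω] [MeasurableSpace X] {ν : Measure Ω} {μ : Measure X}
  {m : Lp ℝ ∞ ν →L[ℝ] ℝ}

/-- The mass that a functional on `L^∞` gives to a set. -/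
noncomputable abbrev meanOf (m : Lp ℝ ∞ ν →L[ℝ] ℝ) (D : Set Ω) : ℝ :=
  meanVal m (D.indicator fun _ => (1 : ℝ))

theorem memLp_indicator_one {D : Set Ω} (hD : MeasurableSet D) :
    MemLp (D.indicator fun _ => (1 : ℝ)) ∞ ν :=
  (memLp_top_const (1 : ℝ)).indicator hD

theorem meanOf_nonneg (hm : ∀ f : Lp ℝ ∞ ν, 0 ≤ f → 0 ≤ m f) (D : Set Ω) : 0 ≤ meanOf m D :=
  meanVal_nonneg hm (Eventually.of_forall fun x => Set.indicator_nonneg (by simp) x)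

theorem meanOf_union {D E : Set Ω} (hD : MeasurableSet D) (hE : MeasurableSet E)
    (h : Disjoint D E) : meanOf m (D ∪ E) = meanOf m D + meanOf m E := by
  rw [meanOf, Set.indicator_union_of_disjoint h,
    ← meanVal_add (memLp_indicator_one hD) (memLp_indicator_one hE)]
  rfl

theorem meanOf_inter_add_diff {D E : Set Ω} (hD : MeasurableSet D) (hE : MeasurableSet E) :
    meanOf m (D ∩ E) + meanOf m (D \ E) = meanOf m D := by
  rw [← meanOf_union (hD.inter hE) (hD.diff hE) Set.disjoint_sdiff_inter.symm,
    Set.inter_union_sdiff]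

theorem meanOf_mono (hm : ∀ f : Lp ℝ ∞ ν, 0 ≤ f → 0 ≤ m f) {D E : Set Ω} (hD : MeasurableSet D)
    (hE : MeasurableSet E) (h : D ⊆ E) : meanOf m D ≤ meanOf m E := by
  rw [← meanOf_inter_add_diff (m := m) hE hD, Set.inter_eq_right.2 h]
  exact le_add_of_nonneg_right (meanOf_nonneg hm _)

theorem meanOf_empty : meanOf m (∅ : Set Ω) = 0 := by
  have := meanOf_union (m := m) MeasurableSet.empty MeasurableSet.empty (disjoint_bot_left (a := (∅ : Set Ω)))
  rw [Set.union_empty] at this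
  linarith

/-- If a positive functional on `L^∞` is mapped to the countably additive measure `μ` by `π`, then
so is its restriction to any set, whose image therefore has a density. -/
theorem exists_density_of_meanOf_preimage [IsFiniteMeasure μ]
    (hm : ∀ f : Lp ℝ ∞ ν, 0 ≤ f → 0 ≤ m f) {π : Ω → X} (hπ : Measurable π)
    (hmμ : ∀ A, MeasurableSet A → meanOf m (π ⁻¹' A) = μ.real A)
    {D : Set Ω} (hD : MeasurableSet D) :
    ∃ φ : X → ℝ, Measurable φ ∧ Integrable φ μ ∧
      ∀ A, MeasurableSet A → meanOf m (D ∩ π ⁻¹' A) = ∫ x in A, φ x ∂μ := by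
  let κ : Set X → ℝ := fun A => meanOf m (D ∩ π ⁻¹' A)
  have hκ0 : ∀ A, 0 ≤ κ A := fun A => meanOf_nonneg hm _
  have hκle : ∀ A, MeasurableSet A → κ A ≤ μ.real A := fun A hA => by
    rw [← hmμ A hA]
    exact meanOf_mono hm (hD.inter (hπ hA)) (hπ hA) Set.inter_subset_right
  have hκadd : ∀ A B, MeasurableSet A → MeasurableSet B → Disjoint A B →
      κ (A ∪ B) = κ A + κ B := fun A B hA hB h => by
    simp only [κ]
    rw [Set.preimage_union, Set.inter_union_distrib_left]
    exact meanOf_union (hD.inter (hπ hA)) (hD.inter (hπ hB))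
      ((h.preimage π).mono Set.inter_subset_right Set.inter_subset_right)
  have hκsum : ∀ f : ℕ → Set X, (∀ i, MeasurableSet (f i)) → Pairwise (Function.onFun Disjoint f) →
      HasSum (fun i => κ (f i)) (κ (⋃ i, f i)) := by
    intro f hf hd
    have hpart : ∀ n, ∑ i ∈ Finset.range n, κ (f i) + κ (⋃ i, f (i + n)) = κ (⋃ i, f i) := by
      intro n
      induction n with
      | zero => simp
      | succ n ih =>
        have e : ⋃ i, f (i + n) = f n ∪ ⋃ i, f (i + (n + 1)) := by
          ext x
          simp only [Set.mem_iUnion, Set.mem_union]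
          constructor
          · rintro ⟨_ | i, hi⟩
            · exact Or.inl (by simpa using hi)
            · exact Or.inr ⟨i, by rwa [add_assoc, add_comm 1 n] at hi⟩
          · rintro (h | ⟨i, hi⟩)
            · exact ⟨0, by simpa using h⟩
            · exact ⟨i + 1, by rwa [add_assoc, add_comm 1 n]⟩
        rw [← ih, e, hκadd _ _ (hf n) (MeasurableSet.iUnion fun i => hf _), Finset.sum_range_succ,
          add_assoc]
        exact Set.disjoint_iUnion_right.2 fun i => hd (by omega)
    have htail : Tendsto (fun n => μ.real (⋃ i, f (i + n))) atTop (𝓝 0) := by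
      have hs : Summable fun i => μ.real (f i) := by
        refine ENNReal.summable_toReal ?_
        rw [← measure_iUnion hd hf]
        exact measure_ne_top _ _
      refine (tendsto_sum_nat_add fun i => μ.real (f i)).congr fun n => ?_
      simp only [Measure.real]
      rw [measure_iUnion (f := fun i => f (i + n)) (fun i j hij => hd (by omega)) fun i => hf _,
        ENNReal.tsum_toReal_eq]
      exact fun i => measure_ne_top _ _
    have h0 : Tendsto (fun n => κ (⋃ i, f (i + n))) atTop (𝓝 0) :=
      squeeze_zero (fun n => hκ0 _) (fun n => hκle _ (MeasurableSet.iUnion fun i => hf _)) htail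
    rw [hasSum_iff_tendsto_nat_of_nonneg (fun i => hκ0 _)]
    have h1 := (tendsto_const_nhds (x := κ (⋃ i, f i))).sub h0
    rw [sub_zero] at h1
    exact h1.congr fun n => by rw [← hpart n]; ring
  -- Although `m` is only finitely additive, `κ ≤ μ` makes `κ` countably additive.
  let M : Measure X := Measure.ofMeasurable (fun A _ => ENNReal.ofReal (κ A))
    (by simp [κ, meanOf_empty]) fun f hf hd => by
      rw [← (hκsum f hf hd).tsum_eq, ENNReal.ofReal_tsum_of_nonneg (fun i => hκ0 _)
        (hκsum f hf hd).summable]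
  have hM : ∀ A, MeasurableSet A → M A = ENNReal.ofReal (κ A) := fun A hA =>
    Measure.ofMeasurable_apply A hA
  have hfin : IsFiniteMeasure M := ⟨by rw [hM _ MeasurableSet.univ]; exact ENNReal.ofReal_lt_top⟩
  have hac : M ≪ μ := Measure.AbsolutelyContinuous.mk fun A hA h0 => by
    rw [hM A hA, ENNReal.ofReal_eq_zero]
    exact (hκle A hA).trans (by simp [Measure.real, h0])
  refine ⟨fun x => (M.rnDeriv μ x).toReal, (Measure.measurable_rnDeriv M μ).ennreal_toReal,
    Measure.integrable_toReal_rnDeriv, fun A hA => ?_⟩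
  rw [Measure.setIntegral_toReal_rnDeriv hac, Measure.real, hM A hA, ENNReal.toReal_ofReal (hκ0 A)]

end MeanOf

section InvariantMean

universe v u
variable {X : Type u} [Groupoid.{v} X] [MeasurableSpace X] [MeasurableSpace (Elt X)]
  {μ : Measure X}

/-- The properties of a mean on the groupoid that are used: its image under the source map is `μ`,
and it is invariant under conjugation by bisections and diffuse. -/
structure IsInvariantMean (μ : Measure X) (m : Lp ℝ ∞ (srcMeasure μ) →L[ℝ] ℝ) : Prop where
  nonneg : ∀ f : Lp ℝ ∞ (srcMeasure μ), 0 ≤ f → 0 ≤ m f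
  src_preimage : ∀ A, MeasurableSet A → meanOf m (src ⁻¹' A) = μ.real A
  conj_eq : ∀ D σ, MeasurableSet D → IsBisection μ σ → meanOf m (conj D σ) = meanOf m D
  diffuse : ∀ D, MeasurableSet D → srcMeasure μ D < ∞ → meanOf m D = 0

theorem InnerAmenable.exists_isInvariantMean (hG : IsDiscretePMP μ) (h : InnerAmenable μ) :
    ∃ m, IsInvariantMean μ m := by
  obtain ⟨m, hm, h1, h2, h3, -⟩ := h
  have key : ∀ D (hD : MeasurableSet D), m (indicatorLinf (srcMeasure μ) hD) = meanOf m D := by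
    intro D hD
    rw [meanOf, meanVal, dif_pos (memLp_indicator_one hD)]
    rfl
  have hm0 : ∀ D, 0 ≤ meanOf m D := meanOf_nonneg hm.nonneg
  have := hG.prob
  refine ⟨m, hm.nonneg, fun A hA => ?_, fun D σ hD hσ => ?_, fun D hD hf => ?_⟩
  -- The set `src⁻¹ A` contains the restriction of the groupoid to `A`, so that its mass is at least
  -- `μ A`; the same holds for `Aᶜ`, and the two masses add up to `1`.
  · have hs : ∀ B, MeasurableSet B → μ.real B ≤ meanOf m (src ⁻¹' B) := by
      intro B hB
      have hBm : MeasurableSet {g : Elt X | src g ∈ B ∧ rng g ∈ B} :=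
        (hG.measurable_src hB).inter (hG.measurable_rng hB)
      rw [← h1 B hB hBm, key]
      exact meanOf_mono hm.nonneg hBm (hG.measurable_src hB) fun g hg => hg.1
    have hu : meanOf m (Set.univ : Set (Elt X)) = 1 := by
      have := h1 Set.univ MeasurableSet.univ (by simp)
      rw [key] at this
      simpa using this
    have hc := meanOf_inter_add_diff (m := m) MeasurableSet.univ (hG.measurable_src hA)
    rw [Set.univ_inter, ← Set.compl_eq_univ_sdiff, ← Set.preimage_compl, hu] at hc
    have e := probReal_add_probReal_compl (μ := μ) hA
    have := hs A hA
    have := hs Aᶜ hA.compl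
    linarith
  · have hc := measurableSet_conj hG.toIsDiscreteBorel hD hσ.toIsPartialBisection
    rw [← key _ hc, ← key _ hD]
    exact h2 D hD σ hσ hc
  · rw [← key _ hD]
    exact h3 D hD hf

end InvariantMean

section AlmostInvariant

universe v u
variable {X : Type u} [Groupoid.{v} X] [MeasurableSpace X] [MeasurableSpace (Elt X)]
  {μ : Measure X}

theorem ae_tendsto_zero_of_lintegral_le {Ω : Type*} [MeasurableSpace Ω] {μ : Measure Ω}
    {g : ℕ → Ω → ℝ≥0∞} (hg : ∀ n, AEMeasurable (g n) μ) (N : ℕ)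
    (h : ∀ n, N ≤ n → ∫⁻ x, g n x ∂μ ≤ ENNReal.ofReal ((1 / 2) ^ n)) :
    ∀ᵐ x ∂μ, Tendsto (fun n => g n x) atTop (𝓝 0) := by
  have h1 : ∫⁻ x, ∑' n, g (n + N) x ∂μ ≠ ∞ := by
    rw [lintegral_tsum fun n => hg _]
    refine ne_top_of_le_ne_top ?_ (ENNReal.tsum_le_tsum fun n => h (n + N) (Nat.le_add_left N n))
    rw [← ENNReal.ofReal_tsum_of_nonneg (fun n => by positivity)
      ((summable_nat_add_iff N).2 summable_geometric_two)]
    exact ENNReal.ofReal_ne_top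
  filter_upwards [ae_lt_top' (AEMeasurable.tsum fun n => hg _) h1] with x hx
  exact (tendsto_add_atTop_iff_nat N).1 (ENNReal.tendsto_atTop_zero_of_tsum_ne_top hx.ne)

/-- On a set that has positive mass for an invariant mean and is preserved by countably many full
sections, there is a sequence of functions whose sums over almost every source fibre converge, not
always to zero, and that is asymptotically invariant in `ℓ¹` of almost every source fibre. -/
theorem IsInvariantMean.exists_almost_invariant_seq (hG : IsDiscretePMP μ)
    {m : Lp ℝ ∞ (srcMeasure μ) →L[ℝ] ℝ} (hm : IsInvariantMean μ m) {D : Set (Elt X)}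
    (hD : MeasurableSet D) (hDm : meanOf m D ≠ 0) {φ : ℕ → X → Elt X}
    (hφ : ∀ j, IsFullSection (φ j)) (hφD : ∀ j g, conjMap (φ j) g ∈ D ↔ g ∈ D) :
    ∃ (f : ℕ → Elt X → ℝ) (ψ : X → ℝ), (∀ n, Measurable (f n)) ∧ (∀ n g, 0 ≤ f n g) ∧
      (∀ n, ∀ g ∉ D, f n g = 0) ∧ Measurable ψ ∧ μ {x | 0 < ψ x} ≠ 0 ∧
      (∀ᵐ x ∂μ, ∀ j, Tendsto (fun n => ∑' g : {g : Elt X // src g = x},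
        ENNReal.ofReal |f n g - f n (conjMap (φ j) g)|) atTop (𝓝 0)) ∧
      ∀ᵐ x ∂μ, Tendsto (fun n => ∑' g : {g : Elt X // src g = x}, ENNReal.ofReal (f n g)) atTop
        (𝓝 (ENNReal.ofReal (ψ x))) := by
  have := hG.prob
  have := hG.sigmaFinite
  have := hG.standardBorel_units
  have := hG.standardBorel_elts
  obtain ⟨ψ, hψm, hψi, hψ⟩ := exists_density_of_meanOf_preimage hm.nonneg hG.measurable_src
    hm.src_preimage hD
  have hac : ∀ N, MeasurableSet N → μ N = 0 → srcMeasure μ (src ⁻¹' N) = 0 := by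
    intro N hN h0
    rw [measure_eq_zero_iff_ae_notMem, hG.ae_iff_src]
    filter_upwards [measure_eq_zero_iff_ae_notMem.1 h0] with x hx g hg
    simpa [hg] using hx
  have hinv : ∀ j E, MeasurableSet E → meanVal m ((conjMap (φ j) ⁻¹' E).indicator fun _ => (1 : ℝ)) =
      meanVal m (E.indicator fun _ => (1 : ℝ)) := by
    intro j E hE
    rw [← (hφ j).conj_range E]
    exact hm.conj_eq E _ hE ((hφ j).isBisection hG.toIsDiscreteBorel)
  have step : ∀ n : ℕ, _ := fun n => exists_almost_invariant hm.nonneg hG.measurable_src hac hD hψi hψ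
    (k := n) (fun j => conjEquiv hG.toIsDiscreteBorel (hφ j))
    (fun j => (hφ j).measurePreserving_conjMap hG) (fun j => hφD j) (fun j => hinv j)
    (ε := (1 / 2) ^ n) (by positivity)
  choose f a hfm hf0 hfD hfi hai hfa hfΔ haψ using step
  refine ⟨f, ψ, hfm, hf0, hfD, hψm, ?_, ?_, ?_⟩
  · intro h0
    refine hDm (le_antisymm ?_ (meanOf_nonneg hm.nonneg D))
    have e := hψ Set.univ MeasurableSet.univ
    rw [Set.preimage_univ, Set.inter_univ, Measure.restrict_univ] at e
    rw [e]
    refine integral_nonpos_of_ae ?_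
    filter_upwards [measure_eq_zero_iff_ae_notMem.1 h0] with x hx
    simpa using hx
  · rw [ae_all_iff]
    intro j
    have hgm : ∀ n, Measurable fun g => ENNReal.ofReal |f n g - f n (conjMap (φ j) g)| := fun n =>
      ((hfm n).sub ((hfm n).comp ((hφ j).measurable_conjMap hG.toIsDiscreteBorel))).abs.ennreal_ofReal
    refine ae_tendsto_zero_of_lintegral_le (fun n => ?_) (j + 1) fun n hn => ?_
    · exact aemeasurable_tsum_fibre hG.measurable_src hG.countable_src (hgm n)
    · rw [← hG.lintegral_src (hgm n)]
      have hi : Integrable (fun g => f n g - f n (conjMap (φ j) g)) (srcMeasure μ) :=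
        (hfi n).sub (((hφ j).measurePreserving_conjMap hG).integrable_comp_of_integrable (hfi n))
      rw [← ofReal_integral_eq_lintegral_ofReal hi.abs (Eventually.of_forall fun g => abs_nonneg _)]
      exact ENNReal.ofReal_le_ofReal (hfΔ n ⟨j, hn⟩).le
  · have hb : ∀ n, ∀ᵐ x ∂μ, ∑' g : {g : Elt X // src g = x}, ENNReal.ofReal (f n g) =
        ENNReal.ofReal (a n x) := by
      intro n
      have hbm : AEMeasurable (fun x => ∑' g : {g : Elt X // src g = x}, ENNReal.ofReal (f n g)) μ :=
        aemeasurable_tsum_fibre hG.measurable_src hG.countable_src (hfm n).ennreal_ofReal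
      have hbA : ∀ A, MeasurableSet A →
          ∫⁻ x in A, ∑' g : {g : Elt X // src g = x}, ENNReal.ofReal (f n g) ∂μ =
            ENNReal.ofReal (∫ x in A, a n x ∂μ) := by
        intro A hA
        have hA' := hG.measurable_src hA
        rw [hfa n A hA, ofReal_integral_eq_lintegral_ofReal (hfi n).integrableOn
          (Eventually.of_forall (hf0 n)), ← lintegral_indicator hA', ← lintegral_indicator hA,
          hG.lintegral_src ((hfm n).ennreal_ofReal.indicator hA')]
        refine lintegral_congr fun x => ?_
        by_cases hx : x ∈ A
        · rw [Set.indicator_of_mem hx]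
          refine tsum_congr fun g => ?_
          rw [Set.indicator_of_mem]
          rwa [Set.mem_preimage, g.2]
        · rw [Set.indicator_of_notMem hx, eq_comm, ENNReal.tsum_eq_zero]
          intro g
          rw [Set.indicator_of_notMem]
          rwa [Set.mem_preimage, g.2]
      have hfin : ∫⁻ x, ∑' g : {g : Elt X // src g = x}, ENNReal.ofReal (f n g) ∂μ ≠ ∞ := by
        rw [← setLIntegral_univ, hbA _ MeasurableSet.univ]
        exact ENNReal.ofReal_ne_top
      have hlt := ae_lt_top' hbm hfin
      have hae := Integrable.ae_eq_of_forall_setIntegral_eq _ _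
        (integrable_toReal_of_lintegral_ne_top hbm hfin) (hai n) fun A hA _ => by
          rw [integral_toReal hbm.restrict (ae_restrict_of_ae hlt), hbA A hA, ENNReal.toReal_ofReal]
          rw [hfa n A hA]
          exact integral_nonneg fun g => hf0 n g
      filter_upwards [hae, hlt] with x h1 h2
      rw [← h1, ENNReal.ofReal_toReal h2.ne]
    have hlim : ∀ᵐ x ∂μ, Tendsto (fun n => ENNReal.ofReal |a n x - ψ x|) atTop (𝓝 0) := by
      refine ae_tendsto_zero_of_lintegral_le
        (fun n => ((hai n).sub hψi).abs.aemeasurable.ennreal_ofReal) 0 fun n _ => ?_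
      have hi : Integrable (fun x => a n x - ψ x) μ := (hai n).sub hψi
      rw [← ofReal_integral_eq_lintegral_ofReal hi.abs
        (Eventually.of_forall fun g => abs_nonneg _)]
      exact ENNReal.ofReal_le_ofReal (haψ n).le
    filter_upwards [hlim, ae_all_iff.2 hb] with x h1 h2
    simp_rw [h2]
    refine ENNReal.tendsto_ofReal ?_
    rw [tendsto_iff_dist_tendsto_zero]
    have h3 := (ENNReal.tendsto_toReal ENNReal.zero_ne_top).comp h1
    refine h3.congr fun n => ?_
    simp [Real.dist_eq]

end AlmostInvariant

/-! ### Amenability from equivariant families of probability measures -/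

section Equivariant

universe v u
variable {X : Type u} [Groupoid.{v} X] [MeasurableSpace X] [MeasurableSpace (Elt X)]
  {μ : Measure X}

/-- Normalising two close nonnegative functions gives close probability vectors. -/
theorem tsum_ofReal_abs_div_sub_div_le {ι : Type*} {S T E : ι → ℝ≥0∞} {a b d : ℝ≥0∞}
    (hST : ∀ i, S i ≤ T i + E i) (hTS : ∀ i, T i ≤ S i + E i) (ha : ∑' i, S i = a)
    (hb : ∑' i, T i = b) (hd : ∑' i, E i = d) (ha0 : a ≠ 0) (ha1 : a ≠ ∞) (hb0 : b ≠ 0)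
    (hb1 : b ≠ ∞) :
    ∑' i, ENNReal.ofReal |(S i / a).toReal - (T i / b).toReal| ≤ 2 * d / a := by
  by_cases hd1 : d = ∞
  · rw [hd1, ENNReal.mul_top two_ne_zero, ENNReal.top_div_of_ne_top ha1]
    exact le_top
  have hab : a ≤ b + d := by
    rw [← ha, ← hb, ← hd, ← ENNReal.tsum_add]
    exact ENNReal.tsum_le_tsum hST
  have hba : b ≤ a + d := by
    rw [← ha, ← hb, ← hd, ← ENNReal.tsum_add]
    exact ENNReal.tsum_le_tsum hTS
  have hS : ∀ i, S i ≠ ∞ := fun i => ne_top_of_le_ne_top ha1 (ha ▸ ENNReal.le_tsum i)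
  have hT : ∀ i, T i ≠ ∞ := fun i => ne_top_of_le_ne_top hb1 (hb ▸ ENNReal.le_tsum i)
  have hE : ∀ i, E i ≠ ∞ := fun i => ne_top_of_le_ne_top hd1 (hd ▸ ENNReal.le_tsum i)
  have key : ∀ i, ENNReal.ofReal |(S i / a).toReal - (T i / b).toReal| ≤
      E i / a + T i * (d / (a * b)) := by
    intro i
    have hA := ENNReal.toReal_pos ha0 ha1
    have hB := ENNReal.toReal_pos hb0 hb1
    have h1 := ENNReal.toReal_mono (ENNReal.add_ne_top.2 ⟨hT i, hE i⟩) (hST i)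
    have h2 := ENNReal.toReal_mono (ENNReal.add_ne_top.2 ⟨hS i, hE i⟩) (hTS i)
    have h3 := ENNReal.toReal_mono (ENNReal.add_ne_top.2 ⟨hb1, hd1⟩) hab
    have h4 := ENNReal.toReal_mono (ENNReal.add_ne_top.2 ⟨ha1, hd1⟩) hba
    rw [ENNReal.toReal_add (hT i) (hE i)] at h1
    rw [ENNReal.toReal_add (hS i) (hE i)] at h2
    rw [ENNReal.toReal_add hb1 hd1] at h3
    rw [ENNReal.toReal_add ha1 hd1] at h4
    have hfin : E i / a + T i * (d / (a * b)) ≠ ∞ :=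
      ENNReal.add_ne_top.2 ⟨ENNReal.div_ne_top (hE i) ha0,
        ENNReal.mul_ne_top (hT i) (ENNReal.div_ne_top hd1 (mul_ne_zero ha0 hb0))⟩
    refine ENNReal.ofReal_le_of_le_toReal ?_
    rw [ENNReal.toReal_add (ENNReal.div_ne_top (hE i) ha0)
      (ENNReal.mul_ne_top (hT i) (ENNReal.div_ne_top hd1 (mul_ne_zero ha0 hb0)))]
    simp only [ENNReal.toReal_div, ENNReal.toReal_mul]
    generalize (S i).toReal = s at *
    generalize hteq : (T i).toReal = t at *
    have ht : 0 ≤ t := hteq ▸ ENNReal.toReal_nonneg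
    generalize (E i).toReal = e at *
    generalize a.toReal = a at *
    generalize b.toReal = b at *
    generalize d.toReal = d at *
    have e1 : s / a - t / b = (s - t) / a + t * ((b - a) / (a * b)) := by
      field_simp
      ring
    rw [e1]
    refine (abs_add_le _ _).trans (add_le_add ?_ ?_)
    · rw [abs_div, abs_of_pos hA]
      exact div_le_div_of_nonneg_right (abs_le.2 ⟨by linarith, by linarith⟩) hA.le
    · rw [abs_mul, abs_of_nonneg ht, abs_div, abs_of_pos (mul_pos hA hB)]
      refine mul_le_mul_of_nonneg_left ?_ ht
      exact div_le_div_of_nonneg_right (abs_le.2 ⟨by linarith, by linarith⟩) (mul_pos hA hB).le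
  refine (ENNReal.tsum_le_tsum key).trans (le_of_eq ?_)
  rw [ENNReal.tsum_add, ENNReal.tsum_mul_right, hb]
  simp only [div_eq_mul_inv]
  rw [ENNReal.tsum_mul_right, hd, ENNReal.mul_inv (Or.inl ha0) (Or.inl ha1)]
  calc d * a⁻¹ + b * (d * (a⁻¹ * b⁻¹)) = d * a⁻¹ + (b * b⁻¹) * (d * a⁻¹) := by ring
    _ = 2 * d * a⁻¹ := by rw [ENNReal.mul_inv_cancel hb0 hb1]; ring

omit [MeasurableSpace X] [MeasurableSpace (Elt X)] in
theorem tsum_rng_fibre_inter {S : Set (Elt X)} {x : X} {F : Elt X → ℝ≥0∞}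
    (h : ∀ w, rng w = x → w ∉ S → F w = 0) :
    ∑' w : {w : Elt X // w ∈ S ∧ rng w = x}, F w = ∑' w : {w : Elt X // rng w = x}, F w := by
  have e1 := tsum_subtype {w : Elt X | w ∈ S ∧ rng w = x} F
  have e2 := tsum_subtype {w : Elt X | rng w = x} F
  refine e1.trans (Eq.trans (tsum_congr fun w => ?_) e2.symm)
  by_cases hx : rng w = x
  · by_cases hS : w ∈ S
    · simp [hx, hS]
    · simp [hx, hS, h w hx hS]
  · simp [hx]

/-- The integral of the family of measures `q (g, ·)` on the range fibre of `w` against the function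
`F` on the source fibre over the same unit. -/
noncomputable def fibreAverage (F : Elt X → ℝ≥0∞) (q : Elt X × Elt X → ℝ≥0∞) (w : Elt X) : ℝ≥0∞ :=
  ∑' g : {g : Elt X // src g = rng w}, F g * q (g, w)

omit [MeasurableSpace X] [MeasurableSpace (Elt X)] in
theorem fibreAverage_of_rng_eq (F : Elt X → ℝ≥0∞) (q : Elt X × Elt X → ℝ≥0∞) {w : Elt X} {x : X}
    (h : rng w = x) : fibreAverage F q w = ∑' g : {g : Elt X // src g = x}, F g * q (g, w) := by
  subst h; rfl

omit [MeasurableSpace X] [MeasurableSpace (Elt X)] in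
theorem tsum_fibre_mul_eq {F : Elt X → ℝ≥0∞} {q : Elt X × Elt X → ℝ≥0∞}
    (hq : ∀ g, F g ≠ 0 → ∑' w : {w : Elt X // rng w = src g}, q (g, w) = 1) (x : X) :
    ∑' (w : {w : Elt X // rng w = x}), ∑' (g : {g : Elt X // src g = x}), F g * q (g, w) =
      ∑' g : {g : Elt X // src g = x}, F g := by
  rw [ENNReal.tsum_comm]
  refine tsum_congr ?_
  rintro ⟨g, rfl⟩
  simp only
  rw [ENNReal.tsum_mul_left]
  by_cases hg : F g = 0
  · simp [hg]
  · rw [hq g hg, mul_one]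

omit [MeasurableSpace X] [MeasurableSpace (Elt X)] in
theorem tsum_fibreAverage {F : Elt X → ℝ≥0∞} {q : Elt X × Elt X → ℝ≥0∞}
    (hq : ∀ g, F g ≠ 0 → ∑' w : {w : Elt X // rng w = src g}, q (g, w) = 1) (x : X) :
    ∑' w : {w : Elt X // rng w = x}, fibreAverage F q w = ∑' g : {g : Elt X // src g = x}, F g := by
  rw [← tsum_fibre_mul_eq hq x]
  exact tsum_congr fun w => fibreAverage_of_rng_eq F q w.2

theorem hasSum_toReal_of_tsum_eq_one {ι : Type*} {F : ι → ℝ≥0∞} (h : ∑' i, F i = 1) :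
    HasSum (fun i => (F i).toReal) 1 := by
  have h1 := ENNReal.hasSum_toReal (f := F) (by rw [h]; exact ENNReal.one_ne_top)
  rwa [← ENNReal.tsum_toReal_eq fun i => ne_top_of_le_ne_top ENNReal.one_ne_top
    (h ▸ ENNReal.le_tsum i), h, ENNReal.toReal_one] at h1

theorem ofReal_le_ofReal_add_ofReal_abs_sub (a b : ℝ) :
    ENNReal.ofReal a ≤ ENNReal.ofReal b + ENNReal.ofReal |a - b| := by
  refine (ENNReal.ofReal_le_ofReal ?_).trans ENNReal.ofReal_add_le
  have := le_abs_self (a - b)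
  linarith

/-- A set `D` over which the mean is positive, and which maps equivariantly to the probability
measures on the range fibres of `H`, produces an amenable restriction of `H`: the images of an
asymptotically invariant sequence on `D` are asymptotically invariant on `H`. -/
theorem IsInvariantMean.exists_isAmenable_of_equivariant (hG : IsDiscretePMP μ)
    {m : Lp ℝ ∞ (srcMeasure μ) →L[ℝ] ℝ} (hm : IsInvariantMean μ m) {H : Subgroupoid X}
    (hH : MeasurableSet (elts H)) {Y : Set X} {σ : ℕ → Set (Elt X)} (hY : IsAtlas Y σ)
    (hY0 : μ Yᶜ = 0) (hunit : ∀ x ∈ Y, unit x ∈ elts H)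
    {D : Set (Elt X)} (hD : MeasurableSet D) (hDm : meanOf m D ≠ 0) (hDY : ∀ g ∈ D, src g ∈ Y)
    (hDH : ∀ k ∈ elts H, ∀ k' ∈ elts H, ∀ g, src k = src g → src k' = rng g →
      (k' * g * k⁻¹ ∈ D ↔ g ∈ D))
    {q : Elt X × Elt X → ℝ≥0∞} (hqm : Measurable q)
    (hq1 : ∀ g ∈ D, ∑' w : {w : Elt X // rng w = src g}, q (g, w) = 1)
    (hq0 : ∀ g ∈ D, ∀ w ∉ elts H, q (g, w) = 0)
    (hqe : ∀ g ∈ D, ∀ k ∈ elts H, ∀ k' ∈ elts H, src k = src g → src k' = rng g →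
      ∀ w, rng w = src k → q (k' * g * k⁻¹, k * w) = q (g, w)) :
    ∃ A, MeasurableSet A ∧ 0 < μ A ∧ IsAmenable μ (H ⊓ Subgroupoid.full A) := by
  classical
  have hB := hG.toIsDiscreteBorel
  have := hG.standardBorel_elts
  obtain ⟨φ, hφ, hφP, hφcov⟩ := hY.exists_fullSections hB hH
  have hφH : ∀ j, ∀ x ∈ Y, φ j x ∈ elts H := by
    intro j x hx
    rcases hφP j x with h | h | h
    · exact h
    · exact elts_inv_iff.1 h
    · rw [h]; exact hunit x hx
  have hφD : ∀ j g, conjMap (φ j) g ∈ D ↔ g ∈ D := by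
    intro j g
    by_cases hg : src g ∈ Y
    · exact hDH _ (hφH j _ hg) _ (hφH j _ ((hY.src_mem_iff g).1 hg)) g ((hφ j).src_eq _)
        ((hφ j).src_eq _)
    · refine iff_of_false (fun h => hg ?_) fun h => hg (hDY g h)
      have h1 := hDY _ h
      rwa [(hφ j).src_conjMap, ← hY.src_mem_iff, (hφ j).src_eq] at h1
  obtain ⟨f, ψ, hfm, hf0, hfD, hψm, hψ0, hfΔ, hfψ⟩ :=
    hm.exists_almost_invariant_seq hG hD hDm hφ hφD
  -- `δ j n` is the error of invariance of `f n` under the section `φ j`, and `a n x` is the total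
  -- mass of `f n` on the source fibre of `x`.
  let F : ℕ → Elt X → ℝ≥0∞ := fun n g => ENNReal.ofReal (f n g)
  let δ : ℕ → ℕ → Elt X → ℝ≥0∞ := fun j n g => ENNReal.ofReal |f n g - f n (conjMap (φ j) g)|
  let a : ℕ → X → ℝ≥0∞ := fun n x => ∑' g : {g : Elt X // src g = x}, F n g
  have hFD : ∀ n g, F n g ≠ 0 → g ∈ D := fun n g h => by
    by_contra hg
    exact h (by simp [F, hfD n g hg])
  have hδD : ∀ j n g, δ j n g ≠ 0 → g ∈ D := fun j n g h => by
    by_contra hg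
    exact h (by simp [δ, hfD n g hg, hfD n _ ((hφD j g).not.2 hg)])
  have hFm : ∀ n, Measurable (F n) := fun n => (hfm n).ennreal_ofReal
  have ham : ∀ n, Measurable (a n) := fun n =>
    hY.measurable_tsum_src hB measurable_id (f := fun p => F n p.2) ((hFm n).comp measurable_snd)
      fun _ g hg => not_not.1 fun h => hg (hDY g (hFD n g h))
  have hTm : ∀ n, Measurable (fibreAverage (F n) q) := fun n =>
    hY.measurable_tsum_src hB hB.measurable_rng (f := fun p => F n p.2 * q (p.2, p.1))
      (((hFm n).comp measurable_snd).mul (hqm.comp measurable_swap))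
      fun _ g hg => by rw [not_not.1 fun h => hg (hDY g (hFD n g h)), zero_mul]
  have hTsum : ∀ n x, ∑' w : {w : Elt X // rng w = x}, fibreAverage (F n) q w = a n x := fun n x =>
    tsum_fibreAverage (fun g hg => hq1 g (hFD n g hg)) x
  have hTH : ∀ n, ∀ w ∉ elts H, fibreAverage (F n) q w = 0 := by
    intro n w hw
    refine ENNReal.tsum_eq_zero.2 fun g => ?_
    by_cases hg : F n g = 0
    · rw [hg, zero_mul]
    · rw [hq0 g (hFD n g hg) w hw, mul_zero]
  -- The translate by an element `k` of `H` is computed with a full section through `k`.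
  have hTk : ∀ j n x, x ∈ Y → ∀ u, rng u = x → fibreAverage (F n) q (φ j x * u) =
      ∑' g : {g : Elt X // src g = x}, F n (conjMap (φ j) g) * q (g, u) := by
    intro j n x hx u hu
    rw [fibreAverage_of_rng_eq _ _ (rng_mul _ _), ← (conjFibreEquiv hB (hφ j) x).tsum_eq]
    refine tsum_congr ?_
    rintro ⟨g, rfl⟩
    by_cases hg : g ∈ D
    · change F n (conjMap (φ j) g) * q (conjMap (φ j) g, φ j (src g) * u) = _
      rw [conjMap, hqe g hg _ (hφH j _ hx) _ (hφH j _ ((hY.src_mem_iff g).1 hx)) ((hφ j).src_eq _)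
        ((hφ j).src_eq _) u (by rw [hu, (hφ j).src_eq])]
    · have : F n (conjMap (φ j) g) = 0 := not_not.1 fun h => hg ((hφD j g).1 (hFD n _ h))
      change F n (conjMap (φ j) g) * q (conjMap (φ j) g, φ j (src g) * u) = F n (conjMap (φ j) g) * _
      rw [this, zero_mul, zero_mul]
  have hak : ∀ j n x, a n (rng (φ j x)) = ∑' g : {g : Elt X // src g = x}, F n (conjMap (φ j) g) :=
    fun j n x => ((conjFibreEquiv hB (hφ j) x).tsum_eq fun g => F n g).symm
  have hle1 : ∀ j n g, F n (conjMap (φ j) g) ≤ F n g + δ j n g := fun j n g => by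
    have := ofReal_le_ofReal_add_ofReal_abs_sub (f n (conjMap (φ j) g)) (f n g)
    rwa [abs_sub_comm] at this
  have hle2 : ∀ j n g, F n g ≤ F n (conjMap (φ j) g) + δ j n g := fun j n g =>
    ofReal_le_ofReal_add_ofReal_abs_sub (f n g) (f n (conjMap (φ j) g))
  -- The conull invariant set on which all the limits exist.
  obtain ⟨N, hN, hNm, hN0, hNinv⟩ := hG.exists_invariant_null (ae_iff.1
    ((hfΔ.and hfψ).and (measure_eq_zero_iff_ae_notMem.1 hY0)))
  have hgood : ∀ x, x ∉ N → ((∀ j, Tendsto (fun n => ∑' g : {g : Elt X // src g = x}, δ j n g)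
      atTop (𝓝 0)) ∧ Tendsto (fun n => a n x) atTop (𝓝 (ENNReal.ofReal (ψ x)))) ∧ x ∈ Y := by
    intro x hx
    have h := not_not.1 fun h => hx (hN h)
    exact ⟨h.1, by simpa using h.2⟩
  have hψH : ∀ k ∈ elts H, src k ∉ N → ENNReal.ofReal (ψ (rng k)) = ENNReal.ofReal (ψ (src k)) := by
    intro k hk hkN
    obtain ⟨⟨hΔ, hlim⟩, hkY⟩ := hgood _ hkN
    obtain ⟨⟨-, hlim'⟩, -⟩ := hgood _ ((hNinv k).not.1 hkN)
    obtain ⟨j, hj⟩ := hφcov k hk hkY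
    have e : ∀ n, a n (rng k) = ∑' g : {g : Elt X // src g = src k}, F n (conjMap (φ j) g) :=
      fun n => by rw [← hak, hj]
    refine le_antisymm ?_ ?_
    · refine le_of_tendsto_of_tendsto' hlim' (by simpa using hlim.add (hΔ j)) fun n => ?_
      rw [e, ← ENNReal.tsum_add]
      exact ENNReal.tsum_le_tsum fun g => hle1 j n g
    · refine le_of_tendsto_of_tendsto' hlim (by simpa using hlim'.add (hΔ j)) fun n => ?_
      rw [e, ← ENNReal.tsum_add]
      exact ENNReal.tsum_le_tsum fun g => hle2 j n g
  -- Since `A` is invariant under `H`, the range fibres of the restriction of `H` to `A` are full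
  -- ones.
  let A : Set X := {x | 0 < ψ x} ∩ Nᶜ
  have hAm : MeasurableSet A := (measurableSet_lt measurable_const hψm).inter hNm.compl
  have hAH : ∀ k ∈ elts H, src k ∈ A ↔ rng k ∈ A := by
    intro k hk
    by_cases hkN : src k ∈ N
    · exact iff_of_false (fun h => h.2 hkN) fun h => h.2 ((hNinv k).1 hkN)
    · have h1 := hψH k hk hkN
      have h2 : 0 < ψ (src k) ↔ 0 < ψ (rng k) := by
        rw [← ENNReal.ofReal_pos, ← ENNReal.ofReal_pos, h1]
      exact and_congr h2 (hNinv k).not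
  refine ⟨A, hAm, ?_, ?_⟩
  · rw [pos_iff_ne_zero]
    intro h0
    refine hψ0 (measure_mono_null (fun x hx => ?_) (measure_union_null h0 hN0))
    by_cases hxN : x ∈ N
    · exact Or.inr hxN
    · exact Or.inl ⟨hx, hxN⟩
  -- The normalised averages; where the total mass is `0` or `∞`, which over `A` happens for
  -- finitely many `n` only, they are replaced by the point mass at the unit.
  let W : ℕ → Elt X → ℝ≥0∞ := fun n w =>
    if a n (rng w) ≠ 0 ∧ a n (rng w) ≠ ∞ then fibreAverage (F n) q w / a n (rng w)
    else if w = unit (rng w) then 1 else 0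
  have hW1 : ∀ n w, W n w ≤ 1 := by
    intro n w
    simp only [W]
    split_ifs with h1 h2
    · refine ENNReal.div_le_of_le_mul ?_
      rw [one_mul, ← hTsum n (rng w)]
      exact ENNReal.le_tsum (f := fun w : {w' : Elt X // rng w' = rng w} =>
        fibreAverage (F n) q w) ⟨w, rfl⟩
    · exact le_rfl
    · exact zero_le_one
  have hWm : ∀ n, Measurable (W n) := by
    intro n
    have h1 : Measurable fun w => a n (rng w) := (ham n).comp hB.measurable_rng
    refine Measurable.ite ?_ ((hTm n).div h1) (Measurable.ite ?_ measurable_const measurable_const)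
    · exact ((h1 (measurableSet_singleton 0)).compl).inter (h1 (measurableSet_singleton ∞)).compl
    · exact measurableSet_eq_fun measurable_id (hB.measurable_unit.comp hB.measurable_rng)
  have hWsum : ∀ n x, ∑' w : {w : Elt X // rng w = x}, W n w = 1 := by
    intro n x
    by_cases h : a n x ≠ 0 ∧ a n x ≠ ∞
    · have e : ∀ w : {w : Elt X // rng w = x}, W n w = fibreAverage (F n) q w * (a n x)⁻¹ := by
        rintro ⟨w, rfl⟩
        simp only [W, if_pos h, div_eq_mul_inv]
      simp_rw [e]
      rw [ENNReal.tsum_mul_right, hTsum, ENNReal.mul_inv_cancel h.1 h.2]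
    · rw [tsum_eq_single ⟨unit x, rfl⟩]
      · simp only [W, rng_unit, if_neg h, if_true]
      · rintro ⟨w, rfl⟩ hw
        simp only [W, if_neg h]
        exact if_neg fun h' => hw (Subtype.ext h')
  have hWL : ∀ n x, x ∈ A → ∀ w, rng w = x → w ∉ elts (H ⊓ Subgroupoid.full A) → W n w = 0 := by
    rintro n _ hx w rfl hw
    have hwH : w ∉ elts H := fun h => hw (mem_elts_inf_full.2 ⟨h, (hAH w h).2 hx, hx⟩)
    have hwu : w ≠ unit (rng w) := fun h => hwH (h ▸ hunit _ (hgood _ hx.2).2)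
    simp only [W, hTH n w hwH, ENNReal.zero_div, if_neg hwu, ite_self]
  refine ⟨fun n w => (W n w).toReal, fun n => (hWm n).ennreal_toReal,
    fun n w => ⟨ENNReal.toReal_nonneg, ENNReal.toReal_le_of_le_ofReal zero_le_one
      (by simpa using hW1 n w)⟩, fun n => Eventually.of_forall fun x hx => ?_,
    Eventually.of_forall fun k hk => ?_⟩
  · have hxA : x ∈ A := (mem_elts_inf_full.1 (mem_objs_iff.1 hx)).2.1
    have h1 := tsum_rng_fibre_inter (hWL n x hxA)
    exact hasSum_toReal_of_tsum_eq_one (h1.trans (hWsum n x))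
  · obtain ⟨hkH, hkA, hkA'⟩ := mem_elts_inf_full.1 hk
    obtain ⟨⟨hΔ, hlim⟩, hkY⟩ := hgood _ hkA.2
    obtain ⟨⟨-, hlim'⟩, -⟩ := hgood _ hkA'.2
    obtain ⟨j, hj⟩ := hφcov k hkH hkY
    have hev : ∀ x, x ∈ A → Tendsto (fun n => a n x) atTop (𝓝 (ENNReal.ofReal (ψ x))) →
        ∀ᶠ n in atTop, a n x ≠ 0 ∧ a n x ≠ ∞ := by
      intro x hx hl
      exact (hl.eventually_ne (ENNReal.ofReal_pos.2 hx.1).ne').and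
        (hl.eventually_ne ENNReal.ofReal_ne_top)
    have hbd : ∀ᶠ n in atTop, ∑' w : {w : Elt X // w ∈ elts (H ⊓ Subgroupoid.full A) ∧
        rng w = rng k}, ENNReal.ofReal |(W n w).toReal - (W n (mul (inv k) w w.2.2.symm)).toReal| ≤
        2 * (∑' g : {g : Elt X // src g = src k}, δ j n g) / a n (rng k) := by
      filter_upwards [hev _ hkA hlim, hev _ hkA' hlim'] with n h1 h2
      have e1 : ∑' w : {w : Elt X // w ∈ elts (H ⊓ Subgroupoid.full A) ∧ rng w = rng k},
          ENNReal.ofReal |(W n w).toReal - (W n (mul (inv k) w w.2.2.symm)).toReal| ≤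
          ∑' w : {w : Elt X // rng w = rng k},
            ENNReal.ofReal |(W n w).toReal - (W n (k⁻¹ * w)).toReal| := by
        refine le_trans (le_of_eq (tsum_congr fun w => ?_)) (ENNReal.tsum_mono_subtype
          (fun w : Elt X => ENNReal.ofReal |(W n w).toReal - (W n (k⁻¹ * w)).toReal|)
          (s := {w | w ∈ elts (H ⊓ Subgroupoid.full A) ∧ rng w = rng k})
          (t := {w | rng w = rng k}) fun w hw => hw.2)
        have := mul_def (g := inv k) (h := w.1) w.2.2.symm
        rw [← this]
        rfl
      refine e1.trans ?_
      rw [← (mulLeftEquiv k).tsum_eq]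
      have e2 : ∀ u : {w : Elt X // rng w = src k},
          ENNReal.ofReal |(W n (mulLeftEquiv k u)).toReal - (W n (k⁻¹ * (mulLeftEquiv k u))).toReal| =
          ENNReal.ofReal |(fibreAverage (F n) q (k * u) / a n (rng k)).toReal -
            (fibreAverage (F n) q u / a n (src k)).toReal| := by
        rintro ⟨u, hu⟩
        have hm : ((mulLeftEquiv k ⟨u, hu⟩ : {w : Elt X // rng w = rng k}) : Elt X) = k * u := rfl
        rw [hm, inv_mul_cancel_left' hu.symm]
        simp only [W, rng_mul, hu, if_pos h1, if_pos h2]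
      simp_rw [e2]
      have hk1 : ∀ u : {w : Elt X // rng w = src k}, fibreAverage (F n) q (k * u) =
          ∑' g : {g : Elt X // src g = src k}, F n (conjMap (φ j) g) * q (g, u) := by
        intro u
        have := hTk j n (src k) hkY u u.2
        rwa [hj] at this
      refine tsum_ofReal_abs_div_sub_div_le
        (E := fun u : {w : Elt X // rng w = src k} =>
          ∑' g : {g : Elt X // src g = src k}, δ j n g * q (g, u)) (fun u => ?_) (fun u => ?_) ?_
        (hTsum n _) (tsum_fibre_mul_eq (fun g hg => hq1 g (hδD j n g hg)) _) h2.1 h2.2 h1.1 h1.2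
      · rw [hk1, fibreAverage_of_rng_eq _ _ u.2, ← ENNReal.tsum_add]
        refine ENNReal.tsum_le_tsum fun g => ?_
        rw [← add_mul]
        exact mul_le_mul_left (hle1 j n g) _
      · rw [hk1, fibreAverage_of_rng_eq _ _ u.2, ← ENNReal.tsum_add]
        refine ENNReal.tsum_le_tsum fun g => ?_
        rw [← add_mul]
        exact mul_le_mul_left (hle2 j n g) _
      · rw [← hTsum n (rng k), ← (mulLeftEquiv k).tsum_eq]
        rfl
    refine tendsto_of_tendsto_of_tendsto_of_le_of_le' tendsto_const_nhds ?_
      (Eventually.of_forall fun n => zero_le) hbd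
    have h1 := ENNReal.Tendsto.const_mul (a := 2) (hΔ j) (Or.inr (by simp))
    have h2 := ENNReal.Tendsto.div h1 (Or.inr (ENNReal.ofReal_pos.2 hkA'.1).ne') hlim'
      (Or.inl ENNReal.ofReal_ne_top)
    simpa using h2

end Equivariant

/-! ### Amenability and finiteness -/

section Finiteness

universe v u
variable {X : Type u} [Groupoid.{v} X] 

theorem tsum_src_indicator_one (S : Set (Elt X)) (x : X) :
    ∑' g : {g : Elt X // src g = x}, S.indicator 1 (g : Elt X) =
      (({g | src g = x ∧ g ∈ S} : Set (Elt X)).encard : ℝ≥0∞) := by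
  have e1 := tsum_subtype {g : Elt X | src g = x} (S.indicator (1 : Elt X → ℝ≥0∞))
  have e2 := tsum_subtype {g : Elt X | src g = x ∧ g ∈ S} (1 : Elt X → ℝ≥0∞)
  rw [← ENNReal.tsum_set_one]
  refine e1.trans (Eq.trans ?_ e2.symm)
  rw [Set.indicator_indicator]
  rfl

theorem tsum_rng_indicator_one (S : Set (Elt X)) (x : X) :
    ∑' g : {g : Elt X // rng g = x}, S.indicator 1 (g : Elt X) =
      (({g | rng g = x ∧ g ∈ S} : Set (Elt X)).encard : ℝ≥0∞) := by
  have e1 := tsum_subtype {g : Elt X | rng g = x} (S.indicator (1 : Elt X → ℝ≥0∞))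
  have e2 := tsum_subtype {g : Elt X | rng g = x ∧ g ∈ S} (1 : Elt X → ℝ≥0∞)
  rw [← ENNReal.tsum_set_one]
  refine e1.trans (Eq.trans ?_ e2.symm)
  rw [Set.indicator_indicator]
  rfl

variable [MeasurableSpace X] [MeasurableSpace (Elt X)] {μ : Measure X}

/-- The uniform distributions on the range fibres show that a subgroupoid with finite fibres is
amenable. -/
theorem isAmenable_of_finite_fibres (hG : IsDiscreteBorel X) {L : Subgroupoid X}
    (hL : MeasurableSet (elts L)) {Y : Set X} {σ : ℕ → Set (Elt X)} (hY : IsAtlas Y σ)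
    (hLY : ∀ w ∈ elts L, rng w ∈ Y) (hfin : ∀ x, {w | rng w = x ∧ w ∈ elts L}.Finite) :
    IsAmenable μ L := by
  let M : X → ℝ≥0∞ := fun x => ∑' w : {w : Elt X // rng w = x}, (elts L).indicator 1 (w : Elt X)
  have hMm : Measurable M :=
    hY.measurable_tsum_rng hG measurable_id (f := fun p => (elts L).indicator 1 p.2)
      ((measurable_one.indicator hL).comp measurable_snd)
      fun _ g hg => Set.indicator_of_notMem (fun h => hg (hLY g h)) _
  have hMfin : ∀ x, M x ≠ ∞ := by
    intro x
    simp only [M]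
    rw [tsum_rng_indicator_one, ENat.toENNReal_ne_top, Set.encard_ne_top_iff]
    exact hfin x
  have hM1 : ∀ w ∈ elts L, 1 ≤ M (rng w) := by
    intro w hw
    refine le_trans ?_ (ENNReal.le_tsum (f := fun w : {w' : Elt X // rng w' = rng w} =>
      (elts L).indicator 1 (w : Elt X)) ⟨w, rfl⟩)
    rw [Set.indicator_of_mem hw]
    rfl
  let W : Elt X → ℝ≥0∞ := fun w => (elts L).indicator 1 w * (M (rng w))⁻¹
  have hW1 : ∀ w, W w ≤ 1 := by
    intro w
    by_cases hw : w ∈ elts L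
    · simp only [W, Set.indicator_of_mem hw, Pi.one_apply, one_mul]
      exact ENNReal.inv_le_one.2 (hM1 w hw)
    · simp [W, hw]
  refine ⟨fun _ w => (W w).toReal, fun _ => ((measurable_one.indicator hL).mul
    (hMm.comp hG.measurable_rng).inv).ennreal_toReal, fun _ w => ⟨ENNReal.toReal_nonneg,
      ENNReal.toReal_le_of_le_ofReal zero_le_one (by simpa using hW1 w)⟩,
    fun _ => Eventually.of_forall fun x hx => ?_, Eventually.of_forall fun k hk => ?_⟩
  · have h1 : ∑' w : {w : Elt X // w ∈ elts L ∧ rng w = x}, W w = 1 := by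
      rw [tsum_rng_fibre_inter fun w _ hw => by simp [W, hw]]
      have e : ∀ w : {w : Elt X // rng w = x},
          W w = (elts L).indicator 1 (w : Elt X) * (M x)⁻¹ := by
        rintro ⟨w, rfl⟩; rfl
      simp_rw [e]
      rw [ENNReal.tsum_mul_right]
      refine ENNReal.mul_inv_cancel ?_ (hMfin x)
      exact (lt_of_lt_of_le zero_lt_one (hM1 _ (mem_objs_iff.1 hx))).ne'
    exact hasSum_toReal_of_tsum_eq_one h1
  · have hMk : M (rng k) = M (src k) := by
      simp only [M]
      rw [← (mulLeftEquiv k).tsum_eq]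
      refine tsum_congr ?_
      rintro ⟨u, hu⟩
      have e : ((mulLeftEquiv k ⟨u, hu⟩ : {w : Elt X // rng w = rng k}) : Elt X) = k * u := rfl
      have : k * u ∈ elts L ↔ u ∈ elts L := by
        refine ⟨fun h => ?_, fun h => elts_mul hk h hu.symm⟩
        have := elts_mul (elts_inv hk) h (by simp)
        rwa [inv_mul_cancel_left' hu.symm] at this
      rw [e]
      by_cases hu' : u ∈ elts L
      · rw [Set.indicator_of_mem hu', Set.indicator_of_mem (this.2 hu')]; rfl
      · rw [Set.indicator_of_notMem hu', Set.indicator_of_notMem (this.not.2 hu')]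
    refine tendsto_const_nhds.congr fun n => (ENNReal.tsum_eq_zero.2 ?_).symm
    rintro ⟨w, hw, hwk⟩
    have e : mul (inv k) w hwk.symm = k⁻¹ * w :=
      (mul_def (g := inv k) (h := w) hwk.symm).symm
    have h1 : k⁻¹ * w ∈ elts L := elts_mul (elts_inv hk) hw hwk.symm
    have h2 : W (k⁻¹ * w) = W w := by
      simp only [W, Set.indicator_of_mem hw, Set.indicator_of_mem h1, rng_mul, hwk, rng_inv, hMk]
      rfl
    simp only [e, h2, sub_self, abs_zero, ENNReal.ofReal_zero]

/-- If `H` is nowhere amenable, then almost every point of a Borel set `A` is the source of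
infinitely many elements of `H` with range in `A`. -/
theorem NowhereAmenable.ae_infinite (hG : IsDiscretePMP μ) {H : Subgroupoid X}
    (hH : MeasurableSet (elts H)) (hHna : NowhereAmenable μ H) {A : Set X} (hA : MeasurableSet A) :
    ∀ᵐ x ∂μ, x ∈ A → {h | src h = x ∧ h ∈ elts H ∩ rng ⁻¹' A}.Infinite := by
  have hB := hG.toIsDiscreteBorel
  obtain ⟨Y, σ, hY, hY0, -⟩ := hG.exists_atlas MeasurableSet.empty
  let C : Set (Elt X) := (elts H ∩ rng ⁻¹' A) ∩ src ⁻¹' Y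
  have hC : MeasurableSet C := (hH.inter (hB.measurable_rng hA)).inter
    (hB.measurable_src hY.measurableSet)
  let N : X → ℝ≥0∞ := fun x => ∑' g : {g : Elt X // src g = x}, C.indicator 1 (g : Elt X)
  have hNm : Measurable N :=
    hY.measurable_tsum_src hB measurable_id (f := fun p => C.indicator 1 p.2)
      ((measurable_one.indicator hC).comp measurable_snd)
      fun _ g hg => Set.indicator_of_notMem (fun h => hg h.2) _
  let Z : Set X := A ∩ Y ∩ {x | N x < ∞}
  have hZ : MeasurableSet Z := (hA.inter hY.measurableSet).inter
    (measurableSet_lt hNm measurable_const)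
  have hNfin : ∀ x ∈ Z, {g | src g = x ∧ g ∈ C}.Finite := by
    intro x hx
    have h : N x ≠ ∞ := ne_of_lt hx.2
    simp only [N] at h
    rwa [tsum_src_indicator_one, ENat.toENNReal_ne_top, Set.encard_ne_top_iff] at h
  have hZ0 : μ Z = 0 := by
    by_contra h0
    refine hHna Z hZ (pos_iff_ne_zero.2 h0) (isAmenable_of_finite_fibres hB (σ := σ) ?_ hY
      (fun w hw => (mem_elts_inf_full.1 hw).2.2.1.2) fun x => ?_)
    · have : elts (H ⊓ Subgroupoid.full Z) = elts H ∩ (src ⁻¹' Z ∩ rng ⁻¹' Z) := by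
        ext g; exact mem_elts_inf_full
      rw [this]
      exact hH.inter ((hB.measurable_src hZ).inter (hB.measurable_rng hZ))
    · by_cases hx : x ∈ Z
      · refine ((hNfin x hx).image inv).subset ?_
        rintro w ⟨rfl, hw⟩
        obtain ⟨h1, h2, -⟩ := mem_elts_inf_full.1 hw
        exact ⟨w⁻¹, ⟨rfl, ⟨elts_inv h1, h2.1.1⟩, hx.1.2⟩, elt_inv_inv w⟩
      · refine Set.finite_empty.subset ?_
        rintro w ⟨rfl, hw⟩
        exact hx (mem_elts_inf_full.1 hw).2.2
  filter_upwards [measure_eq_zero_iff_ae_notMem.1 hZ0, measure_eq_zero_iff_ae_notMem.1 hY0]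
    with x hx hxY hxA hfin
  have hxY' : x ∈ Y := by simpa using hxY
  refine hx ⟨⟨hxA, hxY'⟩, ?_⟩
  have : N x ≠ ∞ := by
    simp only [N]
    rw [tsum_src_indicator_one, ENat.toENNReal_ne_top, Set.encard_ne_top_iff]
    exact hfin.subset fun g hg => ⟨hg.1, hg.2.1⟩
  exact this.lt_top

/-- The case of an equivariant family of nonempty finite sets, with their uniform distributions. -/
theorem IsInvariantMean.exists_isAmenable_of_finite_sets (hG : IsDiscretePMP μ)
    {m : Lp ℝ ∞ (srcMeasure μ) →L[ℝ] ℝ} (hm : IsInvariantMean μ m) {H : Subgroupoid X}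
    (hH : MeasurableSet (elts H)) {Y : Set X} {σ : ℕ → Set (Elt X)} (hY : IsAtlas Y σ)
    (hY0 : μ Yᶜ = 0) (hunit : ∀ x ∈ Y, unit x ∈ elts H)
    {D : Set (Elt X)} (hD : MeasurableSet D) (hDm : meanOf m D ≠ 0) (hDY : ∀ g ∈ D, src g ∈ Y)
    (hDH : ∀ k ∈ elts H, ∀ k' ∈ elts H, ∀ g, src k = src g → src k' = rng g →
      (k' * g * k⁻¹ ∈ D ↔ g ∈ D))
    {R : Set (Elt X × Elt X)} (hR : MeasurableSet R)
    (hRH : ∀ g w, (g, w) ∈ R → w ∈ elts H ∧ rng w = src g ∧ src g ∈ Y)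
    (hRfin : ∀ g ∈ D, {w | (g, w) ∈ R}.Finite) (hRne : ∀ g ∈ D, ∃ w, (g, w) ∈ R)
    (hRe : ∀ g ∈ D, ∀ k ∈ elts H, ∀ k' ∈ elts H, src k = src g → src k' = rng g →
      ∀ w, rng w = src k → ((k' * g * k⁻¹, k * w) ∈ R ↔ (g, w) ∈ R)) :
    ∃ A, MeasurableSet A ∧ 0 < μ A ∧ IsAmenable μ (H ⊓ Subgroupoid.full A) := by
  have hB := hG.toIsDiscreteBorel
  let c : Elt X → ℝ≥0∞ := fun g =>
    ∑' w : {w : Elt X // rng w = src g}, R.indicator 1 (g, (w : Elt X))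
  have hcm : Measurable c := hY.measurable_tsum_rng hB hB.measurable_src
    (f := R.indicator 1) (measurable_one.indicator hR) fun g w hw =>
      Set.indicator_of_notMem (fun h => hw (by obtain ⟨-, h2, h3⟩ := hRH g w h; rwa [h2])) _
  have hc : ∀ g, c g = (({w | rng w = src g ∧ w ∈ {w | (g, w) ∈ R}} : Set (Elt X)).encard : ℝ≥0∞) :=
    fun g => tsum_rng_indicator_one {w | (g, w) ∈ R} (src g)
  have hcfin : ∀ g ∈ D, c g ≠ ∞ := by
    intro g hg
    rw [hc, ENat.toENNReal_ne_top, Set.encard_ne_top_iff]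
    exact (hRfin g hg).subset fun w hw => hw.2
  have hc0 : ∀ g ∈ D, c g ≠ 0 := by
    intro g hg
    obtain ⟨w, hw⟩ := hRne g hg
    rw [hc, ne_eq, ENat.toENNReal_eq_zero, ← ne_eq, Set.encard_ne_zero]
    exact ⟨w, (hRH g w hw).2.1, hw⟩
  refine hm.exists_isAmenable_of_equivariant hG hH hY hY0 hunit hD hDm hDY hDH
    (q := fun p => R.indicator 1 p * (c p.1)⁻¹)
    ((measurable_one.indicator hR).mul (hcm.comp measurable_fst).inv) (fun g hg => ?_)
    (fun g hg w hw => ?_) fun g hg k hk k' hk' h1 h2 w hw => ?_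
  · simp only
    rw [ENNReal.tsum_mul_right]
    exact ENNReal.mul_inv_cancel (hc0 g hg) (hcfin g hg)
  · rw [Set.indicator_of_notMem fun h => hw (hRH g w h).1, zero_mul]
  · have hind : ∀ w, rng w = src k → R.indicator (1 : Elt X × Elt X → ℝ≥0∞) (k' * g * k⁻¹, k * w) =
        R.indicator 1 (g, w) := by
      intro w hw
      have := hRe g hg k hk k' hk' h1 h2 w hw
      by_cases h : (g, w) ∈ R
      · rw [Set.indicator_of_mem h, Set.indicator_of_mem (this.2 h)]; rfl
      · rw [Set.indicator_of_notMem h, Set.indicator_of_notMem (this.not.2 h)]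
    have hsrc : src (k' * g * k⁻¹) = rng k := by
      rw [src_mul (by rw [src_mul h2, rng_inv, h1]), src_inv]
    have hcc : c (k' * g * k⁻¹) = c g := by
      simp only [c]
      rw [hsrc, ← h1, ← (mulLeftEquiv k).tsum_eq]
      exact tsum_congr fun u => hind u u.2
    simp only [hind w hw, hcc]

end Finiteness

section Commensurating

universe v u
variable {X : Type u} [Groupoid.{v} X] [MeasurableSpace X] [MeasurableSpace (Elt X)]
  {μ : Measure X}

/-- Countably many equivariant families of finite sets can be combined into one, by taking the first
of them that is nonempty. -/
theorem IsInvariantMean.exists_isAmenable_of_seq_finite_sets (hG : IsDiscretePMP μ)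
    {m : Lp ℝ ∞ (srcMeasure μ) →L[ℝ] ℝ} (hm : IsInvariantMean μ m) {H : Subgroupoid X}
    (hH : MeasurableSet (elts H)) {Y : Set X} {σ : ℕ → Set (Elt X)} (hY : IsAtlas Y σ)
    (hY0 : μ Yᶜ = 0) (hunit : ∀ x ∈ Y, unit x ∈ elts H)
    {D : Set (Elt X)} (hD : MeasurableSet D) (hDm : meanOf m D ≠ 0) (hDY : ∀ g ∈ D, src g ∈ Y)
    (hDH : ∀ k ∈ elts H, ∀ k' ∈ elts H, ∀ g, src k = src g → src k' = rng g →
      (k' * g * k⁻¹ ∈ D ↔ g ∈ D))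
    {R : ℕ → Set (Elt X × Elt X)} (hR : ∀ n, MeasurableSet (R n))
    (hRH : ∀ n g w, (g, w) ∈ R n → w ∈ elts H ∧ rng w = src g ∧ src g ∈ Y)
    (hRfin : ∀ n, ∀ g ∈ D, {w | (g, w) ∈ R n}.Finite) (hRne : ∀ g ∈ D, ∃ n w, (g, w) ∈ R n)
    (hRe : ∀ n, ∀ g ∈ D, ∀ k ∈ elts H, ∀ k' ∈ elts H, src k = src g → src k' = rng g →
      ∀ w, rng w = src k → ((k' * g * k⁻¹, k * w) ∈ R n ↔ (g, w) ∈ R n)) :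
    ∃ A, MeasurableSet A ∧ 0 < μ A ∧ IsAmenable μ (H ⊓ Subgroupoid.full A) := by
  classical
  have hB := hG.toIsDiscreteBorel
  let E : ℕ → Set (Elt X) := fun n => {g | ∃ w, (g, w) ∈ R n}
  have hE : ∀ n, MeasurableSet (E n) := by
    intro n
    have hc : Measurable fun g : Elt X => ∑' w : {w : Elt X // rng w = src g},
        (R n).indicator (1 : Elt X × Elt X → ℝ≥0∞) (g, (w : Elt X)) :=
      hY.measurable_tsum_rng hB hB.measurable_src (f := (R n).indicator 1)
        (measurable_one.indicator (hR n)) fun g w hw =>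
          Set.indicator_of_notMem (fun h => hw (by obtain ⟨-, h2, h3⟩ := hRH n g w h; rwa [h2])) _
    convert (hc (measurableSet_singleton 0)).compl using 1
    ext g
    simp only [E, Set.mem_ofPred_eq, Set.mem_compl_iff, Set.mem_preimage, Set.mem_singleton_iff,
      ENNReal.tsum_eq_zero, not_forall]
    constructor
    · rintro ⟨w, hw⟩
      exact ⟨⟨w, (hRH n g w hw).2.1⟩, by rw [Set.indicator_of_mem hw]; exact one_ne_zero⟩
    · rintro ⟨w, hw⟩
      exact ⟨w, not_not.1 fun h => hw (Set.indicator_of_notMem h _)⟩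
  have hEe : ∀ n, ∀ g ∈ D, ∀ k ∈ elts H, ∀ k' ∈ elts H, src k = src g → src k' = rng g →
      (k' * g * k⁻¹ ∈ E n ↔ g ∈ E n) := by
    intro n g hg k hk k' hk' h1 h2
    constructor
    · rintro ⟨w, hw⟩
      have hwk : rng w = rng k := by
        rw [(hRH n _ _ hw).2.1, src_mul (by rw [src_mul h2, rng_inv, h1]), src_inv]
      refine ⟨k⁻¹ * w, (hRe n g hg k hk k' hk' h1 h2 _ (by rw [rng_mul, rng_inv])).1 ?_⟩
      rwa [mul_inv_cancel_left' hwk.symm]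
    · rintro ⟨w, hw⟩
      exact ⟨k * w, (hRe n g hg k hk k' hk' h1 h2 w (by rw [(hRH n _ _ hw).2.1, h1])).2 hw⟩
  -- The family with the least index for which the set attached to `g` is nonempty.
  let R' : Set (Elt X × Elt X) := ⋃ n, R n ∩ ⋂ i ∈ Finset.range n, Prod.fst ⁻¹' (E i)ᶜ
  have hR' : ∀ g w, (g, w) ∈ R' ↔ ∃ n, (g, w) ∈ R n ∧ ∀ i < n, g ∉ E i := by
    intro g w
    simp [R']
  refine hm.exists_isAmenable_of_finite_sets hG hH hY hY0 hunit hD hDm hDY hDH (R := R')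
    (MeasurableSet.iUnion fun n => (hR n).inter (Finset.measurableSet_biInter _ fun i _ =>
      measurable_fst (hE i).compl)) ?_ ?_ ?_ ?_
  · intro g w h
    obtain ⟨n, hn, -⟩ := (hR' g w).1 h
    exact hRH n g w hn
  · intro g hg
    have hex : ∃ n, g ∈ E n := hRne g hg
    refine (hRfin (Nat.find hex) g hg).subset fun w hw => ?_
    obtain ⟨n, hn, hmin⟩ := (hR' g w).1 hw
    have : Nat.find hex = n := (Nat.find_eq_iff hex).2 ⟨⟨w, hn⟩, hmin⟩
    rwa [this]
  · intro g hg
    have hex : ∃ n, g ∈ E n := hRne g hg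
    obtain ⟨w, hw⟩ := Nat.find_spec hex
    exact ⟨w, (hR' g w).2 ⟨_, hw, fun i hi => Nat.find_min hex hi⟩⟩
  · intro g hg k hk k' hk' h1 h2 w hw
    rw [hR', hR']
    refine exists_congr fun n => and_congr (hRe n g hg k hk k' hk' h1 h2 w hw) ?_
    exact forall₂_congr fun i _ => (hEe i g hg k hk k' hk' h1 h2).not

/-! ### The subgroupoid generated by the commensurating elements -/

/-- Over a conull set of units that belong to `H` there is an atlas each member of which is
contained in `H` or disjoint from it. -/
theorem NowhereAmenable.exists_atlas (hG : IsDiscretePMP μ) {H : Subgroupoid X}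
    (hH : MeasurableSet (elts H)) (hHna : NowhereAmenable μ H) :
    ∃ Y σ, IsAtlas Y σ ∧ μ Yᶜ = 0 ∧ (∀ n, σ n ⊆ elts H ∨ Disjoint (σ n) (elts H)) ∧
      ∀ x ∈ Y, unit x ∈ elts H := by
  obtain ⟨Y, σ, hY, hY0, hσH⟩ := hG.exists_atlas hH
  have h := hHna.ae_infinite hG hH MeasurableSet.univ
  obtain ⟨N, hN, hNm, hN0, hNinv⟩ := hG.exists_invariant_null (ae_iff.1
    (h.and (measure_eq_zero_iff_ae_notMem.1 hY0)))
  have hgood : ∀ x ∈ Nᶜ, unit x ∈ elts H ∧ x ∈ Y := by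
    intro x hx
    have h := not_not.1 fun h => hx (hN h)
    obtain ⟨g, rfl, hg⟩ := (h.1 trivial).nonempty
    exact ⟨unit_src_mem_elts hg.1, by simpa using h.2⟩
  refine ⟨Nᶜ, _, hY.restrict hG.toIsDiscreteBorel hNm.compl (fun g => (hNinv g).not)
    fun x hx => (hgood x hx).2, by rwa [compl_compl], fun n => ?_, fun x hx => (hgood x hx).1⟩
  exact (hσH n).imp (fun h => Set.inter_subset_left.trans h)
    fun h => h.mono_left Set.inter_subset_left

omit [MeasurableSpace X] [MeasurableSpace (Elt X)] in
theorem mul_inv_mem_conj {H : Subgroupoid X} {σ : Set (Elt X)} (hσ : Set.InjOn src σ) {g h : Elt X}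
    (hg : g ∈ conj (elts H) σ) (hh : h ∈ conj (elts H) σ) (e : src g = src h) :
    g * h⁻¹ ∈ conj (elts H) σ := by
  obtain ⟨a, ha, b, hb, hag, hbg, h1⟩ := mem_conj.1 hg
  obtain ⟨a', ha', b', hb', hah, hbh, h2⟩ := mem_conj.1 hh
  obtain rfl : a = a' := hσ ha ha' (by rw [hag, hah, e])
  have e1 : src g = rng h⁻¹ := e
  refine mem_conj.2 ⟨b', hb', b, hb, ?_, ?_, ?_⟩
  · rw [src_mul e1, src_inv, hbh]
  · rw [rng_mul, hbg]
  have h3 : src (b * g * a⁻¹) = rng (b' * h * a⁻¹)⁻¹ := by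
    rw [rng_inv, src_mul (by rw [src_mul hbg, rng_inv, hag]),
      src_mul (by rw [src_mul hbh, rng_inv, hah])]
  have h4 := elts_mul h1 (elts_inv h2) h3
  have h5 : b * g * a⁻¹ * (b' * h * a⁻¹)⁻¹ = b * (g * h⁻¹) * b'⁻¹ := by
    rw [elt_mul_inv_rev (by rw [src_mul hbh, rng_inv, hah]), elt_mul_inv_rev hbh, elt_inv_inv,
      elt_mul_assoc (by rw [src_mul hbg, rng_inv, hag]) (by rw [src_inv, rng_mul]),
      inv_mul_cancel_left' (by rw [rng_mul, rng_inv, hah]),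
      elt_mul_assoc hbg (by rw [rng_mul, rng_inv, e]),
      elt_mul_assoc (g := b) (by rw [rng_mul, hbg]) (by rw [src_mul e1, src_inv, rng_inv, hbh]),
      elt_mul_assoc e1 (by rw [src_inv, rng_inv, hbh])]
  rwa [h5] at h4

/-- For each member `σ n` of an atlas adapted to `H`, a Borel set `B n` such that the restriction of
`σ n` to `B n` commensurates `H`, and outside of which `H ^ σ n ∩ H` has finite fibres. -/
theorem NowhereAmenable.exists_commensurating_sets (hG : IsDiscretePMP μ) {H : Subgroupoid X}
    (hH : MeasurableSet (elts H)) (hHna : NowhereAmenable μ H) {Y : Set X} {σ : ℕ → Set (Elt X)}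
    (hY : IsAtlas Y σ) :
    ∃ B : ℕ → Set X, (∀ n, MeasurableSet (B n)) ∧ (∀ n, σ n ⊆ elts H → B n = Set.univ) ∧
      (∀ n, ∀ x ∉ B n, {g | src g = x ∧ g ∈ conj (elts H) (σ n) ∩ elts H}.Finite) ∧
      ∀ n, AperiodicOn μ (conj (elts H) (σ n ∩ src ⁻¹' B n) ∩ elts H)
        (src '' (σ n ∩ src ⁻¹' B n)) := by
  classical
  have hB := hG.toIsDiscreteBorel
  let Q : ℕ → Set (Elt X) := fun n => conj (elts H) (σ n) ∩ elts H
  have hQ : ∀ n, MeasurableSet (Q n) := fun n =>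
    (measurableSet_conj hB hH (hY.isPartialBisection n)).inter hH
  have hQY : ∀ n, ∀ g ∈ Q n, src g ∈ Y := by
    intro n g hg
    obtain ⟨a, ha, b, hb, h1, -, -⟩ := mem_conj.1 hg.1
    rw [← h1]
    exact hY.src_mem ha
  let B : ℕ → Set X := fun n =>
    if σ n ⊆ elts H then Set.univ else {x | {g | src g = x ∧ g ∈ Q n}.Infinite}
  have hBm : ∀ n, MeasurableSet (B n) := by
    intro n
    simp only [B]
    split_ifs
    · exact MeasurableSet.univ
    · have hN : Measurable fun x => ∑' g : {g : Elt X // src g = x},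
          (Q n).indicator (1 : Elt X → ℝ≥0∞) g :=
        hY.measurable_tsum_src hB measurable_id (f := fun p => (Q n).indicator 1 p.2)
          ((measurable_one.indicator (hQ n)).comp measurable_snd)
          fun _ g hg => Set.indicator_of_notMem (fun h => hg (hQY n g h)) _
      convert hN (measurableSet_singleton ∞) using 1
      ext x
      simp only [Set.mem_ofPred_eq, Set.mem_preimage, Set.mem_singleton_iff]
      rw [tsum_src_indicator_one, ENat.toENNReal_eq_top, Set.encard_eq_top_iff]
  refine ⟨B, hBm, fun n h => if_pos h, fun n x hx => ?_, fun n => ?_⟩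
  · by_cases h : σ n ⊆ elts H
    · exact absurd (show x ∈ B n by simp only [B, if_pos h]; trivial) hx
    · simp only [B, if_neg h] at hx
      exact Set.not_infinite.1 hx
  · by_cases h : σ n ⊆ elts H
    · have hBn : B n = Set.univ := if_pos h
      rw [hBn, Set.preimage_univ, Set.inter_univ]
      filter_upwards [hHna.ae_infinite hG hH
        (measurableSet_src_image hB (hY.isPartialBisection n))] with x hx hxσ
      refine (hx hxσ).mono ?_
      rintro g ⟨rfl, hgH, b, hb, hbg⟩
      obtain ⟨a, ha, hag⟩ := hxσ
      refine ⟨rfl, mem_conj.2 ⟨a, ha, b, hb, hag, hbg, ?_⟩, hgH⟩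
      refine elts_mul (elts_mul (h hb) hgH hbg) (elts_inv (h ha)) ?_
      rw [src_mul hbg, rng_inv, hag]
    · have hBn : B n = {x | {g | src g = x ∧ g ∈ Q n}.Infinite} := if_neg h
      refine Eventually.of_forall ?_
      rintro _ ⟨a, ⟨haσ, haB⟩, rfl⟩
      have hinf : {g | src g = src a ∧ g ∈ Q n}.Infinite := by
        rw [hBn] at haB; exact haB
      refine hinf.mono ?_
      rintro g ⟨hga, hgQ⟩
      refine ⟨hga, ?_, hgQ.2⟩
      obtain ⟨a', ha', b, hb, h1, h2, h3⟩ := mem_conj.1 hgQ.1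
      obtain rfl : a' = a := (hY.isPartialBisection n).src_injOn ha' haσ (h1.trans hga)
      refine mem_conj.2 ⟨a', ⟨haσ, haB⟩, b, ⟨hb, ?_⟩, h1, h2, h3⟩
      -- Right translation by `g⁻¹` maps the fibre over `src g` to the fibre over `rng g`.
      rw [Set.mem_preimage, hBn, h2]
      have hinj : Set.InjOn (fun h => h * g⁻¹) {h | src h = src a' ∧ h ∈ Q n} := by
        rintro h ⟨hh, -⟩ h' ⟨hh', -⟩ e
        have e' : h * g⁻¹ = h' * g⁻¹ := e
        rw [← inv_mul_cancel_right' (hh.trans hga.symm), e',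
          inv_mul_cancel_right' (hh'.trans hga.symm)]
      refine (hinf.image hinj).mono ?_
      rintro _ ⟨h, ⟨hh, hhQ⟩, rfl⟩
      have hhg : src h = src g := hh.trans hga.symm
      refine ⟨by simp only; rw [src_mul (by rw [rng_inv, hhg]), src_inv],
        mul_inv_mem_conj (hY.isPartialBisection n).src_injOn hhQ.1 hgQ.1 hhg,
        elts_mul hhQ.2 (elts_inv hgQ.2) (by rw [rng_inv, hhg])⟩

/-- The complement of the set generated by the commensurating elements has mass zero for every
invariant mean: it maps equivariantly to the finite subsets of the range fibres of `H`, so that a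
positive mass would make some restriction of `H` amenable. -/
theorem IsInvariantMean.meanOf_compl_generatedSet (hG : IsDiscretePMP μ)
    {m : Lp ℝ ∞ (srcMeasure μ) →L[ℝ] ℝ} (hm : IsInvariantMean μ m) {H : Subgroupoid X}
    (hH : MeasurableSet (elts H)) (hHna : NowhereAmenable μ H) {Y : Set X} {σ : ℕ → Set (Elt X)}
    (hY : IsAtlas Y σ) (hY0 : μ Yᶜ = 0) (hunit : ∀ x ∈ Y, unit x ∈ elts H)
    {B : ℕ → Set X} (hBm : ∀ n, MeasurableSet (B n))
    (hfin : ∀ n, ∀ x ∉ B n, {g | src g = x ∧ g ∈ conj (elts H) (σ n) ∩ elts H}.Finite)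
    (hHS : ∀ g ∈ elts H, src g ∈ Y → g ∈ ⋃ n, σ n ∩ src ⁻¹' B n) :
    meanOf m (src ⁻¹' Y \ generatedSet (⋃ n, σ n ∩ src ⁻¹' B n)) = 0 := by
  have hB := hG.toIsDiscreteBorel
  set S : Set (Elt X) := ⋃ n, σ n ∩ src ⁻¹' B n with hS
  set D : Set (Elt X) := src ⁻¹' Y \ generatedSet S with hDdef
  have hD : MeasurableSet D := (hB.measurable_src hY.measurableSet).diff
    (measurableSet_generatedSet hB fun n =>
      (hY.isPartialBisection n).inter (hB.measurable_src (hBm n)))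
  by_contra hne
  -- The finite set attached to `g` consists of those `w` in `H` for which `g * w` lies in `H τ n`,
  -- for a fixed `n`. Two such `w` differ by an element of `H ^ σ n ∩ H` with source outside `B n`.
  let τ : ℕ → Set (Elt X) := fun n => σ n ∩ src ⁻¹' (B n)ᶜ
  have hτ : ∀ n, IsPartialBisection (τ n) := fun n =>
    (hY.isPartialBisection n).inter (hB.measurable_src (hBm n).compl)
  let Q : ℕ → Set (Elt X) := fun n => setMul (elts H) (τ n)
  have hQ : ∀ n, MeasurableSet (Q n) := fun n => measurableSet_setMul hB hH (hτ n)
  have hQH : ∀ n, ∀ k ∈ elts H, ∀ g, src k = rng g → (k * g ∈ Q n ↔ g ∈ Q n) := by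
    have aux : ∀ n, ∀ k ∈ elts H, ∀ g, src k = rng g → g ∈ Q n → k * g ∈ Q n := by
      rintro n k hk _ e hg
      obtain ⟨h, hh, t, ht, e', rfl⟩ := mem_setMul.1 hg
      rw [rng_mul] at e
      exact mem_setMul.2 ⟨k * h, elts_mul hk hh e, t, ht, by rw [src_mul e, e'],
        elt_mul_assoc e e'⟩
    refine fun n k hk g e => ⟨fun h => ?_, aux n k hk g e⟩
    have := aux n k⁻¹ (elts_inv hk) (k * g) (by simp) h
    rwa [inv_mul_cancel_left' e] at this
  let R : ℕ → Set (Elt X × Elt X) := fun n =>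
    {p | src p.1 = rng p.2} ∩ ((fun p => p.1 * p.2) ⁻¹' Q n) ∩ (Prod.snd ⁻¹' elts H) ∩
      (src ∘ Prod.fst) ⁻¹' Y
  have := hG.standardBorel_units
  have hR : ∀ n, MeasurableSet (R n) := fun n =>
    (((measurableSet_eq_fun (hB.measurable_src.comp measurable_fst)
      (hB.measurable_rng.comp measurable_snd)).inter (hB.measurable_mul' (hQ n))).inter
      (measurable_snd hH)).inter ((hB.measurable_src.comp measurable_fst) hY.measurableSet)
  suffices h : ∃ A, MeasurableSet A ∧ 0 < μ A ∧ IsAmenable μ (H ⊓ Subgroupoid.full A) by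
    obtain ⟨A, hA, hA0, hAam⟩ := h
    exact hHna A hA hA0 hAam
  refine hm.exists_isAmenable_of_seq_finite_sets hG hH hY hY0 hunit hD hne
    (fun g hg => hg.1) ?_ hR ?_ ?_ ?_ ?_
  · intro k hk k' hk' g e e'
    have e1 : src (k' * g) = rng k⁻¹ := by rw [src_mul e', rng_inv, e]
    have hs : src (k' * g * k⁻¹) = rng k := by rw [src_mul e1, src_inv]
    refine and_congr (by rw [Set.mem_preimage, hs, ← hY.src_mem_iff, e, Set.mem_preimage]) ?_
    by_cases hg : src g ∈ Y
    · have hkS := subset_generatedSet _ (hHS k hk (e ▸ hg))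
      have hkS' := subset_generatedSet _ (hHS k' hk' (e' ▸ (hY.src_mem_iff g).1 hg))
      refine not_congr ⟨fun h => ?_, fun h => ?_⟩
      · have h1 := generatedSet_mul (generatedSet_mul (generatedSet_inv hkS') h (by simp)) hkS (by
          rw [src_mul (by simp), hs])
        rwa [elt_mul_assoc e' (by rw [rng_inv, e]),
          inv_mul_cancel_left' (by rw [rng_mul, e']), inv_mul_cancel_right' e.symm] at h1
      · exact generatedSet_mul (generatedSet_mul hkS' h e') (generatedSet_inv hkS) e1
    · have hgen : ∀ g ∈ generatedSet S, src g ∈ Y := fun g =>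
        generatedSet_src_mem hY.src_mem_iff fun g hg => by
          obtain ⟨n, hn⟩ := Set.mem_iUnion.1 hg
          exact hY.src_mem hn.1
      refine not_congr (iff_of_false (fun h => hg ?_) fun h => hg (hgen _ h))
      have := hgen _ h
      rwa [hs, ← hY.src_mem_iff, e] at this
  · rintro n g w ⟨⟨⟨h1, -⟩, h2⟩, h3⟩
    exact ⟨h2, h1.symm, h3⟩
  · intro n g hg
    by_cases hne' : ∃ w₀, (g, w₀) ∈ R n
    swap
    · exact Set.finite_empty.subset fun w hw => hne' ⟨w, hw⟩
    obtain ⟨w₀, ⟨⟨e₀, hw₀⟩, hw₀H⟩, -⟩ := hne'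
    obtain ⟨h₀, hh₀, t₀, ht₀, eh₀, ht₀eq⟩ := mem_setMul.1 hw₀
    have e₀' : src g = rng w₀ := e₀
    have ht₀eq' : h₀ * t₀ = g * w₀ := ht₀eq
    have hst₀ : src t₀ = src w₀ := by rw [← src_mul eh₀, ht₀eq', src_mul e₀']
    refine ((hfin n (src w₀) (hst₀ ▸ ht₀.2)).image fun l => w₀ * l⁻¹).subset ?_
    rintro w ⟨⟨⟨e, hw⟩, hwH⟩, -⟩
    have e' : src g = rng w := e
    obtain ⟨h, hh, t, ht, eh, hteq⟩ := mem_setMul.1 hw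
    have hteq' : h * t = g * w := hteq
    have hst : src t = src w := by rw [← src_mul eh, hteq', src_mul e']
    have ew : src w⁻¹ = rng w₀ := by rw [src_inv, ← e', e₀']
    refine ⟨w⁻¹ * w₀, ⟨src_mul ew, mem_conj.2 ⟨t₀, ht₀.1, t, ht.1, ?_, ?_, ?_⟩,
      elts_mul (elts_inv hwH) hw₀H ew⟩, ?_⟩
    · rw [src_mul ew, hst₀]
    · rw [rng_mul, rng_inv, hst]
    · have ht' : t = h⁻¹ * (g * w) := by rw [← hteq', inv_mul_cancel_left' eh]
      have ht₀' : t₀ = h₀⁻¹ * (g * w₀) := by rw [← ht₀eq', inv_mul_cancel_left' eh₀]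
      have hrh : rng h = rng g := by rw [← rng_mul h t, hteq', rng_mul]
      have hrh₀ : rng h₀ = rng g := by rw [← rng_mul h₀ t₀, ht₀eq', rng_mul]
      have key : t * (w⁻¹ * w₀) * t₀⁻¹ = h⁻¹ * h₀ := by
        have e3 : src (h⁻¹ * (g * w)) = rng w⁻¹ := by
          rw [src_mul (by rw [src_inv, rng_mul, hrh]), src_mul e', rng_inv]
        have e4 : src h⁻¹ = rng (g * w) := by rw [src_inv, rng_mul, hrh]
        have e5 : t * w⁻¹ = h⁻¹ * g := by
          rw [ht', elt_mul_assoc e4 (by rw [src_mul e', rng_inv]), mul_inv_cancel_right' e']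
        rw [← elt_mul_assoc (by rw [ht', e3]) ew, e5, elt_mul_assoc (by rw [src_inv, hrh]) e₀',
          ← ht₀eq', elt_mul_assoc (by rw [src_inv, rng_mul, hrh, hrh₀])
            (by rw [src_mul eh₀, rng_inv]), mul_inv_cancel_right' eh₀]
      rw [key]
      exact elts_mul (elts_inv hh) hh₀ (by rw [src_inv, hrh, hrh₀])
    · simp only
      rw [elt_mul_inv_rev ew, elt_inv_inv, mul_inv_cancel_left' ew.symm]
  · intro g hg
    obtain ⟨n, hn⟩ := hY.exists_mem hg.1
    have hgB : src g ∉ B n := fun h =>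
      hg.2 (subset_generatedSet _ (Set.mem_iUnion.2 ⟨n, hn, h⟩))
    refine ⟨n, unit (src g), ⟨⟨(rng_unit _).symm, ?_⟩, hunit _ hg.1⟩, hg.1⟩
    change g * unit (src g) ∈ Q n
    rw [mul_unit rfl]
    exact mem_setMul.2 ⟨unit (rng g), hunit _ ((hY.src_mem_iff g).1 hg.1), g, ⟨hn, hgB⟩,
      src_unit _, unit_mul rfl⟩
  · intro n g hg k hk k' hk' h1 h2 w hw
    have e1 : src (k' * g) = rng k⁻¹ := by rw [src_mul h2, rng_inv, h1]
    have hs : src (k' * g * k⁻¹) = rng k := by rw [src_mul e1, src_inv]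
    have e2 : src g = rng w := by rw [hw, h1]
    have e3 : k' * g * k⁻¹ * (k * w) = k' * (g * w) := by
      rw [elt_mul_assoc e1 (by rw [src_inv, rng_mul]), inv_mul_cancel_left' hw.symm,
        elt_mul_assoc h2 e2]
    have hQ' := hQH n k' hk' (g * w) (by rw [rng_mul, h2])
    have hkw : k * w ∈ elts H ↔ w ∈ elts H := by
      refine ⟨fun h => ?_, fun h => elts_mul hk h hw.symm⟩
      have := elts_mul (elts_inv hk) h (by simp)
      rwa [inv_mul_cancel_left' hw.symm] at this
    change ((src (k' * g * k⁻¹) = rng (k * w) ∧ k' * g * k⁻¹ * (k * w) ∈ Q n) ∧ k * w ∈ elts H) ∧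
      src (k' * g * k⁻¹) ∈ Y ↔ ((src g = rng w ∧ g * w ∈ Q n) ∧ w ∈ elts H) ∧ src g ∈ Y
    rw [e3, hQ', hkw, hs, ← hY.src_mem_iff, h1, rng_mul]
    simp only [e2, true_and]

end Commensurating

/-! ### Aperiodicity of sets of full mean -/

section Aperiodicity

universe v u
variable {X : Type u} [Groupoid.{v} X] [MeasurableSpace X] [MeasurableSpace (Elt X)]
  {μ : Measure X} {m : Lp ℝ ∞ (srcMeasure μ) →L[ℝ] ℝ}

theorem IsInvariantMean.meanOf_univ (hG : IsDiscretePMP μ) (hm : IsInvariantMean μ m) :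
    meanOf m (Set.univ : Set (Elt X)) = 1 := by
  have := hG.prob
  have h := hm.src_preimage Set.univ MeasurableSet.univ
  rwa [Set.preimage_univ, probReal_univ] at h

theorem IsInvariantMean.meanOf_compl (hG : IsDiscretePMP μ) (hm : IsInvariantMean μ m)
    {D : Set (Elt X)} (hD : MeasurableSet D) : meanOf m Dᶜ = 1 - meanOf m D := by
  have h := meanOf_inter_add_diff (m := m) MeasurableSet.univ hD
  rw [Set.univ_inter, ← Set.compl_eq_univ_sdiff, hm.meanOf_univ hG] at h
  linarith

theorem IsInvariantMean.meanOf_union_eq_zero (hm : IsInvariantMean μ m) {D E : Set (Elt X)}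
    (hD : MeasurableSet D) (hE : MeasurableSet E) (hD0 : meanOf m D = 0) (hE0 : meanOf m E = 0) :
    meanOf m (D ∪ E) = 0 := by
  have h1 := meanOf_union (m := m) hD (hE.diff hD) Set.disjoint_sdiff_right
  have h2 := meanOf_mono hm.nonneg (hE.diff hD) hE Set.sdiff_subset
  have h3 := meanOf_nonneg hm.nonneg (E \ D)
  rw [Set.union_sdiff_self] at h1
  linarith

theorem IsInvariantMean.meanOf_iUnion_eq_zero (hm : IsInvariantMean μ m) {n : ℕ}
    {E : Fin n → Set (Elt X)} (hE : ∀ i, MeasurableSet (E i)) (hE0 : ∀ i, meanOf m (E i) = 0) :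
    meanOf m (⋃ i, E i) = 0 := by
  classical
  have key : ∀ s : Finset (Fin n), meanOf m (⋃ i ∈ s, E i) = 0 := by
    intro s
    induction s using Finset.induction_on with
    | empty => simpa using meanOf_empty (m := m)
    | insert i s _ ih =>
      rw [Finset.set_biUnion_insert]
      exact hm.meanOf_union_eq_zero (hE i) (Finset.measurableSet_biUnion s fun i _ => hE i)
        (hE0 i) ih
  simpa using key Finset.univ

/-- A set of full mean is aperiodic: if it had at most `N` points in each source fibre over a set
`Z` of positive measure, then its part over `Z` would have finite measure, hence mass zero, whereas
the mass of `src⁻¹ Z` is the measure of `Z`. -/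
theorem IsInvariantMean.aperiodic (hG : IsDiscretePMP μ) (hm : IsInvariantMean μ m)
    {E : Set (Elt X)} (hE : MeasurableSet E) (hE0 : meanOf m Eᶜ = 0) : Aperiodic μ E := by
  have hB := hG.toIsDiscreteBorel
  have := hG.prob
  obtain ⟨Y, σ, hY, hY0, -⟩ := hG.exists_atlas MeasurableSet.empty
  let C : Set (Elt X) := E ∩ src ⁻¹' Y
  have hC : MeasurableSet C := hE.inter (hB.measurable_src hY.measurableSet)
  let N : X → ℝ≥0∞ := fun x => ∑' g : {g : Elt X // src g = x}, C.indicator 1 (g : Elt X)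
  have hNm : Measurable N :=
    hY.measurable_tsum_src hB measurable_id (f := fun p => C.indicator 1 p.2)
      ((measurable_one.indicator hC).comp measurable_snd)
      fun _ g hg => Set.indicator_of_notMem (fun h => hg h.2) _
  let Z : ℕ → Set X := fun n => {x | N x ≤ n} ∩ Y
  have hZ : ∀ n, MeasurableSet (Z n) := fun n =>
    (measurableSet_le hNm measurable_const).inter hY.measurableSet
  have hZ0 : ∀ n, μ (Z n) = 0 := by
    intro n
    have hZm := hB.measurable_src (hZ n)
    have hfin : srcMeasure μ (src ⁻¹' Z n ∩ E) < ∞ := by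
      rw [← lintegral_indicator_one (hZm.inter hE),
        hG.lintegral_src (measurable_one.indicator (hZm.inter hE))]
      refine (lintegral_mono (g := fun _ => (n : ℝ≥0∞)) fun x => ?_).trans_lt
        (by simp)
      by_cases hx : x ∈ Z n
      · refine le_trans (ENNReal.tsum_le_tsum fun g => ?_) hx.1
        have hsub : src ⁻¹' Z n ∩ E ⊆ C := fun g hg => ⟨hg.2, hg.1.2⟩
        exact Set.indicator_le_indicator_of_subset hsub (fun _ => zero_le) _
      · refine le_of_eq_of_le (ENNReal.tsum_eq_zero.2 ?_) zero_le
        rintro ⟨g, rfl⟩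
        exact Set.indicator_of_notMem (fun h => hx h.1) _
    have h1 := hm.diffuse _ (hZm.inter hE) hfin
    have h2 := meanOf_mono hm.nonneg (hZm.diff hE) hE.compl fun g hg => hg.2
    have h3 := meanOf_nonneg hm.nonneg (src ⁻¹' Z n \ E)
    have h4 := meanOf_inter_add_diff (m := m) hZm hE
    rw [hm.src_preimage _ (hZ n)] at h4
    exact (measureReal_eq_zero_iff).1 (by linarith)
  filter_upwards [measure_eq_zero_iff_ae_notMem.1 hY0,
    measure_eq_zero_iff_ae_notMem.1 (measure_iUnion_null hZ0)] with x hxY hx _ hfin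
  have hxY' : x ∈ Y := by simpa using hxY
  have hNx : N x ≠ ∞ := by
    simp only [N]
    rw [tsum_src_indicator_one, ENat.toENNReal_ne_top, Set.encard_ne_top_iff]
    exact hfin.subset fun g hg => ⟨hg.1, hg.2.1⟩
  obtain ⟨n, hn⟩ := ENNReal.exists_nat_gt hNx
  exact hx (Set.mem_iUnion.2 ⟨n, hn.le, hxY'⟩)

theorem IsInvariantMean.aperiodic_inter_conj (hG : IsDiscretePMP μ) (hm : IsInvariantMean μ m)
    {D : Set (Elt X)} (hD : MeasurableSet D) (hD0 : meanOf m Dᶜ = 0) {n : ℕ}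
    {σ : Fin n → Set (Elt X)} (hσ : ∀ i, IsBisection μ (σ i)) :
    Aperiodic μ (D ∩ ⋂ i, conj D (σ i)) := by
  have hc : ∀ i, MeasurableSet (conj D (σ i)) := fun i =>
    measurableSet_conj hG.toIsDiscreteBorel hD (hσ i).toIsPartialBisection
  refine hm.aperiodic hG (hD.inter (MeasurableSet.iInter hc)) ?_
  rw [Set.compl_inter, Set.compl_iInter]
  refine hm.meanOf_union_eq_zero hD.compl (MeasurableSet.iUnion fun i => (hc i).compl) hD0
    (hm.meanOf_iUnion_eq_zero (fun i => (hc i).compl) fun i => ?_)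
  rw [hm.meanOf_compl hG (hc i), hm.conj_eq D _ hD (hσ i), ← hm.meanOf_compl hG hD, hD0]

/-- A subgroupoid of full mean is q-normal, since the groupoid is covered by countably many
bisections up to a null set. -/
theorem IsInvariantMean.qNormal_top (hG : IsDiscretePMP μ) (hm : IsInvariantMean μ m)
    {K : Subgroupoid X} (hK : MeasurableSet (elts K)) (hK0 : meanOf m (elts K)ᶜ = 0) :
    QNormal μ K ⊤ := by
  have hB := hG.toIsDiscreteBorel
  obtain ⟨Y, σ, hY, hY0, -⟩ := hG.exists_atlas MeasurableSet.empty
  obtain ⟨φ, hφ, -, hcov⟩ := hY.exists_fullSections hB MeasurableSet.univ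
  refine ⟨le_top, Set.range fun j => Set.range (φ j), Set.countable_range _, ?_, ?_, ?_⟩
  · rintro _ ⟨j, rfl⟩
    exact ⟨(hφ j).isPartialBisection hB, fun g _ => by rw [elts_top]; trivial⟩
  · rw [hG.ae_iff_src]
    filter_upwards [measure_eq_zero_iff_ae_notMem.1 hY0] with x hx
    rintro g rfl -
    obtain ⟨j, hj⟩ := hcov g trivial (by simpa using hx)
    exact subset_generatedSet _ ⟨_, ⟨j, rfl⟩, _, hj⟩
  · rintro _ ⟨j, rfl⟩
    have h := hm.aperiodic_inter_conj hG hK hK0 (n := 1) (σ := fun _ => Set.range (φ j))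
      fun _ => (hφ j).isBisection hB
    filter_upwards [h] with x hx _
    refine (hx trivial).mono fun g hg => ⟨hg.1, ?_, hg.2.1⟩
    exact Set.mem_iInter.1 hg.2.2 0

/-- A nowhere amenable subgroupoid is q-normal in a subgroupoid that has full mean for every
invariant mean. -/
theorem NowhereAmenable.exists_qNormal (hG : IsDiscretePMP μ) (hm : IsInvariantMean μ m)
    {H : Subgroupoid X} (hH : MeasurableSet (elts H)) (hHna : NowhereAmenable μ H) :
    ∃ K : Subgroupoid X, MeasurableSet (elts K) ∧ QNormal μ H K ∧ meanOf m (elts K)ᶜ = 0 := by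
  have hB := hG.toIsDiscreteBorel
  have := hG.prob
  obtain ⟨Y, σ, hY, hY0, hσH, hunit⟩ := hHna.exists_atlas hG hH
  obtain ⟨B, hBm, hBH, hfin, haper⟩ := hHna.exists_commensurating_sets hG hH hY
  -- Over `Y` the set `S` contains `H`; the union with `H` only serves to include its elements
  -- outside `Y`.
  let S : Set (Elt X) := ⋃ n, σ n ∩ src ⁻¹' B n
  have hσ' : ∀ n, IsPartialBisection (σ n ∩ src ⁻¹' B n) := fun n =>
    (hY.isPartialBisection n).inter (hB.measurable_src (hBm n))
  have hgenm : MeasurableSet (generatedSet S) := measurableSet_generatedSet hB hσ'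
  have hHS : ∀ g ∈ elts H, src g ∈ Y → g ∈ S := by
    intro g hg hgY
    obtain ⟨n, hn⟩ := hY.exists_mem hgY
    refine Set.mem_iUnion.2 ⟨n, hn, ?_⟩
    have := (hσH n).resolve_right fun h => Set.disjoint_left.1 h hn hg
    rw [hBH n this]
    trivial
  have hgenY : ∀ g ∈ generatedSet S, src g ∈ Y := fun g =>
    generatedSet_src_mem hY.src_mem_iff fun g hg => by
      obtain ⟨n, hn⟩ := Set.mem_iUnion.1 hg
      exact hY.src_mem hn.1
  let K : Subgroupoid X := subgroupoidOf (elts H ∪ generatedSet S)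
    (fun g hg => hg.imp elts_inv generatedSet_inv) (by
      rintro g (hg | hg) h (hh | hh) e
      · exact Or.inl (elts_mul hg hh e)
      · refine Or.inr (generatedSet_mul (subset_generatedSet _ (hHS g hg ?_)) hh e)
        rw [e, ← hY.src_mem_iff]
        exact hgenY h hh
      · refine Or.inr (generatedSet_mul hg (subset_generatedSet _ (hHS h hh ?_)) e)
        rw [hY.src_mem_iff, ← e]
        exact hgenY g hg
      · exact Or.inr (generatedSet_mul hg hh e))
  have hK : elts K = elts H ∪ generatedSet S := rfl
  refine ⟨K, hH.union hgenm, ⟨le_iff_elts_subset.2 Set.subset_union_left,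
    Set.range fun n => σ n ∩ src ⁻¹' B n, Set.countable_range _, ?_, ?_, ?_⟩, ?_⟩
  · rintro _ ⟨n, rfl⟩
    exact ⟨hσ' n, fun g hg => Or.inr (subset_generatedSet _ (Set.mem_iUnion.2 ⟨n, hg⟩))⟩
  · rw [hG.ae_iff_src]
    filter_upwards [measure_eq_zero_iff_ae_notMem.1 hY0] with x hx
    rintro g rfl hg
    rw [Set.sUnion_range]
    exact hg.elim (fun h => subset_generatedSet _ (hHS g h (by simpa using hx))) id
  · rintro _ ⟨n, rfl⟩
    exact haper n
  · have h1 := hm.meanOf_compl_generatedSet hG hH hHna hY hY0 hunit hBm hfin hHS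
    have h2 : meanOf m (src ⁻¹' Yᶜ : Set (Elt X)) = 0 := by
      rw [hm.src_preimage _ hY.measurableSet.compl, Measure.real, hY0, ENNReal.toReal_zero]
    have hYm := hB.measurable_src hY.measurableSet
    have hYm' := hB.measurable_src hY.measurableSet.compl
    have h3 := hm.meanOf_union_eq_zero (hYm.diff hgenm) hYm' h1 h2
    refine le_antisymm ?_ (meanOf_nonneg hm.nonneg _)
    rw [← h3]
    refine meanOf_mono hm.nonneg (hH.union hgenm).compl ((hYm.diff hgenm).union hYm') fun g hg => ?_
    by_cases hgY : src g ∈ Y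
    · exact Or.inl ⟨hgY, fun h => hg (Or.inr h)⟩
    · exact Or.inr hgY

end Aperiodicity

end PMPGroupoid

theorem theorem2 {X : Type*} [CategoryTheory.Groupoid X]
    [MeasurableSpace X] [MeasurableSpace (PMPGroupoid.Elt X)]
    (μ : MeasureTheory.Measure X) (hG : PMPGroupoid.IsDiscretePMP μ)
    (hinner : PMPGroupoid.InnerAmenable μ)
    (H : CategoryTheory.Subgroupoid X)
    (hH_meas : MeasurableSet (PMPGroupoid.elts H))
    (hH : PMPGroupoid.NowhereAmenable μ H) :
    ∃ K : CategoryTheory.Subgroupoid X,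
      MeasurableSet (PMPGroupoid.elts K) ∧
      PMPGroupoid.QNormal μ H K ∧
      PMPGroupoid.QNormal μ K ⊤ ∧
      ∀ (n : ℕ) (σ : Fin n → Set (PMPGroupoid.Elt X)),
        (∀ i, PMPGroupoid.IsBisection μ (σ i)) →
        PMPGroupoid.Aperiodic μ
          (PMPGroupoid.elts K ∩ ⋂ i, PMPGroupoid.conj (PMPGroupoid.elts K) (σ i)) := by
  obtain ⟨m, hm⟩ := hinner.exists_isInvariantMean hG
  obtain ⟨K, hK, hHK, hK0⟩ := hH.exists_qNormal hG hm hH_meas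
  exact ⟨K, hK, hHK, hm.qNormal_top hG hK hK0, fun n σ hσ => hm.aperiodic_inter_conj hG hK hK0 hσ⟩
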